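/- Let $E=1$ and, for $u,\xi\in\mathbb C\cong\mathbb R^2$ with $\xi\neq 0$, let $$\widetilde S(u,\xi)=(\xi^3+\bar\xi^3)\Big(1-\frac{3}{\xi\bar\xi}\Big)+\frac12(\bar u\xi+u\bar\xi).$$ For every $0\le\alpha\le\frac14$ and every $\varepsilon>0$ there is a constant $C>0$, depending on $\alpha$ and $\varepsilon$ only, such that for all $t>0$ and all $u\in\mathbb C$ the improper integral $$I=I(t,u)=\int_{\mathbb C}|\xi|^{\alpha}e^{it\widetilde S(u,\xi)}\,d\operatorname{Re}\xi\,d\operatorname{Im}\xi=\lim_{R\to\infty}\int_{|\xi|\le R}|\xi|^{\alpha}e^{it\widetilde S(u,\xi)}\,d\operatorname{Re}\xi\,d\operatorname{Im}\xi$$ converges, and its value satisfies 1. $|I|\le C\,t^{-3/4+\varepsilon}$ whenever $t\ge1$, and also for all $t>0$ if $\varepsilon\le\frac{1-4\alpha}{12}$; 2. $|I|\le C\,t^{-(\alpha+2)/3}$ for $0<t\le1$. (For $0\le\alpha<\frac14$, part 1 gives $|I|\le C\,t^{-3/4+\varepsilon}$ for all $t>0$ and all small $\varepsilon>0$, namely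 $0<\varepsilon\le\frac{1-4\alpha}{12}$. For $\alpha=\frac14$ it gives this for $t\ge1$ and every $\varepsilon>0$, and part 2 gives $|I|\le C\,t^{-3/4}$ for $0<t\le1$.) -/

import Mathlib

/-- The phase `S̃(u, ξ) = (ξ³ + ξ̄³) (1 - 3 E / (ξ ξ̄)) + (ū ξ + u ξ̄) / 2` of the linearized
Novikov-Veselov equation at energy `E`, with `ℝ²` identified with `ℂ`. Its values are real numbers,
seen as complex numbers. At `ξ = 0` the formula gives `0`, which is also the limit there. -/
noncomputable def nvPhase (E : ℝ) (u ξ : ℂ) : ℂ :=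
  (ξ ^ 3 + (starRingEnd ℂ) ξ ^ 3) * (1 - 3 * (E : ℂ) / (ξ * (starRingEnd ℂ) ξ))
    + 1 / 2 * ((starRingEnd ℂ) u * ξ + u * (starRingEnd ℂ) ξ)

/-- The integrand `|ξ|^α e^{i t S̃(u, ξ)}`. -/
noncomputable def nvIntegrand (E α t : ℝ) (u ξ : ℂ) : ℂ :=
  ((‖ξ‖ ^ α : ℝ) : ℂ) * Complex.exp (Complex.I * (t : ℂ) * nvPhase E u ξ)

/-- `J` is the value of the oscillatory integral `∫_ℂ |ξ|^α e^{i t S̃(u, ξ)} dRe ξ dIm ξ`. The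
integrand has modulus `|ξ|^α`, so that the integral never converges absolutely; it is the
improper integral, the limit as `R → ∞` of the (absolutely convergent) integrals over the discs
`|ξ| ≤ R` with respect to Lebesgue measure on the plane. -/
def IsNVIntegral (E α t : ℝ) (u J : ℂ) : Prop :=
  Filter.Tendsto
    (fun R : ℝ => ∫ ξ in Metric.closedBall (0 : ℂ) R, nvIntegrand E α t u ξ)
    Filter.atTop (nhds J)

open MeasureTheory Filter Topology

namespace NovikovVeselov

/-- A phase on the plane, `2π`-periodic in its second variable, with its partial derivatives
`P`, `Q` of first order and `P₁`, `P₂`, `Q₂` of second order. -/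
structure PlanePhase where
  ψ : ℝ × ℝ → ℝ
  P : ℝ × ℝ → ℝ
  Q : ℝ × ℝ → ℝ
  P₁ : ℝ × ℝ → ℝ
  P₂ : ℝ × ℝ → ℝ
  Q₂ : ℝ × ℝ → ℝ
  diff_ψ : Differentiable ℝ ψ
  diff_P : Differentiable ℝ P
  diff_Q : Differentiable ℝ Q
  cont_P₁ : Continuous P₁
  cont_P₂ : Continuous P₂
  cont_Q₂ : Continuous Q₂
  deriv_ψ_fst : ∀ x y, HasDerivAt (fun s => ψ (s, y)) (P (x, y)) x
  deriv_ψ_snd : ∀ x y, HasDerivAt (fun s => ψ (x, s)) (Q (x, y)) y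
  deriv_P_fst : ∀ x y, HasDerivAt (fun s => P (s, y)) (P₁ (x, y)) x
  deriv_P_snd : ∀ x y, HasDerivAt (fun s => P (x, s)) (P₂ (x, y)) y
  deriv_Q_fst : ∀ x y, HasDerivAt (fun s => Q (s, y)) (P₂ (x, y)) x
  deriv_Q_snd : ∀ x y, HasDerivAt (fun s => Q (x, s)) (Q₂ (x, y)) y
  per_ψ : ∀ x, ψ (x, Real.pi) = ψ (x, -Real.pi)
  per_P : ∀ x, P (x, Real.pi) = P (x, -Real.pi)
  per_Q : ∀ x, Q (x, Real.pi) = Q (x, -Real.pi)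

/-- An amplitude `b` and a regularization `κ > 0`, functions of the first variable only. -/
structure RadialWeight where
  b : ℝ → ℝ
  b' : ℝ → ℝ
  κ : ℝ → ℝ
  κ' : ℝ → ℝ
  deriv_b : ∀ x, HasDerivAt b (b' x) x
  deriv_κ : ∀ x, HasDerivAt κ (κ' x) x
  cont_b' : Continuous b'
  cont_κ' : Continuous κ'
  κ_pos : ∀ x, 0 < κ x

namespace PlanePhase

variable (Φ : PlanePhase) (w : RadialWeight) (t : ℝ)

/-- The squared length of the gradient. -/
noncomputable def N (p : ℝ × ℝ) : ℝ := Φ.P p ^ 2 + Φ.Q p ^ 2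

lemma N_nonneg (p : ℝ × ℝ) : 0 ≤ Φ.N p := by unfold N; positivity

/-- The oscillating factor. -/
noncomputable def osc (p : ℝ × ℝ) : ℂ := Complex.exp (Complex.I * t * Φ.ψ p)

lemma norm_osc (p : ℝ × ℝ) : ‖Φ.osc t p‖ = 1 := by
  unfold osc
  rw [show Complex.I * t * Φ.ψ p = ((t * Φ.ψ p : ℝ) : ℂ) * Complex.I by push_cast; ring]
  exact Complex.norm_exp_ofReal_mul_I _

/-- The divergence of `b ∇ψ / (|∇ψ|² + κ)`. -/
noncomputable def divField (p : ℝ × ℝ) : ℝ :=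
  (w.b' p.1 * Φ.P p + w.b p.1 * (Φ.P₁ p + Φ.Q₂ p)) / (Φ.N p + w.κ p.1)
    - w.b p.1 * (Φ.P p * (2 * Φ.P p * Φ.P₁ p + 2 * Φ.Q p * Φ.P₂ p + w.κ' p.1)
      + Φ.Q p * (2 * Φ.P p * Φ.P₂ p + 2 * Φ.Q p * Φ.Q₂ p)) / (Φ.N p + w.κ p.1) ^ 2

/-- What is left of the amplitude after one regularized integration by parts. -/
noncomputable def density (p : ℝ × ℝ) : ℂ :=
  Φ.osc t p * (((w.b p.1 * w.κ p.1 / (Φ.N p + w.κ p.1) : ℝ) : ℂ)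
    - ((Φ.divField w p : ℝ) : ℂ) / (Complex.I * t))

/-- The flux through the lines where the first variable is constant. -/
noncomputable def flux (p : ℝ × ℝ) : ℂ :=
  ((w.b p.1 * Φ.P p / (Φ.N p + w.κ p.1) : ℝ) : ℂ) * Φ.osc t p

lemma N_add_pos (p : ℝ × ℝ) : 0 < Φ.N p + w.κ p.1 :=
  add_pos_of_nonneg_of_pos (Φ.N_nonneg p) (w.κ_pos _)

lemma diff_osc : Differentiable ℝ (Φ.osc t) := by
  unfold osc
  have := Φ.diff_ψ
  fun_prop

lemma diff_N : Differentiable ℝ Φ.N := by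
  unfold N
  have := Φ.diff_P
  have := Φ.diff_Q
  fun_prop

lemma diff_b : Differentiable ℝ w.b := fun x => (w.deriv_b x).differentiableAt
lemma diff_κ : Differentiable ℝ w.κ := fun x => (w.deriv_κ x).differentiableAt

lemma continuous_density : Continuous (Φ.density w t) := by
  have h1 := (diff_b w).continuous
  have h2 := (diff_κ w).continuous
  have h3 := w.cont_b'
  have h4 := w.cont_κ'
  have h5 := Φ.diff_P.continuous
  have h6 := Φ.diff_Q.continuous
  have h7 := Φ.diff_N.continuous
  have h8 := (Φ.diff_osc t).continuous
  have h9 := Φ.cont_P₁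
  have h10 := Φ.cont_P₂
  have h11 := Φ.cont_Q₂
  have hne : ∀ p, Φ.N p + w.κ p.1 ≠ 0 := fun p => (Φ.N_add_pos w p).ne'
  have hne2 : ∀ p, (Φ.N p + w.κ p.1) ^ 2 ≠ 0 := fun p => pow_ne_zero _ (hne p)
  unfold density divField
  refine h8.mul (Continuous.sub (Complex.continuous_ofReal.comp ?_)
    (Continuous.div_const (Complex.continuous_ofReal.comp ?_) _))
  · exact Continuous.div (by fun_prop) (by fun_prop) hne
  · exact Continuous.sub (Continuous.div (by fun_prop) (by fun_prop) hne)
      (Continuous.div (by fun_prop) (by fun_prop) hne2)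

lemma diff_field {R : ℝ × ℝ → ℝ} (hR : Differentiable ℝ R) :
    Differentiable ℝ (fun p : ℝ × ℝ =>
      ((w.b p.1 * R p / (Φ.N p + w.κ p.1) : ℝ) : ℂ) * Φ.osc t p) := by
  have h1 := diff_b w
  have h2 := diff_κ w
  have h7 := Φ.diff_N
  have h8 := Φ.diff_osc t
  have hne : ∀ p : ℝ × ℝ, Φ.N p + w.κ p.1 ≠ 0 := fun p => (Φ.N_add_pos w p).ne'
  refine Differentiable.mul ?_ h8
  have : Differentiable ℝ (fun p : ℝ × ℝ => w.b p.1 * R p / (Φ.N p + w.κ p.1)) := by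
    simp_rw [div_eq_mul_inv]
    have h9 : Differentiable ℝ (fun p : ℝ × ℝ => Φ.N p + w.κ p.1) := by fun_prop
    exact Differentiable.mul (by fun_prop) (fun p => (h9 p).inv (hne p))
  exact (Complex.ofRealCLM.differentiable.comp this)

lemma fderiv_fst {f : ℝ × ℝ → ℂ} (hf : Differentiable ℝ f) {x y : ℝ} {f' : ℂ}
    (h : HasDerivAt (fun s => f (s, y)) f' x) : fderiv ℝ f (x, y) (1, 0) = f' := by
  have h2 : HasDerivAt (fun s : ℝ => (s, y)) ((1 : ℝ), (0 : ℝ)) x :=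
    (hasDerivAt_id x).prodMk (hasDerivAt_const x y)
  exact ((hf (x, y)).hasFDerivAt.comp_hasDerivAt x h2).unique h

lemma fderiv_snd {f : ℝ × ℝ → ℂ} (hf : Differentiable ℝ f) {x y : ℝ} {f' : ℂ}
    (h : HasDerivAt (fun s => f (x, s)) f' y) : fderiv ℝ f (x, y) (0, 1) = f' := by
  have h2 : HasDerivAt (fun s : ℝ => (x, s)) ((0 : ℝ), (1 : ℝ)) y :=
    (hasDerivAt_const y x).prodMk (hasDerivAt_id y)
  exact ((hf (x, y)).hasFDerivAt.comp_hasDerivAt y h2).unique h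

lemma deriv_osc_fst (x y : ℝ) :
    HasDerivAt (fun s => Φ.osc t (s, y)) (Φ.osc t (x, y) * (Complex.I * t * Φ.P (x, y))) x :=
  ((Φ.deriv_ψ_fst x y).ofReal_comp.const_mul (Complex.I * t)).cexp

lemma deriv_osc_snd (x y : ℝ) :
    HasDerivAt (fun s => Φ.osc t (x, s)) (Φ.osc t (x, y) * (Complex.I * t * Φ.Q (x, y))) y :=
  ((Φ.deriv_ψ_snd x y).ofReal_comp.const_mul (Complex.I * t)).cexp

lemma divergence_eq (ht : t ≠ 0) (x y : ℝ) :
    fderiv ℝ (Φ.flux w t) (x, y) (1, 0)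
      + fderiv ℝ (fun p : ℝ × ℝ =>
      ((w.b p.1 * Φ.Q p / (Φ.N p + w.κ p.1) : ℝ) : ℂ) * Φ.osc t p) (x, y) (0, 1)
    = (Complex.I * t) * (w.b x * Φ.osc t (x, y) - Φ.density w t (x, y)) := by
  have hpos := Φ.N_add_pos w (x, y)
  have hN1 : HasDerivAt (fun s => Φ.N (s, y) + w.κ s)
      (2 * Φ.P (x, y) * Φ.P₁ (x, y) + 2 * Φ.Q (x, y) * Φ.P₂ (x, y) + w.κ' x) x := by
    have := (((Φ.deriv_P_fst x y).pow 2).add ((Φ.deriv_Q_fst x y).pow 2)).add (w.deriv_κ x)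
    refine this.congr_deriv ?_
    simp
  have hN2 : HasDerivAt (fun s => Φ.N (x, s) + w.κ x)
      (2 * Φ.P (x, y) * Φ.P₂ (x, y) + 2 * Φ.Q (x, y) * Φ.Q₂ (x, y)) y := by
    have := (((Φ.deriv_P_snd x y).pow 2).add ((Φ.deriv_Q_snd x y).pow 2)).add_const (w.κ x)
    refine this.congr_deriv ?_
    simp
  have hf : HasDerivAt (fun s => Φ.flux w t (s, y)) _ x :=
    (((w.deriv_b x).mul (Φ.deriv_P_fst x y)).div hN1 hpos.ne').ofReal_comp.mul
      (Φ.deriv_osc_fst t x y)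
  have hg := (((Φ.deriv_Q_snd x y).const_mul (w.b x)).div hN2 hpos.ne').ofReal_comp.mul
    (Φ.deriv_osc_snd t x y)
  rw [fderiv_fst (f := Φ.flux w t) (Φ.diff_field w t Φ.diff_P) hf, fderiv_snd (Φ.diff_field w t Φ.diff_Q) hg]
  have hne : (Φ.N (x, y) : ℂ) + (w.κ x : ℂ) ≠ 0 := by exact_mod_cast hpos.ne'
  have htc : (t : ℂ) ≠ 0 := by exact_mod_cast ht
  unfold density divField
  simp only [Pi.mul_apply, Pi.div_apply]
  push_cast
  have hNc : (Φ.N (x, y) : ℂ) = (Φ.P (x, y) : ℂ) ^ 2 + (Φ.Q (x, y) : ℂ) ^ 2 := by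
    unfold N; push_cast; rfl
  generalize hD : (Φ.N (x, y) : ℂ) + (w.κ x : ℂ) = D at hne ⊢
  have hκ : (w.κ x : ℂ) = D - ((Φ.P (x, y) : ℂ) ^ 2 + (Φ.Q (x, y) : ℂ) ^ 2) := by
    rw [← hD, hNc]; ring
  rw [hκ]
  field_simp
  ring

/-- Regularized integration by parts over a rectangle. -/
theorem integral_osc_eq (ht : t ≠ 0) (a₁ b₁ : ℝ) :
    (∫ x in a₁..b₁, ∫ y in (-Real.pi)..Real.pi, (w.b x : ℂ) * Φ.osc t (x, y))
      = (∫ x in a₁..b₁, ∫ y in (-Real.pi)..Real.pi, Φ.density w t (x, y))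
        + ((∫ y in (-Real.pi)..Real.pi, Φ.flux w t (b₁, y))
          - ∫ y in (-Real.pi)..Real.pi, Φ.flux w t (a₁, y)) / (Complex.I * t) := by
  have hdf := Φ.diff_field w t Φ.diff_P
  have hdg := Φ.diff_field w t Φ.diff_Q
  have hI : Complex.I * t ≠ 0 := mul_ne_zero Complex.I_ne_zero (by exact_mod_cast ht)
  have hcb : Continuous (fun p : ℝ × ℝ => (w.b p.1 : ℂ) * Φ.osc t p) := by
    have h1 := (diff_b w).continuous
    have h8 := (Φ.diff_osc t).continuous
    fun_prop
  have hcd := Φ.continuous_density w t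
  have key : ∀ p : ℝ × ℝ, fderiv ℝ (Φ.flux w t) p (1, 0)
      + fderiv ℝ (fun p : ℝ × ℝ =>
      ((w.b p.1 * Φ.Q p / (Φ.N p + w.κ p.1) : ℝ) : ℂ) * Φ.osc t p) p (0, 1)
    = (Complex.I * t) * (w.b p.1 * Φ.osc t p - Φ.density w t p) :=
    fun p => Φ.divergence_eq w t ht p.1 p.2
  have hdiv := integral2_divergence_prod_of_hasFDerivAt_off_countable
    (Φ.flux w t) (fun p : ℝ × ℝ =>
      ((w.b p.1 * Φ.Q p / (Φ.N p + w.κ p.1) : ℝ) : ℂ) * Φ.osc t p)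
    (fderiv ℝ (Φ.flux w t)) (fderiv ℝ (fun p : ℝ × ℝ =>
      ((w.b p.1 * Φ.Q p / (Φ.N p + w.κ p.1) : ℝ) : ℂ) * Φ.osc t p))
    a₁ (-Real.pi) b₁ Real.pi ∅ Set.countable_empty hdf.continuous.continuousOn
    hdg.continuous.continuousOn (fun p _ => (hdf p).hasFDerivAt) (fun p _ => (hdg p).hasFDerivAt)
    (by
      simp_rw [key]
      exact ((continuous_const.mul (hcb.sub hcd)).continuousOn).integrableOn_compact
        (isCompact_uIcc.prod isCompact_uIcc))
  simp_rw [key] at hdiv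
  have hper : ∀ x, ((w.b x * Φ.Q (x, Real.pi) / (Φ.N (x, Real.pi) + w.κ x) : ℝ) : ℂ)
      * Φ.osc t (x, Real.pi)
      = ((w.b x * Φ.Q (x, -Real.pi) / (Φ.N (x, -Real.pi) + w.κ x) : ℝ) : ℂ)
      * Φ.osc t (x, -Real.pi) := by
    intro x
    simp only [N, osc, Φ.per_ψ, Φ.per_P, Φ.per_Q]
  simp_rw [hper] at hdiv
  rw [sub_self, zero_add] at hdiv
  rw [← hdiv]
  have hin : ∀ x, (∫ y in (-Real.pi)..Real.pi,
      (Complex.I * t) * (w.b x * Φ.osc t (x, y) - Φ.density w t (x, y)))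
      = (Complex.I * t) * ((∫ y in (-Real.pi)..Real.pi, (w.b x : ℂ) * Φ.osc t (x, y))
        - ∫ y in (-Real.pi)..Real.pi, Φ.density w t (x, y)) := by
    intro x
    rw [intervalIntegral.integral_const_mul, intervalIntegral.integral_sub]
    · exact (hcb.comp (Continuous.prodMk_right x)).intervalIntegrable _ _
    · exact (hcd.comp (Continuous.prodMk_right x)).intervalIntegrable _ _
  simp_rw [hin]
  rw [intervalIntegral.integral_const_mul, intervalIntegral.integral_sub]
  · rw [mul_div_cancel_left₀ _ hI]
    ring
  · exact (intervalIntegral.continuous_parametric_intervalIntegral_of_continuous' hcb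
      _ _).intervalIntegrable _ _
  · exact (intervalIntegral.continuous_parametric_intervalIntegral_of_continuous'
      (f := fun x y => Φ.density w t (x, y)) hcd
      _ _).intervalIntegrable _ _

lemma abs_P_le (p : ℝ × ℝ) : |Φ.P p| ≤ Real.sqrt (Φ.N p) :=
  Real.abs_le_sqrt (by unfold N; nlinarith [sq_nonneg (Φ.Q p)])

lemma abs_Q_le (p : ℝ × ℝ) : |Φ.Q p| ≤ Real.sqrt (Φ.N p) :=
  Real.abs_le_sqrt (by unfold N; nlinarith [sq_nonneg (Φ.P p)])

/-- A bound of the density by its three constituents. -/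
lemma norm_density_le (ht : 0 < t) (p : ℝ × ℝ) {H c : ℝ} (hb : 0 ≤ w.b p.1)
    (h1 : |Φ.P₁ p| ≤ H) (h2 : |Φ.P₂ p| ≤ H) (h3 : |Φ.Q₂ p| ≤ H)
    (hc : w.b p.1 * |w.κ' p.1| ≤ c * w.κ p.1) :
    ‖Φ.density w t p‖ ≤ w.b p.1 * w.κ p.1 / (Φ.N p + w.κ p.1)
      + ((|w.b' p.1| + c) * Real.sqrt (Φ.N p) / (Φ.N p + w.κ p.1)
        + 10 * (w.b p.1 * H / (Φ.N p + w.κ p.1))) / t := by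
  have hpos := Φ.N_add_pos w p
  have hκ := w.κ_pos p.1
  have hN := Φ.N_nonneg p
  have hH : 0 ≤ H := (abs_nonneg _).trans h1
  set s := Real.sqrt (Φ.N p) with hs
  have hs0 : 0 ≤ s := Real.sqrt_nonneg _
  have hss : s * s = Φ.N p := Real.mul_self_sqrt hN
  have hP := Φ.abs_P_le p
  have hQ := Φ.abs_Q_le p
  rw [← hs] at hP hQ
  set D := Φ.N p + w.κ p.1 with hD
  have hdiv : |Φ.divField w p| ≤ (|w.b' p.1| + c) * s / D + 10 * (w.b p.1 * H / D) := by
    have e1 : |w.b' p.1 * Φ.P p + w.b p.1 * (Φ.P₁ p + Φ.Q₂ p)|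
        ≤ |w.b' p.1| * s + w.b p.1 * (2 * H) := by
      refine (abs_add_le _ _).trans ?_
      rw [abs_mul, abs_mul, abs_of_nonneg hb]
      have := abs_add_le (Φ.P₁ p) (Φ.Q₂ p)
      gcongr
      linarith
    have hPP : |Φ.P p * (2 * Φ.P p * Φ.P₁ p)| ≤ 2 * D * H := by
      rw [show Φ.P p * (2 * Φ.P p * Φ.P₁ p) = 2 * (Φ.P p * Φ.P p) * Φ.P₁ p by ring, abs_mul,
        abs_mul, abs_mul, abs_two]
      have : |Φ.P p| * |Φ.P p| ≤ D := by
        calc _ ≤ s * s := by gcongr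
          _ ≤ D := by rw [hss, hD]; linarith
      gcongr
    have hPQ : |Φ.P p * (2 * Φ.Q p * Φ.P₂ p)| ≤ 2 * D * H := by
      rw [show Φ.P p * (2 * Φ.Q p * Φ.P₂ p) = 2 * (Φ.P p * Φ.Q p) * Φ.P₂ p by ring, abs_mul,
        abs_mul, abs_mul, abs_two]
      have : |Φ.P p| * |Φ.Q p| ≤ D := by
        calc _ ≤ s * s := by gcongr
          _ ≤ D := by rw [hss, hD]; linarith
      gcongr
    have hQQ : |Φ.Q p * (2 * Φ.Q p * Φ.Q₂ p)| ≤ 2 * D * H := by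
      rw [show Φ.Q p * (2 * Φ.Q p * Φ.Q₂ p) = 2 * (Φ.Q p * Φ.Q p) * Φ.Q₂ p by ring, abs_mul,
        abs_mul, abs_mul, abs_two]
      have : |Φ.Q p| * |Φ.Q p| ≤ D := by
        calc _ ≤ s * s := by gcongr
          _ ≤ D := by rw [hss, hD]; linarith
      gcongr
    have e2 : |w.b p.1 * (Φ.P p * (2 * Φ.P p * Φ.P₁ p + 2 * Φ.Q p * Φ.P₂ p + w.κ' p.1)
      + Φ.Q p * (2 * Φ.P p * Φ.P₂ p + 2 * Φ.Q p * Φ.Q₂ p))|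
        ≤ c * s * D + 8 * (w.b p.1 * H) * D := by
      rw [abs_mul, abs_of_nonneg hb]
      have h5 : |Φ.P p * (2 * Φ.P p * Φ.P₁ p + 2 * Φ.Q p * Φ.P₂ p + w.κ' p.1)
          + Φ.Q p * (2 * Φ.P p * Φ.P₂ p + 2 * Φ.Q p * Φ.Q₂ p)| ≤ 8 * D * H + s * |w.κ' p.1| := by
        have h6 : |Φ.P p * w.κ' p.1| ≤ s * |w.κ' p.1| := by rw [abs_mul]; gcongr
        rw [abs_le] at hPP hPQ hQQ h6 ⊢
        constructor <;> nlinarith [hPP.1, hPP.2, hPQ.1, hPQ.2, hQQ.1, hQQ.2, h6.1, h6.2]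
      have h7 : s * (w.b p.1 * |w.κ' p.1|) ≤ s * (c * D) := by
        have hc0 : 0 ≤ c := by
          by_contra hneg
          push Not at hneg
          have : c * w.κ p.1 < 0 := mul_neg_of_neg_of_pos hneg hκ
          have : 0 ≤ w.b p.1 * |w.κ' p.1| := by positivity
          linarith
        refine mul_le_mul_of_nonneg_left (hc.trans (mul_le_mul_of_nonneg_left ?_ hc0)) hs0
        rw [hD]; linarith
      calc _ ≤ w.b p.1 * (8 * D * H + s * |w.κ' p.1|) := by gcongr
        _ = s * (w.b p.1 * |w.κ' p.1|) + 8 * (w.b p.1 * H) * D := by ring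
        _ ≤ _ := by linarith
    unfold divField
    rw [← hD]
    refine (abs_sub _ _).trans ?_
    rw [abs_div, abs_div, abs_of_pos hpos, abs_of_pos (pow_pos hpos 2)]
    calc _ ≤ (|w.b' p.1| * s + w.b p.1 * (2 * H)) / D
          + (c * s * D + 8 * (w.b p.1 * H) * D) / D ^ 2 := by gcongr
      _ = _ := by field_simp; ring
  unfold density
  rw [norm_mul, norm_osc, one_mul]
  refine (norm_sub_le _ _).trans ?_
  rw [norm_div, norm_mul, Complex.norm_I, one_mul, Complex.norm_real, Complex.norm_real,
    Complex.norm_real, Real.norm_eq_abs, Real.norm_eq_abs, Real.norm_eq_abs, abs_of_pos ht,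
    abs_of_nonneg (by positivity)]
  gcongr

lemma norm_flux_le (p : ℝ × ℝ) (hb : 0 ≤ w.b p.1) :
    ‖Φ.flux w t p‖ ≤ w.b p.1 * (Real.sqrt (Φ.N p) / (Φ.N p + w.κ p.1)) := by
  have hpos := Φ.N_add_pos w p
  unfold flux
  rw [norm_mul, norm_osc, mul_one, Complex.norm_real, Real.norm_eq_abs, abs_div, abs_mul,
    abs_of_nonneg hb, abs_of_pos hpos, mul_div_assoc]
  gcongr
  exact Φ.abs_P_le p

end PlanePhase

end NovikovVeselov

namespace NovikovVeselov

section Phases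

variable (a b : ℝ)

/-- The one-variable phase `2 cos 3x + a cos x + b sin x`. -/
noncomputable def circ (x : ℝ) : ℝ := 2 * Real.cos (3 * x) + a * Real.cos x + b * Real.sin x

/-- The derivative of `circ`. -/
noncomputable def circ₁ (x : ℝ) : ℝ :=
  -6 * Real.sin (3 * x) - a * Real.sin x + b * Real.cos x

/-- The second derivative of `circ`. -/
noncomputable def circ₂ (x : ℝ) : ℝ :=
  -18 * Real.cos (3 * x) - a * Real.cos x - b * Real.sin x

lemma hasDerivAt_cos_three (x : ℝ) :
    HasDerivAt (fun x => Real.cos (3 * x)) (-3 * Real.sin (3 * x)) x := by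
  have := ((hasDerivAt_id x).const_mul 3).cos
  simp only [id] at this
  exact this.congr_deriv (by ring)

lemma hasDerivAt_sin_three (x : ℝ) :
    HasDerivAt (fun x => Real.sin (3 * x)) (3 * Real.cos (3 * x)) x := by
  have := ((hasDerivAt_id x).const_mul 3).sin
  simp only [id] at this
  exact this.congr_deriv (by ring)

lemma hasDerivAt_cosh_three (x : ℝ) :
    HasDerivAt (fun x => Real.cosh (3 * x)) (3 * Real.sinh (3 * x)) x := by
  have := ((hasDerivAt_id x).const_mul 3).cosh
  simp only [id] at this
  exact this.congr_deriv (by ring)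

lemma hasDerivAt_sinh_three (x : ℝ) :
    HasDerivAt (fun x => Real.sinh (3 * x)) (3 * Real.cosh (3 * x)) x := by
  have := ((hasDerivAt_id x).const_mul 3).sinh
  simp only [id] at this
  exact this.congr_deriv (by ring)

lemma hasDerivAt_circ (x : ℝ) : HasDerivAt (circ a b) (circ₁ a b x) x := by
  unfold circ circ₁
  exact ((((hasDerivAt_cos_three x).const_mul 2).add ((Real.hasDerivAt_cos x).const_mul a)).add
    ((Real.hasDerivAt_sin x).const_mul b)).congr_deriv (by ring)

lemma hasDerivAt_circ₁ (x : ℝ) : HasDerivAt (circ₁ a b) (circ₂ a b x) x := by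
  unfold circ₁ circ₂
  exact ((((hasDerivAt_sin_three x).const_mul (-6)).sub ((Real.hasDerivAt_sin x).const_mul a)).add
    ((Real.hasDerivAt_cos x).const_mul b)).congr_deriv (by ring)

lemma differentiable_circ : Differentiable ℝ (circ a b) :=
  fun x => (hasDerivAt_circ a b x).differentiableAt

lemma differentiable_circ₁ : Differentiable ℝ (circ₁ a b) :=
  fun x => (hasDerivAt_circ₁ a b x).differentiableAt

lemma continuous_circ₂ : Continuous (circ₂ a b) := by unfold circ₂; fun_prop

lemma periodic_circ (x : ℝ) : circ a b (x + 2 * Real.pi) = circ a b x := by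
  unfold circ
  rw [show 3 * (x + 2 * Real.pi) = 3 * x + (3 : ℕ) * (2 * Real.pi) by push_cast; ring,
    Real.cos_add_nat_mul_two_pi, Real.cos_add_two_pi, Real.sin_add_two_pi]

lemma periodic_circ₁ (x : ℝ) : circ₁ a b (x + 2 * Real.pi) = circ₁ a b x := by
  unfold circ₁
  rw [show 3 * (x + 2 * Real.pi) = 3 * x + (3 : ℕ) * (2 * Real.pi) by push_cast; ring,
    Real.sin_add_nat_mul_two_pi, Real.cos_add_two_pi, Real.sin_add_two_pi]

/-- The phase inside the disc of radius `2`, where the modulus is `2 cos β`. -/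
noncomputable def innerPhase : PlanePhase where
  ψ p := circ a b (p.2 + p.1) + circ a b (p.2 - p.1)
  P p := circ₁ a b (p.2 + p.1) - circ₁ a b (p.2 - p.1)
  Q p := circ₁ a b (p.2 + p.1) + circ₁ a b (p.2 - p.1)
  P₁ p := circ₂ a b (p.2 + p.1) + circ₂ a b (p.2 - p.1)
  P₂ p := circ₂ a b (p.2 + p.1) - circ₂ a b (p.2 - p.1)
  Q₂ p := circ₂ a b (p.2 + p.1) + circ₂ a b (p.2 - p.1)
  diff_ψ := by have := differentiable_circ a b; fun_prop
  diff_P := by have := differentiable_circ₁ a b; fun_prop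
  diff_Q := by have := differentiable_circ₁ a b; fun_prop
  cont_P₁ := by have := continuous_circ₂ a b; fun_prop
  cont_P₂ := by have := continuous_circ₂ a b; fun_prop
  cont_Q₂ := by have := continuous_circ₂ a b; fun_prop
  deriv_ψ_fst x y := (((hasDerivAt_circ a b (y + x)).comp_const_add y x).add
    ((hasDerivAt_circ a b (y - x)).comp_const_sub y x)).congr_deriv (by ring)
  deriv_ψ_snd x y := ((hasDerivAt_circ a b (y + x)).comp_add_const y x).add
    ((hasDerivAt_circ a b (y - x)).comp_sub_const y x)
  deriv_P_fst x y := (((hasDerivAt_circ₁ a b (y + x)).comp_const_add y x).sub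
    ((hasDerivAt_circ₁ a b (y - x)).comp_const_sub y x)).congr_deriv (by ring)
  deriv_P_snd x y := ((hasDerivAt_circ₁ a b (y + x)).comp_add_const y x).sub
    ((hasDerivAt_circ₁ a b (y - x)).comp_sub_const y x)
  deriv_Q_fst x y := (((hasDerivAt_circ₁ a b (y + x)).comp_const_add y x).add
    ((hasDerivAt_circ₁ a b (y - x)).comp_const_sub y x)).congr_deriv (by ring)
  deriv_Q_snd x y := ((hasDerivAt_circ₁ a b (y + x)).comp_add_const y x).add
    ((hasDerivAt_circ₁ a b (y - x)).comp_sub_const y x)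
  per_ψ x := by
    rw [show Real.pi + x = -Real.pi + x + 2 * Real.pi by ring,
      show Real.pi - x = -Real.pi - x + 2 * Real.pi by ring, periodic_circ, periodic_circ]
  per_P x := by
    rw [show Real.pi + x = -Real.pi + x + 2 * Real.pi by ring,
      show Real.pi - x = -Real.pi - x + 2 * Real.pi by ring, periodic_circ₁, periodic_circ₁]
  per_Q x := by
    rw [show Real.pi + x = -Real.pi + x + 2 * Real.pi by ring,
      show Real.pi - x = -Real.pi - x + 2 * Real.pi by ring, periodic_circ₁, periodic_circ₁]

lemma cos_three_neg_pi : Real.cos (3 * -Real.pi) = Real.cos (3 * Real.pi) := by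
  rw [mul_neg, Real.cos_neg]

lemma sin_three_neg_pi : Real.sin (3 * -Real.pi) = Real.sin (3 * Real.pi) := by
  rw [mul_neg, Real.sin_neg, show (3 : ℝ) * Real.pi = Real.pi + 2 * Real.pi by ring,
    Real.sin_add_two_pi, Real.sin_pi, neg_zero]

/-- The phase outside the disc of radius `2`, where the modulus is `2 cosh τ`. -/
noncomputable def outerPhase : PlanePhase where
  ψ p := 4 * (Real.cosh (3 * p.1) * Real.cos (3 * p.2))
    + 2 * (Real.cosh p.1 * (a * Real.cos p.2 + b * Real.sin p.2))
  P p := 12 * (Real.sinh (3 * p.1) * Real.cos (3 * p.2))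
    + 2 * (Real.sinh p.1 * (a * Real.cos p.2 + b * Real.sin p.2))
  Q p := -12 * (Real.cosh (3 * p.1) * Real.sin (3 * p.2))
    + 2 * (Real.cosh p.1 * (-a * Real.sin p.2 + b * Real.cos p.2))
  P₁ p := 36 * (Real.cosh (3 * p.1) * Real.cos (3 * p.2))
    + 2 * (Real.cosh p.1 * (a * Real.cos p.2 + b * Real.sin p.2))
  P₂ p := -36 * (Real.sinh (3 * p.1) * Real.sin (3 * p.2))
    + 2 * (Real.sinh p.1 * (-a * Real.sin p.2 + b * Real.cos p.2))
  Q₂ p := -(36 * (Real.cosh (3 * p.1) * Real.cos (3 * p.2))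
    + 2 * (Real.cosh p.1 * (a * Real.cos p.2 + b * Real.sin p.2)))
  diff_ψ := by fun_prop
  diff_P := by fun_prop
  diff_Q := by fun_prop
  cont_P₁ := by fun_prop
  cont_P₂ := by fun_prop
  cont_Q₂ := by fun_prop
  deriv_ψ_fst x y := ((((hasDerivAt_cosh_three x).mul_const (Real.cos (3 * y))).const_mul 4).add
    (((Real.hasDerivAt_cosh x).mul_const (a * Real.cos y + b * Real.sin y)).const_mul 2)).congr_deriv (by ring)
  deriv_ψ_snd x y := ((((hasDerivAt_cos_three y).const_mul (Real.cosh (3 * x))).const_mul 4).add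
    (((((Real.hasDerivAt_cos y).const_mul a).add
      ((Real.hasDerivAt_sin y).const_mul b)).const_mul (Real.cosh x)).const_mul 2)).congr_deriv (by ring)
  deriv_P_fst x y := ((((hasDerivAt_sinh_three x).mul_const (Real.cos (3 * y))).const_mul 12).add
    (((Real.hasDerivAt_sinh x).mul_const (a * Real.cos y + b * Real.sin y)).const_mul 2)).congr_deriv (by ring)
  deriv_P_snd x y := ((((hasDerivAt_cos_three y).const_mul (Real.sinh (3 * x))).const_mul 12).add
    (((((Real.hasDerivAt_cos y).const_mul a).add
      ((Real.hasDerivAt_sin y).const_mul b)).const_mul (Real.sinh x)).const_mul 2)).congr_deriv (by ring)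
  deriv_Q_fst x y := ((((hasDerivAt_cosh_three x).mul_const (Real.sin (3 * y))).const_mul (-12)).add
    (((Real.hasDerivAt_cosh x).mul_const (-a * Real.sin y + b * Real.cos y)).const_mul 2)).congr_deriv (by ring)
  deriv_Q_snd x y := ((((hasDerivAt_sin_three y).const_mul (Real.cosh (3 * x))).const_mul (-12)).add
    (((((Real.hasDerivAt_sin y).const_mul (-a)).add
      ((Real.hasDerivAt_cos y).const_mul b)).const_mul (Real.cosh x)).const_mul 2)).congr_deriv (by ring)
  per_ψ x := by simp only [cos_three_neg_pi, Real.cos_neg, Real.sin_neg, Real.sin_pi, neg_zero]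
  per_P x := by simp only [cos_three_neg_pi, Real.cos_neg, Real.sin_neg, Real.sin_pi, neg_zero]
  per_Q x := by simp only [sin_three_neg_pi, Real.cos_neg, Real.sin_neg, Real.sin_pi, neg_zero]

end Phases

/-- The roots of the cubic `z³ + (ū/6) z² - (u/6) z - 1`, `u = a + b i`; all but the first one lie
in the closed unit disc. -/
structure CriticalRoots (a b : ℝ) where
  μ : Fin 3 → ℂ
  prod_eq : ∀ z : ℂ, z ^ 3 + (a - b * Complex.I) / 6 * z ^ 2 - (a + b * Complex.I) / 6 * z - 1
    = (z - μ 0) * (z - μ 1) * (z - μ 2)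
  norm_one : ‖μ 1‖ ≤ 1
  norm_two : ‖μ 2‖ ≤ 1
  norm_le : ‖(a + b * Complex.I : ℂ)‖ / 6 - 2 ≤ ‖μ 0‖

section Roots
open Complex ComplexConjugate

lemma exists_cubic_roots (s u : ℂ) : ∃ x y z : ℂ,
    ∀ w : ℂ, w ^ 3 + s * w ^ 2 - u * w - 1 = (w - x) * (w - y) * (w - z) := by
  have hsp : (Polynomial.map (RingHom.id ℂ) (Cubic.toPoly ⟨1, s, -u, -1⟩)).Splits :=
    IsAlgClosed.splits _
  have h1 : (⟨1, s, -u, -1⟩ : Cubic ℂ).a ≠ 0 := one_ne_zero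
  obtain ⟨x, y, z, h⟩ := (Cubic.splits_iff_roots_eq_three h1).1 hsp
  have hb := Cubic.b_eq_three_roots h1 h
  have hc := Cubic.c_eq_three_roots h1 h
  have hd := Cubic.d_eq_three_roots h1 h
  simp only [RingHom.id_apply, one_mul] at hb hc hd
  refine ⟨x, y, z, fun w => ?_⟩
  rw [hb]
  linear_combination w * hc + hd

/-- A self-inversive cubic has at most one root outside the closed unit disc. -/
lemma not_two_outside {u x y z : ℂ}
    (h : ∀ w : ℂ, w ^ 3 + conj u * w ^ 2 - u * w - 1 = (w - x) * (w - y) * (w - z)) :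
    ‖x‖ ≤ 1 ∨ ‖y‖ ≤ 1 := by
  by_contra! hcon
  obtain ⟨hx, hy⟩ := hcon
  have inv : ∀ r : ℂ, 1 < ‖r‖ → r ^ 3 + conj u * r ^ 2 - u * r - 1 = 0 → z * conj r = 1 := by
    intro r hr hroot
    have hr0 : conj r ≠ 0 := by
      intro h0
      rw [map_eq_zero] at h0
      rw [h0, norm_zero] at hr
      linarith
    have hroot' := congrArg conj hroot
    simp only [map_add, map_sub, map_mul, map_pow, map_one, map_zero, conj_conj] at hroot'
    have h2 : (((conj r)⁻¹ - x) * ((conj r)⁻¹ - y)) * ((conj r)⁻¹ - z) = 0 := by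
      rw [← h]
      field_simp
      linear_combination -hroot'
    have hn : ‖(conj r)⁻¹‖ < 1 := by
      rw [norm_inv, Complex.norm_conj]
      exact inv_lt_one_of_one_lt₀ hr
    rcases mul_eq_zero.1 h2 with h3 | h3
    · rcases mul_eq_zero.1 h3 with h4 | h4
      · rw [sub_eq_zero.1 h4] at hn; linarith
      · rw [sub_eq_zero.1 h4] at hn; linarith
    · rw [← sub_eq_zero.1 h3]
      exact inv_mul_cancel₀ hr0
  have ex := inv x hx (by rw [h]; ring)
  have ey := inv y hy (by rw [h]; ring)
  have hz : z ≠ 0 := by rintro rfl; simp at ex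
  have exy : x = y := by
    have : conj x = conj y := mul_left_cancel₀ hz (ex.trans ey.symm)
    exact (starRingEnd ℂ).injective this
  have h0 := h 0
  have hprod : ‖x‖ * ‖x‖ * ‖z‖ = 1 := by
    rw [← exy] at h0
    have : x * x * z = 1 := by linear_combination h0
    rw [← norm_mul, ← norm_mul, this, norm_one]
  have hzx : ‖z‖ * ‖x‖ = 1 := by
    rw [← Complex.norm_conj x, ← norm_mul, ex, norm_one]
  nlinarith

lemma nonempty_criticalRoots (a b : ℝ) : Nonempty (CriticalRoots a b) := by
  have hconj : conj ((a + b * I) / 6 : ℂ) = (a - b * I) / 6 := by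
    have h6 : conj (6 : ℂ) = 6 := Complex.conj_ofNat 6
    simp [Complex.conj_ofReal, sub_eq_add_neg, h6]
  have main : ∀ x y z : ℂ, (∀ w : ℂ, w ^ 3 + (a - b * I) / 6 * w ^ 2 - (a + b * I) / 6 * w - 1
      = (w - x) * (w - y) * (w - z)) → ‖y‖ ≤ 1 → ‖z‖ ≤ 1 → Nonempty (CriticalRoots a b) := by
    intro x y z h hy hz
    refine ⟨⟨![x, y, z], by simpa using h, by simpa using hy, by simpa using hz, ?_⟩⟩
    · have h1 := h 1
      have h2 := h (-1)
      have h0 := h 0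
      have e : (a - b * I : ℂ) / 6 = -(x + y + z) := by
        linear_combination (h1 + h2) / 2 - h0
      have e2 : ‖(a + b * I : ℂ)‖ / 6 = ‖x + y + z‖ := by
        rw [← norm_neg (x + y + z), ← e, ← hconj, Complex.norm_conj, norm_div]
        norm_num
      rw [e2]
      have := norm_add₃_le (a := x) (b := y) (c := z)
      simp only [Matrix.cons_val_zero]
      linarith
  obtain ⟨x, y, z, h⟩ := exists_cubic_roots ((a - b * I) / 6) ((a + b * I) / 6)
  have perm : ∀ x y z : ℂ, (∀ w : ℂ, w ^ 3 + (a - b * I) / 6 * w ^ 2 - (a + b * I) / 6 * w - 1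
      = (w - x) * (w - y) * (w - z)) → ‖x‖ ≤ 1 ∨ ‖y‖ ≤ 1 := by
    intro x y z h
    exact not_two_outside (u := (a + b * I) / 6) (z := z) (by rw [hconj]; exact h)
  have h12 := perm x y z h
  have h13 := perm x z y (fun w => by rw [h]; ring)
  have h23 := perm y z x (fun w => by rw [h]; ring)
  by_cases hx : ‖x‖ ≤ 1
  · by_cases hy : ‖y‖ ≤ 1
    · exact main z x y (fun w => by rw [h]; ring) hx hy
    · exact main y x z (fun w => by rw [h]; ring) hx (h23.resolve_left hy)
  · exact main x y z h (h12.resolve_left hx) (h13.resolve_left hx)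

end Roots

end NovikovVeselov

namespace NovikovVeselov

section Outer
open Complex

variable (a b : ℝ)

/-- The point `e^{2 (τ + i φ)}`. -/
noncomputable def expPt (τ φ : ℝ) : ℂ := (Real.exp (2 * τ) : ℂ) * exp ((2 * φ : ℝ) * I)

lemma norm_expPt (τ φ : ℝ) : ‖expPt τ φ‖ = Real.exp (2 * τ) := by
  unfold expPt
  rw [norm_mul, norm_exp_ofReal_mul_I, mul_one, norm_real, Real.norm_eq_abs, Real.abs_exp]

/-- `e^{-3 (τ + i φ)}`. -/
noncomputable def expNegThree (τ φ : ℝ) : ℂ :=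
  (Real.exp (-(3 * τ)) : ℂ) * exp ((-(3 * φ) : ℝ) * I)

lemma norm_expNegThree (τ φ : ℝ) : ‖expNegThree τ φ‖ = Real.exp (-(3 * τ)) := by
  unfold expNegThree
  rw [norm_mul, norm_exp_ofReal_mul_I, mul_one, norm_real, Real.norm_eq_abs, Real.abs_exp]

lemma expNegThree_mul (τ φ : ℝ) (k : ℕ) (l m : ℝ) (hl : l = (2 * k - 3) * τ)
    (hm : m = (2 * k - 3) * φ) :
    expNegThree τ φ * expPt τ φ ^ k
      = (Real.exp l : ℂ) * (Real.cos m + Real.sin m * I) := by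
  subst hl hm
  unfold expNegThree expPt
  rw [ofReal_cos, ofReal_sin, ← exp_mul_I, ofReal_exp, ofReal_exp, ofReal_exp, ← exp_add,
    ← exp_add, ← exp_add, ← exp_nat_mul, ← exp_add]
  congr 1
  push_cast
  ring

lemma outer_gradient_eq (τ φ : ℝ) :
    ((outerPhase a b).P (τ, φ) : ℂ) - (outerPhase a b).Q (τ, φ) * I
      = 6 * expNegThree τ φ * (expPt τ φ ^ 3 + (a - b * I) / 6 * expPt τ φ ^ 2
        - (a + b * I) / 6 * expPt τ φ - 1) := by
  have h3 := expNegThree_mul τ φ 3 (3 * τ) (3 * φ) (by push_cast; ring) (by push_cast; ring)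
  have h2 := expNegThree_mul τ φ 2 τ φ (by push_cast; ring) (by push_cast; ring)
  have h1 := expNegThree_mul τ φ 1 (-τ) (-φ) (by push_cast; ring) (by push_cast; ring)
  have h0 := expNegThree_mul τ φ 0 (-(3 * τ)) (-(3 * φ)) (by push_cast; ring) (by push_cast; ring)
  rw [pow_one] at h1
  rw [pow_zero, mul_one] at h0
  simp only [Real.cos_neg, Real.sin_neg] at h1 h0
  simp only [outerPhase, Real.cosh_eq, Real.sinh_eq]
  simp only [ofReal_add, ofReal_sub, ofReal_mul, ofReal_neg, ofReal_ofNat, ofReal_div] at *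
  linear_combination -6 * h3 - (a - b * I) * h2 + (a + b * I) * h1 + 6 * h0
    + (Real.exp τ - Real.exp (-τ)) * b * Real.sin φ * I_sq

lemma outer_hessian_eq (τ φ : ℝ) :
    ((outerPhase a b).P₁ (τ, φ) : ℂ) - (outerPhase a b).P₂ (τ, φ) * I
      = expNegThree τ φ * (18 * expPt τ φ ^ 3 + (a - b * I) * expPt τ φ ^ 2
        + (a + b * I) * expPt τ φ + 18) := by
  have h3 := expNegThree_mul τ φ 3 (3 * τ) (3 * φ) (by push_cast; ring) (by push_cast; ring)
  have h2 := expNegThree_mul τ φ 2 τ φ (by push_cast; ring) (by push_cast; ring)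
  have h1 := expNegThree_mul τ φ 1 (-τ) (-φ) (by push_cast; ring) (by push_cast; ring)
  have h0 := expNegThree_mul τ φ 0 (-(3 * τ)) (-(3 * φ)) (by push_cast; ring) (by push_cast; ring)
  rw [pow_one] at h1
  rw [pow_zero, mul_one] at h0
  simp only [Real.cos_neg, Real.sin_neg] at h1 h0
  simp only [outerPhase, Real.cosh_eq, Real.sinh_eq]
  simp only [ofReal_add, ofReal_sub, ofReal_mul, ofReal_neg, ofReal_ofNat, ofReal_div] at *
  linear_combination -18 * h3 - (a - b * I) * h2 - (a + b * I) * h1 - 18 * h0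
    + (Real.exp τ + Real.exp (-τ)) * b * Real.sin φ * I_sq

variable {a b}

/-- The distance from `e^{2 (τ + i φ)}` to the `j`-th root. -/
noncomputable def CriticalRoots.dist (M : CriticalRoots a b) (j : Fin 3) (τ φ : ℝ) : ℝ :=
  ‖expPt τ φ - M.μ j‖

lemma CriticalRoots.dist_nonneg (M : CriticalRoots a b) (j : Fin 3) (τ φ : ℝ) :
    0 ≤ M.dist j τ φ := norm_nonneg _

lemma sqrt_outer_N (M : CriticalRoots a b) (τ φ : ℝ) :
    Real.sqrt ((outerPhase a b).N (τ, φ))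
      = 6 * Real.exp (-(3 * τ)) * (M.dist 0 τ φ * M.dist 1 τ φ * M.dist 2 τ φ) := by
  have h := outer_gradient_eq a b τ φ
  rw [M.prod_eq] at h
  have hn : ‖((outerPhase a b).P (τ, φ) : ℂ) - (outerPhase a b).Q (τ, φ) * I‖
      = Real.sqrt ((outerPhase a b).N (τ, φ)) := by
    rw [show ((outerPhase a b).P (τ, φ) : ℂ) - (outerPhase a b).Q (τ, φ) * I
      = ((outerPhase a b).P (τ, φ) : ℂ) + ((-(outerPhase a b).Q (τ, φ) : ℝ) : ℂ) * I by
      push_cast; ring, norm_add_mul_I]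
    unfold PlanePhase.N
    congr 1
    ring
  rw [← hn, h, norm_mul, norm_mul, norm_mul, norm_mul, norm_expNegThree]
  norm_num [CriticalRoots.dist]

/-- The modulus of the complex second derivative. -/
noncomputable def outerHess (a b τ φ : ℝ) : ℝ :=
  ‖((outerPhase a b).P₁ (τ, φ) : ℂ) - (outerPhase a b).P₂ (τ, φ) * I‖

lemma abs_P₁_le (τ φ : ℝ) : |(outerPhase a b).P₁ (τ, φ)| ≤ outerHess a b τ φ := by
  have := abs_re_le_norm (((outerPhase a b).P₁ (τ, φ) : ℂ) - (outerPhase a b).P₂ (τ, φ) * I)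
  simpa [outerHess] using this

lemma abs_P₂_le (τ φ : ℝ) : |(outerPhase a b).P₂ (τ, φ)| ≤ outerHess a b τ φ := by
  have := abs_im_le_norm (((outerPhase a b).P₁ (τ, φ) : ℂ) - (outerPhase a b).P₂ (τ, φ) * I)
  simpa [outerHess] using this

lemma abs_Q₂_le (τ φ : ℝ) : |(outerPhase a b).Q₂ (τ, φ)| ≤ outerHess a b τ φ := by
  have : (outerPhase a b).Q₂ (τ, φ) = -(outerPhase a b).P₁ (τ, φ) := rfl
  rw [this, abs_neg]
  exact abs_P₁_le τ φ

lemma outerHess_le (M : CriticalRoots a b) (τ φ : ℝ) :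
    outerHess a b τ φ ≤ 3 * Real.sqrt ((outerPhase a b).N (τ, φ))
      + 12 * Real.exp (-τ) * (M.dist 1 τ φ * M.dist 2 τ φ + M.dist 0 τ φ * M.dist 2 τ φ
        + M.dist 0 τ φ * M.dist 1 τ φ) := by
  rw [sqrt_outer_N M]
  unfold outerHess
  rw [outer_hessian_eq]
  have h1 := M.prod_eq 1
  have h2 := M.prod_eq (-1)
  have h0 := M.prod_eq 0
  set z := expPt τ φ with hz
  set x := M.μ 0
  set y := M.μ 1
  set v := M.μ 2
  have e : (18 * z ^ 3 + (a - b * I) * z ^ 2 + (a + b * I) * z + 18)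
      = -18 * ((z - x) * (z - y) * (z - v))
        + 12 * (z * ((z - y) * (z - v) + (z - x) * (z - v) + (z - x) * (z - y))) := by
    have es : (a - b * I : ℂ) = -6 * (x + y + v) := by
      linear_combination 3 * (h1 + h2) - 6 * h0
    have ec : (a + b * I : ℂ) = -6 * (x * y + x * v + y * v) := by
      linear_combination -3 * (h1 - h2)
    have ed : x * y * v = 1 := by linear_combination h0
    linear_combination z ^ 2 * es + z * ec - 18 * ed
  rw [e, norm_mul, norm_expNegThree]
  have hzn : ‖z‖ = Real.exp (2 * τ) := norm_expPt τ φ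
  have hexp : Real.exp (-τ) = Real.exp (-(3 * τ)) * Real.exp (2 * τ) := by
    rw [← Real.exp_add]; congr 1; ring
  have hx : M.dist 0 τ φ = ‖z - x‖ := rfl
  have hy : M.dist 1 τ φ = ‖z - y‖ := rfl
  have hv : M.dist 2 τ φ = ‖z - v‖ := rfl
  rw [hx, hy, hv, hexp]
  have hE := Real.exp_pos (-(3 * τ))
  have n1 : ‖-18 * ((z - x) * (z - y) * (z - v))‖ = 18 * (‖z - x‖ * ‖z - y‖ * ‖z - v‖) := by
    simp
  have n2 : ‖12 * (z * ((z - y) * (z - v) + (z - x) * (z - v) + (z - x) * (z - y)))‖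
      ≤ 12 * (Real.exp (2 * τ)
        * (‖z - y‖ * ‖z - v‖ + ‖z - x‖ * ‖z - v‖ + ‖z - x‖ * ‖z - y‖)) := by
    rw [norm_mul, norm_mul, hzn]
    have := norm_add₃_le (a := (z - y) * (z - v)) (b := (z - x) * (z - v))
      (c := (z - x) * (z - y))
    simp only [norm_mul] at this
    norm_num
    gcongr
  calc _ ≤ Real.exp (-(3 * τ)) * (18 * (‖z - x‖ * ‖z - y‖ * ‖z - v‖)
        + 12 * (Real.exp (2 * τ)
        * (‖z - y‖ * ‖z - v‖ + ‖z - x‖ * ‖z - v‖ + ‖z - x‖ * ‖z - y‖))) := by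
        refine mul_le_mul_of_nonneg_left ((norm_add_le _ _).trans ?_) hE.le
        rw [n1]
        gcongr
    _ = _ := by ring

/-- The distance to the set of roots controls the second derivative by the first one. -/
lemma mul_outerHess_le (M : CriticalRoots a b) (τ φ : ℝ) {p : ℝ} (hp : 0 ≤ p)
    (h : ∀ j, p ≤ M.dist j τ φ) :
    p * outerHess a b τ φ
      ≤ (3 * p + 6 * Real.exp (2 * τ)) * Real.sqrt ((outerPhase a b).N (τ, φ)) := by
  have h0 := h 0
  have h1 := h 1
  have h2 := h 2
  have d0 := M.dist_nonneg 0 τ φ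
  have d1 := M.dist_nonneg 1 τ φ
  have d2 := M.dist_nonneg 2 τ φ
  have hexp : Real.exp (-τ) = Real.exp (-(3 * τ)) * Real.exp (2 * τ) := by
    rw [← Real.exp_add]; congr 1; ring
  have hsum : p * (M.dist 1 τ φ * M.dist 2 τ φ + M.dist 0 τ φ * M.dist 2 τ φ
        + M.dist 0 τ φ * M.dist 1 τ φ) ≤ 3 * (M.dist 0 τ φ * M.dist 1 τ φ * M.dist 2 τ φ) := by
    have e0 := mul_le_mul_of_nonneg_right h0 (mul_nonneg d1 d2)
    have e1 := mul_le_mul_of_nonneg_right h1 (mul_nonneg d0 d2)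
    have e2 := mul_le_mul_of_nonneg_right h2 (mul_nonneg d0 d1)
    linarith
  calc p * outerHess a b τ φ ≤ p * _ := mul_le_mul_of_nonneg_left (outerHess_le M τ φ) hp
    _ = 3 * p * Real.sqrt ((outerPhase a b).N (τ, φ)) + 12 * Real.exp (-τ)
      * (p * (M.dist 1 τ φ * M.dist 2 τ φ + M.dist 0 τ φ * M.dist 2 τ φ
        + M.dist 0 τ φ * M.dist 1 τ φ)) := by ring
    _ ≤ 3 * p * Real.sqrt ((outerPhase a b).N (τ, φ)) + 12 * Real.exp (-τ)
      * (3 * (M.dist 0 τ φ * M.dist 1 τ φ * M.dist 2 τ φ)) := by gcongr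
    _ = _ := by rw [sqrt_outer_N M, hexp]; ring

lemma abs_circ₁_eq (M : CriticalRoots a b) (x : ℝ) :
    |circ₁ a b x| = 3 * (M.dist 0 0 x * M.dist 1 0 x * M.dist 2 0 x) := by
  have h := sqrt_outer_N M 0 x
  have hN : (outerPhase a b).N (0, x) = (2 * circ₁ a b x) ^ 2 := by
    simp only [PlanePhase.N, outerPhase, circ₁, mul_zero, Real.sinh_zero, Real.cosh_zero]
    ring
  rw [hN, Real.sqrt_sq_eq_abs, abs_mul, abs_two] at h
  simp only [mul_zero, neg_zero, Real.exp_zero] at h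
  linarith

lemma mul_abs_circ₂_le (M : CriticalRoots a b) (x : ℝ) {p : ℝ} (hp : 0 ≤ p)
    (h : ∀ j, p ≤ M.dist j 0 x) :
    p * |circ₂ a b x| ≤ (3 * p + 6) * |circ₁ a b x| := by
  have h1 := mul_outerHess_le M 0 x hp h
  have hN : (outerPhase a b).N (0, x) = (2 * circ₁ a b x) ^ 2 := by
    simp only [PlanePhase.N, outerPhase, circ₁, mul_zero, Real.sinh_zero, Real.cosh_zero]
    ring
  rw [hN, Real.sqrt_sq_eq_abs, abs_mul, abs_two, mul_zero, Real.exp_zero] at h1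
  have h2 := abs_P₁_le (a := a) (b := b) 0 x
  have h3 : (outerPhase a b).P₁ (0, x) = -2 * circ₂ a b x := by
    simp only [outerPhase, circ₂, mul_zero, Real.cosh_zero]
    ring
  rw [h3, abs_mul, abs_neg, abs_two] at h2
  have := mul_le_mul_of_nonneg_left h2 hp
  nlinarith

/-- The distance of the angle `2 φ` to the argument of the `j`-th root, measured by the sine. -/
noncomputable def CriticalRoots.angle (M : CriticalRoots a b) (j : Fin 3) (φ : ℝ) : ℝ :=
  |Real.sin (2 * φ - (M.μ j).arg)|

lemma CriticalRoots.exp_mul_angle_le (M : CriticalRoots a b) (j : Fin 3) (τ φ : ℝ) :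
    Real.exp (2 * τ) * M.angle j φ ≤ M.dist j τ φ := by
  unfold CriticalRoots.dist CriticalRoots.angle
  have hrot : (expPt τ φ - M.μ j) * exp ((-(M.μ j).arg : ℝ) * I)
      = (Real.exp (2 * τ) : ℂ) * exp ((2 * φ - (M.μ j).arg : ℝ) * I) - (‖M.μ j‖ : ℂ) := by
    unfold expPt
    have hm := norm_mul_exp_arg_mul_I (M.μ j)
    generalize (M.μ j).arg = θ at hm ⊢
    generalize ‖M.μ j‖ = m at hm ⊢
    rw [← hm, sub_mul, mul_assoc, mul_assoc, ← exp_add, ← exp_add]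
    congr 2
    · congr 1; push_cast; ring
    · push_cast
      rw [show (θ : ℂ) * I + -(θ : ℂ) * I = 0 by ring, exp_zero, mul_one]
  have hn : ‖(expPt τ φ - M.μ j) * exp ((-(M.μ j).arg : ℝ) * I)‖ = ‖expPt τ φ - M.μ j‖ := by
    rw [norm_mul, norm_exp_ofReal_mul_I, mul_one]
  rw [← hn, hrot]
  refine le_trans ?_ (abs_im_le_norm _)
  rw [sub_im, ofReal_im, sub_zero, im_ofReal_mul, abs_mul, Real.abs_exp, exp_ofReal_mul_I_im]

lemma CriticalRoots.abs_sub_norm_le (M : CriticalRoots a b) (j : Fin 3) (τ φ : ℝ) :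
    |Real.exp (2 * τ) - ‖M.μ j‖| ≤ M.dist j τ φ := by
  unfold CriticalRoots.dist
  rw [← norm_expPt τ φ]
  exact abs_norm_sub_norm_le _ _

end Outer

end NovikovVeselov

namespace NovikovVeselov

section Weights

/-- The singular weight `|sin x|^{-s}`. -/
noncomputable def sinW (s x : ℝ) : ℝ := |Real.sin x| ^ (-s)

lemma sinW_nonneg (s x : ℝ) : 0 ≤ sinW s x := Real.rpow_nonneg (abs_nonneg _) _

lemma measurable_sinW (s : ℝ) : Measurable (sinW s) := by unfold sinW; fun_prop

lemma periodic_sinW (s : ℝ) : Function.Periodic (sinW s) Real.pi := by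
  intro x; unfold sinW; rw [Real.sin_add_pi, abs_neg]

lemma intervalIntegrable_abs_rpow {s : ℝ} (hs : s < 1) {c : ℝ} (hc : 0 ≤ c) :
    IntervalIntegrable (fun x : ℝ => |x| ^ (-s)) volume (-c) c := by
  have h1 : IntervalIntegrable (fun x : ℝ => |x| ^ (-s)) volume 0 c := by
    refine (intervalIntegral.intervalIntegrable_rpow' (r := -s) (by linarith)).congr ?_
    intro x hx
    rw [Set.uIoc_of_le hc] at hx
    simp only [abs_of_pos hx.1]
  have h2 := (IntervalIntegrable.iff_comp_neg (f := fun x : ℝ => |x| ^ (-s))).1 h1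
  simp only [abs_neg, neg_zero] at h2
  exact h2.symm.trans h1

lemma intervalIntegrable_sinW {s : ℝ} (hs0 : 0 ≤ s) (hs : s < 1) (a b : ℝ) :
    IntervalIntegrable (sinW s) volume a b := by
  refine (periodic_sinW s).intervalIntegrable (t := -(Real.pi / 2)) Real.pi_ne_zero ?_ a b
  rw [show -(Real.pi / 2) + Real.pi = Real.pi / 2 by ring]
  refine IntervalIntegrable.mono_fun'
    ((intervalIntegrable_abs_rpow hs (by positivity)).const_mul ((2 / Real.pi) ^ (-s)))
    (measurable_sinW s).aestronglyMeasurable ?_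
  refine (ae_restrict_mem measurableSet_uIoc).mono ?_
  intro x hx
  rw [Set.uIoc_of_le (by linarith [Real.pi_pos])] at hx
  dsimp only
  rw [Real.norm_of_nonneg (sinW_nonneg s x),
    ← Real.mul_rpow (by positivity) (abs_nonneg _)]
  rcases eq_or_ne x 0 with rfl | hx0
  · simp [sinW]
  · exact Real.rpow_le_rpow_of_nonpos (by positivity)
      (Real.mul_abs_le_abs_sin (abs_le.2 ⟨hx.1.le, hx.2⟩)) (by linarith)

/-- The integral of the weight over one period. -/
noncomputable def sinWInt (s : ℝ) : ℝ := ∫ x in (0 : ℝ)..Real.pi, sinW s x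

lemma sinWInt_nonneg (s : ℝ) : 0 ≤ sinWInt s :=
  intervalIntegral.integral_nonneg Real.pi_pos.le fun _ _ => sinW_nonneg _ _

lemma integral_sinW_affine {s : ℝ} (hs0 : 0 ≤ s) (hs : s < 1) {k a b c : ℝ} (hk : k ≠ 0) (n : ℤ)
    (h : k * b = k * a + n * Real.pi) :
    ∫ x in a..b, sinW s (k * x + c) = k⁻¹ * (n * sinWInt s) := by
  rw [intervalIntegral.integral_comp_mul_add _ hk, smul_eq_mul,
    show k * b + c = k * a + c + n • Real.pi by rw [h, zsmul_eq_mul]; ring,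
    (periodic_sinW s).intervalIntegral_add_zsmul_eq n _ (intervalIntegrable_sinW hs0 hs),
    (periodic_sinW s).intervalIntegral_add_eq _ 0, zero_add, zsmul_eq_mul]
  rfl

lemma intervalIntegrable_sinW_affine {s : ℝ} (hs0 : 0 ≤ s) (hs : s < 1) {k : ℝ} (hk : k ≠ 0)
    (c a b : ℝ) : IntervalIntegrable (fun x => sinW s (k * x + c)) volume a b := by
  have hp : Function.Periodic (fun x => sinW s (k * x + c)) (Real.pi / k) := by
    intro x
    dsimp only
    rw [show k * (x + Real.pi / k) + c = k * x + c + Real.pi by field_simp; ring,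
      periodic_sinW s]
  have h1 := (intervalIntegrable_sinW hs0 hs (k * a + c) (k * b + c)).comp_add_right c
  have h2 := h1.comp_mul_left (c := k)
  simp only [add_sub_cancel_right] at h2
  rwa [mul_div_cancel_left₀ _ hk, mul_div_cancel_left₀ _ hk] at h2

lemma lintegral_sinW_affine {s : ℝ} (hs0 : 0 ≤ s) (hs : s < 1) {k a b : ℝ} (c : ℝ) (hk : k ≠ 0)
    (hab : a ≤ b) (n : ℤ) (h : k * b = k * a + n * Real.pi) :
    ∫⁻ x in Set.Ioc a b, ENNReal.ofReal (sinW s (k * x + c))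
      = ENNReal.ofReal (k⁻¹ * (n * sinWInt s)) := by
  rw [← integral_sinW_affine hs0 hs hk n h (c := c), intervalIntegral.integral_of_le hab,
    ofReal_integral_eq_lintegral_ofReal]
  · exact (intervalIntegrable_iff_integrableOn_Ioc_of_le hab).1
      (intervalIntegrable_sinW_affine hs0 hs hk c a b)
  · exact Filter.Eventually.of_forall fun _ => sinW_nonneg _ _

/-- Weights in the two characteristic directions are integrable together. -/
lemma lintegral_sinW_mul_sinW {s : ℝ} (hs0 : 0 ≤ s) (hs : s < 1) (θ θ' : ℝ) :
    ∫⁻ β in Set.Ioc 0 (Real.pi / 2), ∫⁻ φ in Set.Ioc (-Real.pi) Real.pi,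
      ENNReal.ofReal (sinW s (2 * (φ + β) - θ)) * ENNReal.ofReal (sinW s (2 * (φ - β) - θ'))
      ≤ ENNReal.ofReal (2 * sinWInt s ^ 2) := by
  have hpi := Real.pi_pos
  set K : ℝ → ENNReal := fun x => ENNReal.ofReal (sinW s x) with hK
  have hKm : Measurable K := (measurable_sinW s).ennreal_ofReal
  have step : ∀ β ∈ Set.Ioc 0 (Real.pi / 2), ∫⁻ φ in Set.Ioc (-Real.pi) Real.pi,
      K (2 * (φ + β) - θ) * K (2 * (φ - β) - θ')
      ≤ ∫⁻ φ in Set.Ioc (-(2 * Real.pi)) (2 * Real.pi),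
        K (2 * (φ + 2 * β) - θ) * K (2 * φ - θ') := by
    intro β hβ
    rw [← lintegral_indicator measurableSet_Ioc, ← lintegral_indicator measurableSet_Ioc,
      ← lintegral_add_right_eq_self _ β]
    refine lintegral_mono fun φ => ?_
    by_cases h : φ + β ∈ Set.Ioc (-Real.pi) Real.pi
    · have h' : φ ∈ Set.Ioc (-(2 * Real.pi)) (2 * Real.pi) :=
        ⟨by linarith [h.1, hβ.2], by linarith [h.2, hβ.1]⟩
      rw [Set.indicator_of_mem h, Set.indicator_of_mem h']
      rw [show φ + β + β = φ + 2 * β by ring, show φ + β - β = φ by ring]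
    · rw [Set.indicator_of_notMem h]
      exact zero_le
  calc _ ≤ ∫⁻ β in Set.Ioc 0 (Real.pi / 2), ∫⁻ φ in Set.Ioc (-(2 * Real.pi)) (2 * Real.pi),
        K (2 * (φ + 2 * β) - θ) * K (2 * φ - θ') :=
        setLIntegral_mono' measurableSet_Ioc step
    _ = ∫⁻ φ in Set.Ioc (-(2 * Real.pi)) (2 * Real.pi), ∫⁻ β in Set.Ioc 0 (Real.pi / 2),
        K (2 * (φ + 2 * β) - θ) * K (2 * φ - θ') := by
        refine lintegral_lintegral_swap ?_
        apply Measurable.aemeasurable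
        unfold Function.uncurry
        fun_prop
    _ = ∫⁻ φ in Set.Ioc (-(2 * Real.pi)) (2 * Real.pi),
        ENNReal.ofReal ((4 : ℝ)⁻¹ * ((2 : ℤ) * sinWInt s)) * K (2 * φ - θ') := by
        refine lintegral_congr fun φ => ?_
        rw [lintegral_mul_const _ (by fun_prop),
          ← lintegral_sinW_affine hs0 hs (2 * φ - θ) (by norm_num) (by positivity) 2
            (a := 0) (b := Real.pi / 2) (by push_cast; ring)]
        congr 1
        refine lintegral_congr fun β => ?_
        rw [hK]
        congr 2
        ring
    _ = ENNReal.ofReal ((4 : ℝ)⁻¹ * ((2 : ℤ) * sinWInt s))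
        * ENNReal.ofReal ((2 : ℝ)⁻¹ * ((8 : ℤ) * sinWInt s)) := by
        rw [lintegral_const_mul _ (by fun_prop)]
        congr 1
        exact lintegral_sinW_affine hs0 hs (-θ') (by norm_num) (by linarith) 8
            (by push_cast; ring)
    _ ≤ _ := by
        rw [← ENNReal.ofReal_mul (by have := sinWInt_nonneg s; positivity)]
        refine ENNReal.ofReal_le_ofReal (le_of_eq ?_)
        push_cast
        ring

/-- The truncated weight `|x|^{-s}` on `[-1, 1]`. -/
noncomputable def absW (s x : ℝ) : ℝ := (Set.Ioc (-1 : ℝ) 1).indicator (fun x => |x| ^ (-s)) x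

lemma absW_nonneg (s x : ℝ) : 0 ≤ absW s x :=
  Set.indicator_nonneg (fun _ _ => Real.rpow_nonneg (abs_nonneg _) _) _

lemma integrable_absW {s : ℝ} (hs : s < 1) : Integrable (absW s) := by
  unfold absW
  refine IntegrableOn.integrable_indicator ?_ measurableSet_Ioc
  exact (intervalIntegrable_iff_integrableOn_Ioc_of_le (by norm_num)).1
    (intervalIntegrable_abs_rpow hs zero_le_one)

lemma min_one_rpow_le {s : ℝ} (x : ℝ) :
    min 1 |x| ^ (-s) ≤ 1 + absW s x := by
  have h0 := absW_nonneg s x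
  by_cases h : 1 ≤ |x|
  · rw [min_eq_left h, Real.one_rpow]
    linarith
  · push Not at h
    have hx : x ∈ Set.Ioc (-1 : ℝ) 1 := ⟨(abs_lt.1 h).1, (abs_lt.1 h).2.le⟩
    rw [min_eq_right h.le, absW, Set.indicator_of_mem hx]
    linarith

lemma half_min_le_abs_exp_sub (m τ : ℝ) (hm : 0 ≤ m) :
    Real.exp (2 * τ) * (min 1 |τ - Real.log m / 2| / 2) ≤ |Real.exp (2 * τ) - m| := by
  have hE := Real.exp_pos (2 * τ)
  rcases hm.eq_or_lt with rfl | hm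
  · rw [sub_zero, Real.abs_exp]
    have : min 1 |τ - Real.log 0 / 2| ≤ 1 := min_le_left _ _
    nlinarith
  · set v := Real.log m / 2 with hv
    have hmv : m = Real.exp (2 * τ) * Real.exp (2 * (v - τ)) := by
      rw [← Real.exp_add, show 2 * τ + 2 * (v - τ) = Real.log m by rw [hv]; ring, Real.exp_log hm]
    have hfac : |Real.exp (2 * τ) - m| = Real.exp (2 * τ) * |Real.exp (2 * (v - τ)) - 1| := by
      rw [show Real.exp (2 * τ) - m = -(Real.exp (2 * τ) * (Real.exp (2 * (v - τ)) - 1)) by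
        rw [mul_sub, ← hmv]; ring, abs_neg, abs_mul, Real.abs_exp]
    rw [hfac]
    refine mul_le_mul_of_nonneg_left ?_ hE.le
    rw [abs_sub_comm τ v]
    set w := v - τ
    rcases le_total 0 w with hw | hw
    · have h1 := Real.add_one_le_exp (2 * w)
      have h2 : min 1 |w| ≤ |w| := min_le_right _ _
      rw [abs_of_nonneg (by linarith : 0 ≤ Real.exp (2 * w) - 1)]
      rw [abs_of_nonneg hw] at h2 ⊢
      linarith
    · have h1 := Real.add_one_le_exp (-(2 * w))
      have h3 : Real.exp (2 * w) * Real.exp (-(2 * w)) = 1 := by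
        rw [← Real.exp_add]; simp
      have hpos := Real.exp_pos (2 * w)
      have hle : Real.exp (2 * w) ≤ 1 := Real.exp_le_one_iff.2 (by linarith)
      rw [abs_of_nonpos (by linarith : Real.exp (2 * w) - 1 ≤ 0), abs_of_nonpos hw]
      have h5 : Real.exp (2 * w) * (1 - 2 * w) ≤ 1 := by nlinarith
      rcases le_total 1 (-w) with h6 | h6
      · rw [min_eq_left h6]
        nlinarith
      · rw [min_eq_right h6]
        nlinarith

end Weights

section
variable {a b : ℝ}

/-- The value of `τ` at which `e^{2τ}` is the modulus of the `j`-th root. -/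
noncomputable def CriticalRoots.height (M : CriticalRoots a b) (j : Fin 3) : ℝ :=
  Real.log ‖M.μ j‖ / 2

lemma CriticalRoots.exp_mul_min_le (M : CriticalRoots a b) (j : Fin 3) (τ φ : ℝ) :
    Real.exp (2 * τ) * (min 1 |τ - M.height j| / 2) ≤ M.dist j τ φ :=
  (half_min_le_abs_exp_sub _ τ (norm_nonneg _)).trans (M.abs_sub_norm_le j τ φ)

lemma CriticalRoots.angle_rpow (M : CriticalRoots a b) (j : Fin 3) (s φ : ℝ) :
    M.angle j φ ^ (-s) = sinW s (2 * φ - (M.μ j).arg) := rfl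

lemma CriticalRoots.angle_nonneg (M : CriticalRoots a b) (j : Fin 3) (φ : ℝ) :
    0 ≤ M.angle j φ := abs_nonneg _

lemma CriticalRoots.angle_le_one (M : CriticalRoots a b) (j : Fin 3) (φ : ℝ) :
    M.angle j φ ≤ 1 := Real.abs_sin_le_one _

lemma CriticalRoots.ae_angle_pos (M : CriticalRoots a b) (β : ℝ) :
    ∀ᵐ φ : ℝ, ∀ j, 0 < M.angle j (φ + β) := by
  rw [ae_all_iff]
  intro j
  have hc : {φ : ℝ | Real.sin (2 * (φ + β) - (M.μ j).arg) = 0}.Countable := by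
    refine (Set.countable_range (fun n : ℤ => (n * Real.pi + (M.μ j).arg) / 2 - β)).mono ?_
    intro φ hφ
    obtain ⟨n, hn⟩ := Real.sin_eq_zero_iff.1 hφ
    exact ⟨n, by dsimp only; rw [hn]; ring⟩
  refine (hc.ae_notMem volume).mono ?_
  intro φ hφ
  exact abs_pos.2 hφ

end

end NovikovVeselov

namespace NovikovVeselov

section Young
open Real

lemma one_div_exp_add_exp_le {n k θ : ℝ} (h0 : 0 ≤ θ) (h1 : θ ≤ 1) :
    1 / (exp n + exp k) ≤ exp (-(θ * n + (1 - θ) * k)) := by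
  have h := Real.geom_mean_le_arith_mean2_weighted h0 (by linarith : 0 ≤ 1 - θ) (exp_pos n).le
    (exp_pos k).le (by ring)
  rw [← exp_mul, ← exp_mul, ← exp_add] at h
  have hn := exp_pos n
  have hk := exp_pos k
  rw [exp_neg, ← one_div]
  refine one_div_le_one_div_of_le (exp_pos _) ?_
  rw [show θ * n + (1 - θ) * k = n * θ + k * (1 - θ) by ring]
  nlinarith

lemma one_div_exp_add_exp_add_exp_le {n k l θ θ' : ℝ} (h0 : 0 ≤ θ) (h1 : 0 ≤ θ')
    (h2 : θ + θ' ≤ 1) :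
    1 / (exp n + (exp k + exp l)) ≤ exp (-(θ * n + θ' * k + (1 - θ - θ') * l)) := by
  have h := Real.geom_mean_le_arith_mean3_weighted h0 h1 (by linarith : 0 ≤ 1 - θ - θ')
    (exp_pos n).le (exp_pos k).le (exp_pos l).le (by ring)
  rw [← exp_mul, ← exp_mul, ← exp_mul, ← exp_add, ← exp_add] at h
  have hn := exp_pos n
  have hk := exp_pos k
  have hl := exp_pos l
  rw [exp_neg, ← one_div]
  refine one_div_le_one_div_of_le (exp_pos _) ?_
  rw [show θ * n + θ' * k + (1 - θ - θ') * l = n * θ + k * θ' + l * (1 - θ - θ') by ring]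
  nlinarith

lemma sqrt_exp (n : ℝ) : √(exp n) = exp (n / 2) := by
  rw [show exp n = exp (n / 2) * exp (n / 2) by rw [← exp_add]; congr 1; ring,
    Real.sqrt_mul_self (exp_pos _).le]

/-- The relations, in logarithmic form, between the squared gradient `exp n` of the inner phase at
`(x, y)`, the distances `exp lp`, `exp lr` of `x` and `y` to the roots, and `exp lq = |sin (x-y)|`. -/
structure InnerLog (n lp lr lq : ℝ) : Prop where
  hp : 6 * lp ≤ n
  hr : 6 * lr ≤ n
  hpq : 4 * lp + 2 * lq ≤ n
  hrq : 4 * lr + 2 * lq ≤ n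
  hor : 2 * lp + 4 * lq ≤ n ∨ 2 * lr + 4 * lq ≤ n
  hq : lq ≤ 0

variable {n lp lr lq lt ω : ℝ}

lemma InnerLog.symm (h : InnerLog n lp lr lq) : InnerLog n lr lp lq :=
  ⟨h.hr, h.hp, h.hrq, h.hpq, h.hor.symm, h.hq⟩

lemma InnerLog.amplitude_le (h : InnerLog n lp lr lq) (hω0 : 0 ≤ ω) (hω1 : ω ≤ 1) :
    exp lq * ((exp (2 * lq - lt) + exp (-(3 / 2 * lt)))
      / (exp n + (exp (2 * lq - lt) + exp (-(3 / 2 * lt)))))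
      ≤ 2 * exp (-(3 / 4 * ω * lt) - ω * lp - ω * lr) := by
  wlog hor : 2 * lp + 4 * lq ≤ n generalizing lp lr
  · have := this h.symm (h.hor.resolve_left hor)
    refine this.trans (le_of_eq ?_)
    congr 2; ring
  have e1 : exp (2 * lq - lt) / (exp n + (exp (2 * lq - lt) + exp (-(3 / 2 * lt))))
      ≤ exp (2 * lq - lt) * exp (-(3 / 4 * ω * n + (1 - 3 / 4 * ω) * (2 * lq - lt))) := by
    rw [div_eq_mul_one_div]
    refine mul_le_mul_of_nonneg_left (le_trans ?_ (one_div_exp_add_exp_le (by linarith)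
      (by linarith))) (exp_pos _).le
    refine one_div_le_one_div_of_le (by positivity) ?_
    have := exp_pos (-(3 / 2 * lt))
    linarith
  have e2 : exp (-(3 / 2 * lt)) / (exp n + (exp (2 * lq - lt) + exp (-(3 / 2 * lt))))
      ≤ exp (-(3 / 2 * lt)) * exp (-(ω / 2 * n + (1 - ω / 2) * (-(3 / 2 * lt)))) := by
    rw [div_eq_mul_one_div]
    refine mul_le_mul_of_nonneg_left (le_trans ?_ (one_div_exp_add_exp_le (by linarith)
      (by linarith))) (exp_pos _).le
    refine one_div_le_one_div_of_le (by positivity) ?_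
    have := exp_pos (2 * lq - lt)
    linarith
  rw [add_div]
  calc _ ≤ exp lq * (exp (2 * lq - lt) * exp (-(3 / 4 * ω * n + (1 - 3 / 4 * ω) * (2 * lq - lt)))
        + exp (-(3 / 2 * lt)) * exp (-(ω / 2 * n + (1 - ω / 2) * (-(3 / 2 * lt))))) := by
        gcongr
    _ ≤ exp (-(3 / 4 * ω * lt) - ω * lp - ω * lr) + exp (-(3 / 4 * ω * lt) - ω * lp - ω * lr) := by
        rw [mul_add, ← exp_add, ← exp_add, ← exp_add, ← exp_add]
        have h0 := mul_nonneg (sub_nonneg.2 hω1) (neg_nonneg.2 h.hq)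
        refine add_le_add (exp_le_exp.2 ?_) (exp_le_exp.2 ?_)
        · have h1 := mul_le_mul_of_nonneg_left hor (by linarith : 0 ≤ ω / 2)
          have h2 := mul_le_mul_of_nonneg_left h.hrq (by linarith : 0 ≤ ω / 4)
          linarith
        · have h1 := mul_le_mul_of_nonneg_left h.hpq (by linarith : 0 ≤ ω / 4)
          have h2 := mul_le_mul_of_nonneg_left h.hrq (by linarith : 0 ≤ ω / 4)
          linarith
    _ = _ := by ring

lemma InnerLog.gradient_le (h : InnerLog n lp lr lq) (hω0 : 0 ≤ ω) (hω1 : ω ≤ 1) :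
    exp (n / 2) / (exp n + (exp (2 * lq - lt) + exp (-(3 / 2 * lt))))
      ≤ exp (3 / 4 * lt - ω / 2 * lt - ω * lp - ω * lr) := by
  have e2 : exp (n / 2) / (exp n + (exp (2 * lq - lt) + exp (-(3 / 2 * lt))))
      ≤ exp (n / 2) * exp (-((1 / 2 + ω / 3) * n
        + (1 - (1 / 2 + ω / 3)) * (-(3 / 2 * lt)))) := by
    rw [div_eq_mul_one_div]
    refine mul_le_mul_of_nonneg_left (le_trans ?_ (one_div_exp_add_exp_le (by linarith)
      (by linarith))) (exp_pos _).le
    refine one_div_le_one_div_of_le (by positivity) ?_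
    have := exp_pos (2 * lq - lt)
    linarith
  refine e2.trans ?_
  rw [← exp_add]
  refine exp_le_exp.2 ?_
  have h1 := mul_le_mul_of_nonneg_left h.hp (by linarith : 0 ≤ ω / 6)
  have h2 := mul_le_mul_of_nonneg_left h.hr (by linarith : 0 ≤ ω / 6)
  linarith

lemma InnerLog.hessian_le (h : InnerLog n lp lr lq) (hω0 : 0 ≤ ω) (hω1 : ω ≤ 1) {S K c : ℝ}
    (hS : 0 ≤ S) (hK : 1 ≤ K) (hc : 1 ≤ c) (h1 : S ≤ K) (h2 : S ≤ c * exp (n / 2 - lp)) :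
    exp lq * (S / (exp n + (exp (2 * lq - lt) + exp (-(3 / 2 * lt)))))
      ≤ K * c * exp (1 / 4 * lt + (1 - ω) * lt - ω * lp - ω * lr) := by
  have hSle : S ≤ K * c * exp (ω * (n / 2 - lp)) := by
    rcases hS.eq_or_lt with h0 | h0
    · rw [← h0]; positivity
    · calc S = S ^ (1 - ω) * S ^ ω := by rw [← Real.rpow_add h0]; simp
        _ ≤ K ^ (1 - ω) * (c * exp (n / 2 - lp)) ^ ω := by
            have : 0 ≤ 1 - ω := by linarith
            gcongr
        _ = K ^ (1 - ω) * c ^ ω * exp (ω * (n / 2 - lp)) := by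
            rw [Real.mul_rpow (by linarith) (exp_pos _).le, ← exp_mul, mul_assoc]
            congr 3; ring
        _ ≤ _ := by
            gcongr
            · exact (Real.rpow_le_rpow_of_exponent_le hK (by linarith)).trans_eq (Real.rpow_one K)
            · exact (Real.rpow_le_rpow_of_exponent_le hc (by linarith)).trans_eq (Real.rpow_one c)
  have e : 1 / (exp n + (exp (2 * lq - lt) + exp (-(3 / 2 * lt)))) ≤ _ :=
    one_div_exp_add_exp_add_exp_le (θ := 3 / 4 * ω) (θ' := 1 / 2 - ω / 4) (by linarith)
      (by linarith) (by linarith)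
  calc _ = exp lq * (S * (1 / (exp n + (exp (2 * lq - lt) + exp (-(3 / 2 * lt)))))) := by ring
    _ ≤ exp lq * ((K * c * exp (ω * (n / 2 - lp))) * exp (-(3 / 4 * ω * n + (1 / 2 - ω / 4) * (2 * lq - lt)
          + (1 - 3 / 4 * ω - (1 / 2 - ω / 4)) * -(3 / 2 * lt)))) := by gcongr
    _ = K * c * (exp lq * (exp (ω * (n / 2 - lp)) * exp (-(3 / 4 * ω * n + (1 / 2 - ω / 4) * (2 * lq - lt)
          + (1 - 3 / 4 * ω - (1 / 2 - ω / 4)) * -(3 / 2 * lt))))) := by ring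
    _ ≤ _ := by
        rw [← exp_add, ← exp_add]
        refine mul_le_mul_of_nonneg_left (exp_le_exp.2 ?_) (by positivity)
        have h2 := mul_le_mul_of_nonneg_left h.hrq (by linarith : 0 ≤ ω / 4)
        linarith

/-- The same bound when the parameter `exp l` is large. -/
lemma InnerLog.hessian_le_of_large (hq : lq ≤ 0) (hω0 : 1 / 2 ≤ ω) (hω1 : ω ≤ 1) {S l c : ℝ}
    (hlt : 0 ≤ lt) (hl : 0 ≤ l) (hc : 1 ≤ c) (hS : 0 ≤ S) (hSl : S ≤ 3 * exp l)
    (h1 : 2 * l + 2 * lp - 2 * log c ≤ n) (h2 : 2 * l + 2 * lr - 2 * log c ≤ n) :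
    exp lq * (S / (exp n + (exp (2 * lq - lt) + exp (-(3 / 2 * lt)))))
      ≤ 3 * c ^ 2 * exp (1 / 4 * lt + (1 - ω) * lt - ω * lp - ω * lr) := by
  have e : 1 / (exp n + (exp (2 * lq - lt) + exp (-(3 / 2 * lt))))
      ≤ exp (-(ω * n + (1 - ω) * (-(3 / 2 * lt)))) := by
    refine le_trans ?_ (one_div_exp_add_exp_le (by linarith) (by linarith))
    refine one_div_le_one_div_of_le (by positivity) ?_
    have := exp_pos (2 * lq - lt)
    linarith
  have hlc : 0 ≤ log c := log_nonneg hc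
  have hc2 : c ^ 2 = exp (2 * log c) := by
    rw [two_mul, exp_add, exp_log (by linarith), sq]
  calc _ = exp lq * (S * (1 / (exp n + (exp (2 * lq - lt) + exp (-(3 / 2 * lt)))))) := by ring
    _ ≤ 1 * ((3 * exp l) * exp (-(ω * n + (1 - ω) * (-(3 / 2 * lt))))) := by
        gcongr
        exact exp_le_one_iff.2 hq
    _ = 3 * (exp l * exp (-(ω * n + (1 - ω) * (-(3 / 2 * lt))))) := by ring
    _ ≤ 3 * (exp (2 * log c + (1 / 4 * lt + (1 - ω) * lt - ω * lp - ω * lr))) := by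
        rw [← exp_add]
        refine mul_le_mul_of_nonneg_left (exp_le_exp.2 ?_) (by positivity)
        have g1 := mul_le_mul_of_nonneg_left h1 (by linarith : 0 ≤ ω / 2)
        have g2 := mul_le_mul_of_nonneg_left h2 (by linarith : 0 ≤ ω / 2)
        have g3 := mul_nonneg hl (by linarith : 0 ≤ 2 * ω - 1)
        have g4 := mul_nonneg hlc (by linarith : 0 ≤ 1 - ω)
        have g5 := mul_nonneg hlt (by linarith : 0 ≤ ω - 1 / 2)
        linarith
    _ = _ := by rw [exp_add, hc2]; ring

end Young

end NovikovVeselov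

namespace NovikovVeselov

section
open Real

lemma prod_three_le {x y z x' y' z' : ℝ} (hx : 0 ≤ x) (hy : 0 ≤ y) (hz : 0 ≤ z) (h1 : x ≤ x')
    (h2 : y ≤ y') (h3 : z ≤ z') : x * y * z ≤ x' * y' * z' := by
  have : 0 ≤ x' := hx.trans h1
  have : 0 ≤ y' := hy.trans h2
  gcongr

lemma innerLog_of_dist {X Y : Fin 3 → ℝ} {p r q N : ℝ} (hp : 0 < p) (hr : 0 < r) (hq : 0 < q)
    (hq1 : q ≤ 1) (hX : ∀ j, p ≤ X j) (hY : ∀ j, r ≤ Y j) (hXY : ∀ j, q ≤ X j ∨ q ≤ Y j)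
    (hN : (X 0 * X 1 * X 2) ^ 2 + (Y 0 * Y 1 * Y 2) ^ 2 ≤ N) :
    InnerLog (log N) (log p) (log r) (log q) := by
  set A := X 0 * X 1 * X 2 with hA
  set B := Y 0 * Y 1 * Y 2 with hB
  have hlog : ∀ (i k : ℕ) (z : ℝ), 0 < z → z ^ i * q ^ k ≤ N → i * log z + k * log q ≤ log N := by
    intro i k z hz h
    have h2 := log_le_log (by positivity) h
    rwa [log_mul (by positivity) (by positivity), log_pow, log_pow] at h2
  have hsqA : ∀ z : ℝ, 0 ≤ z → z ≤ A → z ^ 2 ≤ N := by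
    intro z hz h
    have : z ^ 2 ≤ A ^ 2 := by gcongr
    nlinarith [sq_nonneg B]
  have hsqB : ∀ z : ℝ, 0 ≤ z → z ≤ B → z ^ 2 ≤ N := by
    intro z hz h
    have : z ^ 2 ≤ B ^ 2 := by gcongr
    nlinarith [sq_nonneg A]
  have a0 := hX 0
  have a1 := hX 1
  have a2 := hX 2
  have b0 := hY 0
  have b1 := hY 1
  have b2 := hY 2
  have one : ∀ (Z : Fin 3 → ℝ) (z : ℝ), 0 < z → (∀ j, z ≤ Z j) → (∃ j, q ≤ Z j) →
      z ^ 2 * q ≤ Z 0 * Z 1 * Z 2 := by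
    rintro Z z hz h ⟨j, hj⟩
    fin_cases j
    · exact le_trans (le_of_eq (by ring)) (prod_three_le hq.le hz.le hz.le hj (h 1) (h 2))
    · exact le_trans (le_of_eq (by ring)) (prod_three_le hz.le hq.le hz.le (h 0) hj (h 2))
    · exact le_trans (le_of_eq (by ring)) (prod_three_le hz.le hz.le hq.le (h 0) (h 1) hj)
  refine ⟨?_, ?_, ?_, ?_, ?_, log_nonpos hq.le hq1⟩
  · have := hlog 6 0 p hp (by
      have := hsqA (p * p * p) (by positivity) (prod_three_le hp.le hp.le hp.le a0 a1 a2)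
      calc _ = (p * p * p) ^ 2 := by ring
        _ ≤ _ := this)
    push_cast at this; linarith
  · have := hlog 6 0 r hr (by
      have := hsqB (r * r * r) (by positivity) (prod_three_le hr.le hr.le hr.le b0 b1 b2)
      calc _ = (r * r * r) ^ 2 := by ring
        _ ≤ _ := this)
    push_cast at this; linarith
  · have := hlog 4 2 p hp (by
      calc _ = (p ^ 2 * q) ^ 2 := by ring
        _ ≤ N := by
          by_cases hex : ∃ j, q ≤ X j
          · exact hsqA _ (by positivity) (one X p hp hX hex)
          · push Not at hex
            have hYq : ∀ j, q ≤ Y j := fun j => (hXY j).resolve_left (not_le.2 (hex j))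
            refine hsqB _ (by positivity) (le_trans ?_ (prod_three_le hq.le hq.le hq.le
              (hYq 0) (hYq 1) (hYq 2)))
            have hpq : p ≤ q := a0.trans (hex 0).le
            calc p ^ 2 * q ≤ q ^ 2 * q := by gcongr
              _ = _ := by ring)
    push_cast at this; linarith
  · have := hlog 4 2 r hr (by
      calc _ = (r ^ 2 * q) ^ 2 := by ring
        _ ≤ N := by
          by_cases hex : ∃ j, q ≤ Y j
          · exact hsqB _ (by positivity) (one Y r hr hY hex)
          · push Not at hex
            have hXq : ∀ j, q ≤ X j := fun j => (hXY j).resolve_right (not_le.2 (hex j))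
            refine hsqA _ (by positivity) (le_trans ?_ (prod_three_le hq.le hq.le hq.le
              (hXq 0) (hXq 1) (hXq 2)))
            have hpq : r ≤ q := b0.trans (hex 0).le
            calc r ^ 2 * q ≤ q ^ 2 * q := by gcongr
              _ = _ := by ring)
    push_cast at this; linarith
  · have hl : ∀ z : ℝ, 0 < z → (z * q ^ 2) ^ 2 ≤ N → 2 * log z + 4 * log q ≤ log N := by
      intro z hz h
      have := hlog 2 4 z hz (by
        calc _ = (z * q ^ 2) ^ 2 := by ring
          _ ≤ N := h)
      push_cast at this
      linarith
    have hA2 : ∀ x y z : ℝ, p ≤ x → q ≤ y → q ≤ z → x * y * z = A →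
        2 * log p + 4 * log q ≤ log N := by
      intro x y z h1 h2 h3 h
      refine hl p hp (hsqA _ (by positivity) ?_)
      rw [← h]
      calc _ = p * q * q := by ring
        _ ≤ _ := prod_three_le hp.le hq.le hq.le h1 h2 h3
    have hB2 : ∀ x y z : ℝ, r ≤ x → q ≤ y → q ≤ z → x * y * z = B →
        2 * log r + 4 * log q ≤ log N := by
      intro x y z h1 h2 h3 h
      refine hl r hr (hsqB _ (by positivity) ?_)
      rw [← h]
      calc _ = r * q * q := by ring
        _ ≤ _ := prod_three_le hr.le hq.le hq.le h1 h2 h3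
    rcases hXY 0 with h0 | h0 <;> rcases hXY 1 with h1 | h1
    · exact Or.inl (hA2 _ _ _ a2 h0 h1 (by rw [hA]; ring))
    · rcases hXY 2 with h2 | h2
      · exact Or.inl (hA2 _ _ _ a1 h0 h2 (by rw [hA]; ring))
      · exact Or.inr (hB2 _ _ _ b0 h1 h2 hB.symm)
    · rcases hXY 2 with h2 | h2
      · exact Or.inl (hA2 _ _ _ a0 h1 h2 hA.symm)
      · exact Or.inr (hB2 _ _ _ b1 h0 h2 (by rw [hB]; ring))
    · exact Or.inr (hB2 _ _ _ b2 h0 h1 (by rw [hB]; ring))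

/-- The amplitude and the regularization inside the disc of radius `2`. -/
noncomputable def innerWeight (α t : ℝ) (hα : 0 ≤ α) (ht : 0 < t) : RadialWeight where
  b β := 2 ^ (2 + α) * (sin β * cos β ^ (1 + α))
  b' β := 2 ^ (2 + α) * (cos β * cos β ^ (1 + α) - (1 + α) * sin β ^ 2 * cos β ^ α)
  κ β := sin (2 * β) ^ 2 / t + t ^ (-(3 / 2) : ℝ)
  κ' β := 4 * sin (2 * β) * cos (2 * β) / t
  deriv_b x := by
    have h1 : HasDerivAt (fun β => cos β ^ (1 + α)) (-sin x * (1 + α) * cos x ^ (1 + α - 1)) x :=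
      (hasDerivAt_cos x).rpow_const (Or.inr (by linarith))
    rw [add_sub_cancel_left] at h1
    exact (((hasDerivAt_sin x).mul h1).const_mul _).congr_deriv (by ring)
  deriv_κ x := by
    have h1 : HasDerivAt (fun β => sin (2 * β)) (cos (2 * x) * 2) x := by
      have := ((hasDerivAt_id x).const_mul 2).sin
      simpa using this
    exact (((h1.pow 2).div_const t).add_const _).congr_deriv (by push_cast; ring)
  cont_b' := by
    have h1 : Continuous (fun β => cos β ^ (1 + α)) :=
      continuous_cos.rpow_const fun _ => Or.inr (by linarith)
    have h2 : Continuous (fun β => cos β ^ α) :=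
      continuous_cos.rpow_const fun _ => Or.inr hα
    fun_prop
  cont_κ' := by fun_prop
  κ_pos x := by positivity

variable {α t : ℝ}

lemma two_rpow_le (hα1 : α ≤ 1 / 4) : (2 : ℝ) ^ (2 + α) ≤ 8 := by
  calc (2 : ℝ) ^ (2 + α) ≤ 2 ^ (3 : ℝ) :=
        Real.rpow_le_rpow_of_exponent_le (by norm_num) (by linarith)
    _ = 8 := by norm_num

lemma innerWeight_b_nonneg (hα : 0 ≤ α) (ht : 0 < t) {β : ℝ} (h0 : 0 ≤ β) (h1 : β ≤ π / 2) :
    0 ≤ (innerWeight α t hα ht).b β := by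
  have hs : 0 ≤ sin β := sin_nonneg_of_nonneg_of_le_pi h0 (by linarith [pi_pos])
  have hc : 0 ≤ cos β := cos_nonneg_of_neg_pi_div_two_le_of_le (by linarith [pi_pos]) h1
  simp only [innerWeight]
  positivity

lemma innerWeight_b_le (hα : 0 ≤ α) (hα1 : α ≤ 1 / 4) (ht : 0 < t) {β : ℝ} (h0 : 0 ≤ β)
    (h1 : β ≤ π / 2) : (innerWeight α t hα ht).b β ≤ 4 * sin (2 * β) := by
  have hs : 0 ≤ sin β := sin_nonneg_of_nonneg_of_le_pi h0 (by linarith [pi_pos])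
  have hc : 0 ≤ cos β := cos_nonneg_of_neg_pi_div_two_le_of_le (by linarith [pi_pos]) h1
  have h2 : cos β ^ (1 + α) ≤ cos β := by
    rcases hc.eq_or_lt with h | h
    · rw [← h, zero_rpow (by linarith)]
    · exact (Real.rpow_le_rpow_of_exponent_ge h (cos_le_one β)
        (by linarith : (1 : ℝ) ≤ 1 + α)).trans_eq (rpow_one _)
  simp only [innerWeight]
  rw [sin_two_mul]
  calc _ ≤ 8 * (sin β * cos β) := by
        gcongr
        exact two_rpow_le hα1
    _ = _ := by ring

lemma innerWeight_b'_le (hα : 0 ≤ α) (hα1 : α ≤ 1 / 4) (ht : 0 < t) {β : ℝ} (h0 : 0 ≤ β)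
    (h1 : β ≤ π / 2) : |(innerWeight α t hα ht).b' β| ≤ 18 := by
  have hc : 0 ≤ cos β := cos_nonneg_of_neg_pi_div_two_le_of_le (by linarith [pi_pos]) h1
  have h2 : cos β ^ (1 + α) ≤ 1 := rpow_le_one hc (cos_le_one _) (by linarith)
  have h3 : cos β ^ α ≤ 1 := rpow_le_one hc (cos_le_one _) hα
  have h2' : 0 ≤ cos β ^ (1 + α) := by positivity
  have h3' : 0 ≤ cos β ^ α := by positivity
  have h4 : sin β ^ 2 ≤ 1 := sin_sq_le_one β
  simp only [innerWeight]
  rw [abs_mul, abs_of_pos (by positivity : (0 : ℝ) < 2 ^ (2 + α))]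
  have e : |cos β * cos β ^ (1 + α) - (1 + α) * sin β ^ 2 * cos β ^ α| ≤ 1 + (1 + 1 / 4) := by
    refine (abs_sub _ _).trans ?_
    rw [abs_of_nonneg (by positivity), abs_of_nonneg (by positivity)]
    have e1 : cos β * cos β ^ (1 + α) ≤ 1 * 1 := by
      gcongr
      exact cos_le_one β
    have e2 : (1 + α) * sin β ^ 2 * cos β ^ α ≤ (1 + 1 / 4) * 1 * 1 := by gcongr
    linarith
  have := mul_le_mul (two_rpow_le hα1) e (abs_nonneg _) (by norm_num)
  linarith

lemma innerWeight_b_mul_κ'_le (hα : 0 ≤ α) (hα1 : α ≤ 1 / 4) (ht : 0 < t) {β : ℝ} (h0 : 0 ≤ β)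
    (h1 : β ≤ π / 2) : (innerWeight α t hα ht).b β * |(innerWeight α t hα ht).κ' β|
      ≤ 16 * (innerWeight α t hα ht).κ β := by
  have hs : 0 ≤ sin (2 * β) := sin_nonneg_of_nonneg_of_le_pi (by linarith) (by linarith)
  have hb := innerWeight_b_le hα hα1 ht h0 h1
  have hk : |(innerWeight α t hα ht).κ' β| ≤ 4 * sin (2 * β) / t := by
    simp only [innerWeight]
    rw [abs_div, abs_mul, abs_mul, abs_of_pos ht, abs_of_nonneg hs,
      abs_of_pos (by norm_num : (0 : ℝ) < 4)]
    have := abs_cos_le_one (2 * β)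
    have h4 : 4 * sin (2 * β) * |cos (2 * β)| ≤ 4 * sin (2 * β) :=
      mul_le_of_le_one_right (by positivity) this
    gcongr
  calc _ ≤ (4 * sin (2 * β)) * (4 * sin (2 * β) / t) := by gcongr
    _ = 16 * (sin (2 * β) ^ 2 / t) := by ring
    _ ≤ _ := by
      simp only [innerWeight]
      have : 0 ≤ t ^ (-(3 / 2) : ℝ) := by positivity
      linarith

end

section
open Real
variable {a b : ℝ}

/-- The distance to the set of roots on the unit circle. -/
noncomputable def CriticalRoots.minDist (M : CriticalRoots a b) (τ φ : ℝ) : ℝ :=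
  min (M.dist 0 τ φ) (min (M.dist 1 τ φ) (M.dist 2 τ φ))

lemma CriticalRoots.minDist_le (M : CriticalRoots a b) (τ φ : ℝ) (j : Fin 3) :
    M.minDist τ φ ≤ M.dist j τ φ := by
  unfold CriticalRoots.minDist
  fin_cases j
  · exact min_le_left _ _
  · exact (min_le_right _ _).trans (min_le_left _ _)
  · exact (min_le_right _ _).trans (min_le_right _ _)

lemma CriticalRoots.exists_minDist_eq (M : CriticalRoots a b) (τ φ : ℝ) :
    ∃ j, M.minDist τ φ = M.dist j τ φ := by
  unfold CriticalRoots.minDist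
  rcases min_choice (M.dist 0 τ φ) (min (M.dist 1 τ φ) (M.dist 2 τ φ)) with h | h
  · exact ⟨0, h⟩
  · rcases min_choice (M.dist 1 τ φ) (M.dist 2 τ φ) with h' | h'
    · exact ⟨1, h.trans h'⟩
    · exact ⟨2, h.trans h'⟩

lemma CriticalRoots.angle_le_dist (M : CriticalRoots a b) (j : Fin 3) {τ : ℝ} (hτ : 0 ≤ τ)
    (φ : ℝ) : M.angle j φ ≤ M.dist j τ φ := by
  refine le_trans ?_ (M.exp_mul_angle_le j τ φ)
  have : 1 ≤ exp (2 * τ) := one_le_exp (by linarith)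
  exact le_mul_of_one_le_left (M.angle_nonneg j φ) this

lemma CriticalRoots.minDist_pos (M : CriticalRoots a b) {τ φ : ℝ} (hτ : 0 ≤ τ)
    (h : ∀ j, 0 < M.angle j φ) : 0 < M.minDist τ φ := by
  obtain ⟨j, hj⟩ := M.exists_minDist_eq τ φ
  rw [hj]
  exact (h j).trans_le (M.angle_le_dist j hτ φ)

/-- The weight of all the roots together. -/
noncomputable def CriticalRoots.angleW (M : CriticalRoots a b) (s φ : ℝ) : ℝ :=
  ∑ j, sinW s (2 * φ - (M.μ j).arg)

lemma CriticalRoots.minDist_rpow_le (M : CriticalRoots a b) {s φ : ℝ} (hs : 0 ≤ s)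
    (h : ∀ j, 0 < M.angle j φ) : M.minDist 0 φ ^ (-s) ≤ M.angleW s φ := by
  obtain ⟨j, hj⟩ := M.exists_minDist_eq 0 φ
  rw [hj]
  refine (Real.rpow_le_rpow_of_nonpos (h j) (M.angle_le_dist j le_rfl φ) (by linarith)).trans ?_
  rw [M.angle_rpow]
  exact Finset.single_le_sum (f := fun j => sinW s (2 * φ - (M.μ j).arg))
    (fun _ _ => sinW_nonneg _ _) (Finset.mem_univ j)

lemma expPt_dist (x y : ℝ) : ‖expPt 0 x - expPt 0 y‖ = 2 * |sin (x - y)| := by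
  unfold expPt
  rw [mul_zero, exp_zero, Complex.ofReal_one, one_mul, one_mul]
  have : Complex.exp ((2 * x : ℝ) * Complex.I) - Complex.exp ((2 * y : ℝ) * Complex.I)
      = Complex.exp ((x + y : ℝ) * Complex.I) * (2 * Complex.I * (sin (x - y) : ℝ)) := by
    rw [Complex.ofReal_sin, Complex.sin]
    have e1 : Complex.exp ((2 * x : ℝ) * Complex.I) = Complex.exp ((x + y : ℝ) * Complex.I)
        * Complex.exp ((x - y : ℝ) * Complex.I) := by
      rw [← Complex.exp_add]; congr 1; push_cast; ring
    have e2 : Complex.exp ((2 * y : ℝ) * Complex.I) = Complex.exp ((x + y : ℝ) * Complex.I)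
        * Complex.exp (-(x - y : ℝ) * Complex.I) := by
      rw [← Complex.exp_add]; congr 1; push_cast; ring
    rw [e1, e2]
    linear_combination (Complex.exp ((x + y : ℝ) * Complex.I)
      * (Complex.exp ((x - y : ℝ) * Complex.I) - Complex.exp (-(x - y : ℝ) * Complex.I)))
      * Complex.I_sq
  rw [this, norm_mul, Complex.norm_exp_ofReal_mul_I, one_mul, norm_mul, norm_mul, Complex.norm_I,
    Complex.norm_real, Real.norm_eq_abs]
  norm_num

lemma CriticalRoots.sin_le_dist (M : CriticalRoots a b) (x y : ℝ) (j : Fin 3) :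
    |sin (x - y)| ≤ M.dist j 0 x ∨ |sin (x - y)| ≤ M.dist j 0 y := by
  by_contra! h
  have h1 := expPt_dist x y
  have h2 : ‖expPt 0 x - expPt 0 y‖ ≤ M.dist j 0 x + M.dist j 0 y := by
    have := norm_sub_le (expPt 0 x - M.μ j) (expPt 0 y - M.μ j)
    simpa [CriticalRoots.dist] using this
  linarith [h.1, h.2]

lemma CriticalRoots.minDist_le_two (M : CriticalRoots a b) (x : ℝ) : M.minDist 0 x ≤ 2 := by
  refine (M.minDist_le 0 x 1).trans ((norm_sub_le _ _).trans ?_)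
  rw [norm_expPt, mul_zero, exp_zero]
  linarith [M.norm_one]

/-- When `|u|` is large, the first derivative of the circular phase is large away from the roots. -/
lemma CriticalRoots.mul_minDist_le (M : CriticalRoots a b) (x : ℝ)
    (h : 24 ≤ ‖(a + b * Complex.I : ℂ)‖) :
    ‖(a + b * Complex.I : ℂ)‖ * M.minDist 0 x ≤ 32 * |circ₁ a b x| := by
  set ρ := ‖(a + b * Complex.I : ℂ)‖ with hρ
  have hm := M.norm_le
  rw [← hρ] at hm
  have hd : ∀ j, |1 - ‖M.μ j‖| ≤ M.dist j 0 x := by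
    intro j
    have := M.abs_sub_norm_le j 0 x
    rwa [mul_zero, exp_zero] at this
  have h0 : ρ / 24 ≤ M.dist 0 0 x := by
    refine le_trans ?_ (hd 0)
    rw [abs_sub_comm]
    refine le_trans ?_ (le_abs_self _)
    linarith
  have hprod : ‖M.μ 0‖ * ‖M.μ 1‖ * ‖M.μ 2‖ = 1 := by
    have h0 := M.prod_eq 0
    have : M.μ 0 * M.μ 1 * M.μ 2 = 1 := by linear_combination h0
    rw [← norm_mul, ← norm_mul, this, NormOneClass.norm_one]
  have hp0 : 0 ≤ M.minDist 0 x := le_min (M.dist_nonneg _ _ _)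
    (le_min (M.dist_nonneg _ _ _) (M.dist_nonneg _ _ _))
  have key : M.minDist 0 x / 4 ≤ M.dist 1 0 x * M.dist 2 0 x := by
    by_cases h1 : ‖M.μ 1‖ ≤ 3 / 4
    · have h2 : 1 / 4 ≤ M.dist 1 0 x := by
        refine le_trans ?_ (hd 1)
        refine le_trans ?_ (le_abs_self _)
        linarith
      have := mul_le_mul h2 (M.minDist_le 0 x 2) hp0 (M.dist_nonneg _ _ _)
      linarith
    · have h1' : ‖M.μ 2‖ ≤ 3 / 4 := by
        by_contra! h3
        push Not at h1
        have h4 : (2 : ℝ) * (3 / 4) * (3 / 4) ≤ ‖M.μ 0‖ * ‖M.μ 1‖ * ‖M.μ 2‖ :=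
          prod_three_le (by norm_num) (by norm_num) (by norm_num) (by linarith) h1.le h3.le
        linarith
      have h2 : 1 / 4 ≤ M.dist 2 0 x := by
        refine le_trans ?_ (hd 2)
        refine le_trans ?_ (le_abs_self _)
        linarith
      have := mul_le_mul (M.minDist_le 0 x 1) h2 (by norm_num) (M.dist_nonneg _ _ _)
      linarith
  have := mul_le_mul h0 key (by positivity) (M.dist_nonneg _ _ _)
  rw [abs_circ₁_eq M]
  nlinarith

lemma abs_circ₂_le (x : ℝ) : |circ₂ a b x| ≤ 18 + 2 * ‖(a + b * Complex.I : ℂ)‖ := by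
  have ha : |a| ≤ ‖(a + b * Complex.I : ℂ)‖ := by
    simpa using Complex.abs_re_le_norm (a + b * Complex.I : ℂ)
  have hb : |b| ≤ ‖(a + b * Complex.I : ℂ)‖ := by
    simpa using Complex.abs_im_le_norm (a + b * Complex.I : ℂ)
  have h1 : |a * cos x| ≤ |a| := by
    rw [abs_mul]; exact mul_le_of_le_one_right (abs_nonneg _) (abs_cos_le_one x)
  have h2 : |b * sin x| ≤ |b| := by
    rw [abs_mul]; exact mul_le_of_le_one_right (abs_nonneg _) (abs_sin_le_one x)
  have h3 := abs_cos_le_one (3 * x)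
  unfold circ₂
  rw [abs_le] at h1 h2 h3 ⊢
  constructor <;> linarith [h1.1, h1.2, h2.1, h2.2, h3.1, h3.2]

end

end NovikovVeselov

namespace NovikovVeselov
open Real
variable {a b α t ω : ℝ}

lemma innerPhase_N (β φ : ℝ) : (innerPhase a b).N (β, φ)
    = 2 * (|circ₁ a b (φ + β)| ^ 2 + |circ₁ a b (φ - β)| ^ 2) := by
  rw [sq_abs, sq_abs]
  simp only [PlanePhase.N, innerPhase]
  ring

lemma innerLog_innerPhase (M : CriticalRoots a b) {β φ : ℝ} (h0 : 0 < β) (h1 : β < π / 2)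
    (hx : ∀ j, 0 < M.angle j (φ + β)) (hy : ∀ j, 0 < M.angle j (φ - β)) :
    InnerLog (log ((innerPhase a b).N (β, φ))) (log (M.minDist 0 (φ + β)))
      (log (M.minDist 0 (φ - β))) (log (sin (2 * β))) := by
  have hs : 0 < sin (2 * β) := sin_pos_of_pos_of_lt_pi (by linarith) (by linarith)
  refine innerLog_of_dist (X := fun j => M.dist j 0 (φ + β)) (Y := fun j => M.dist j 0 (φ - β))
    (M.minDist_pos le_rfl hx) (M.minDist_pos le_rfl hy) hs (sin_le_one _)
    (M.minDist_le _ _) (M.minDist_le _ _) ?_ ?_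
  · intro j
    have := M.sin_le_dist (φ + β) (φ - β) j
    rwa [show φ + β - (φ - β) = 2 * β by ring, abs_of_pos hs] at this
  · rw [innerPhase_N, abs_circ₁_eq M, abs_circ₁_eq M]
    nlinarith [sq_nonneg (M.dist 0 0 (φ + β) * M.dist 1 0 (φ + β) * M.dist 2 0 (φ + β)),
      sq_nonneg (M.dist 0 0 (φ - β) * M.dist 1 0 (φ - β) * M.dist 2 0 (φ - β))]

lemma abs_circ₁_le_sqrt (β φ : ℝ) :
    |circ₁ a b (φ + β)| ≤ √((innerPhase a b).N (β, φ)) := by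
  refine Real.le_sqrt_of_sq_le ?_
  rw [innerPhase_N]
  nlinarith [sq_nonneg |circ₁ a b (φ + β)|, sq_nonneg |circ₁ a b (φ - β)|]

lemma abs_circ₁_le_sqrt' (β φ : ℝ) :
    |circ₁ a b (φ - β)| ≤ √((innerPhase a b).N (β, φ)) := by
  refine Real.le_sqrt_of_sq_le ?_
  rw [innerPhase_N]
  nlinarith [sq_nonneg |circ₁ a b (φ + β)|, sq_nonneg |circ₁ a b (φ - β)|]

/-- One half of the contribution of the second derivatives inside the disc. -/
lemma inner_hessian_le (M : CriticalRoots a b) {n lp lr lq lt x y : ℝ} (h : InnerLog n lp lr lq)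
    (hω0 : 1 / 2 ≤ ω) (hω1 : ω ≤ 1) (hlt : 0 ≤ lt)
    (hx : M.minDist 0 x = exp lp) (hy : M.minDist 0 y = exp lr)
    (hnx : |circ₁ a b x| ≤ √(exp n)) (hny : |circ₁ a b y| ≤ √(exp n)) :
    exp lq * (|circ₂ a b x| / (exp n + (exp (2 * lq - lt) + exp (-(3 / 2 * lt)))))
      ≤ 3072 * exp (1 / 4 * lt + (1 - ω) * lt - ω * lp - ω * lr) := by
  have h3 := abs_circ₂_le (a := a) (b := b) x
  by_cases hρ : 24 ≤ ‖(a + b * Complex.I : ℂ)‖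
  · have hlog : ∀ z l : ℝ, M.minDist 0 z = exp l → |circ₁ a b z| ≤ √(exp n) →
        2 * log ‖(a + b * Complex.I : ℂ)‖ + 2 * l - 2 * log 32 ≤ n := by
      intro z l hz hn
      have h4 := M.mul_minDist_le z hρ
      rw [hz] at h4
      have h5 : ‖(a + b * Complex.I : ℂ)‖ * exp l ≤ 32 * exp (n / 2) := by
        rw [sqrt_exp] at hn
        linarith
      have h6 := log_le_log (by positivity) h5
      rw [log_mul (by positivity) (exp_pos _).ne', log_mul (by norm_num) (exp_pos _).ne',
        log_exp, log_exp] at h6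
      linarith
    have := InnerLog.hessian_le_of_large (n := n) (lp := lp) (lr := lr) (lt := lt) h.hq hω0 hω1
      hlt (log_nonneg (by linarith : 1 ≤ ‖(a + b * Complex.I : ℂ)‖)) (by norm_num : (1 : ℝ) ≤ 32)
      (abs_nonneg (circ₂ a b x))
      (by rw [exp_log (by linarith)]; linarith) (hlog x lp hx hnx) (hlog y lr hy hny)
    norm_num at this ⊢
    exact this
  · push Not at hρ
    have h4 := mul_abs_circ₂_le M x (exp_pos lp).le (fun j => hx ▸ M.minDist_le 0 x j)
    have h5 : exp lp ≤ 2 := hx ▸ M.minDist_le_two x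
    have h6 : |circ₂ a b x| ≤ 12 * exp (n / 2 - lp) := by
      rw [exp_sub, mul_div_assoc', le_div_iff₀ (exp_pos _)]
      rw [sqrt_exp] at hnx
      calc |circ₂ a b x| * exp lp = exp lp * |circ₂ a b x| := mul_comm _ _
        _ ≤ (3 * exp lp + 6) * |circ₁ a b x| := h4
        _ ≤ 12 * exp (n / 2) := by
          have : 3 * exp lp + 6 ≤ 12 := by linarith
          gcongr
    have := h.hessian_le (lt := lt) (by linarith) hω1 (abs_nonneg (circ₂ a b x))
      (by norm_num : (1 : ℝ) ≤ 66) (by norm_num : (1 : ℝ) ≤ 12) (by linarith) h6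
    refine this.trans (mul_le_mul_of_nonneg_right (by norm_num) (exp_pos _).le)

lemma norm_inner_density_le (M : CriticalRoots a b) (hα : 0 ≤ α) (hα1 : α ≤ 1 / 4) (ht : 1 ≤ t)
    (hω0 : 1 / 2 ≤ ω) (hω1 : ω ≤ 1) {β φ : ℝ} (h0 : 0 < β) (h1 : β < π / 2)
    (hx : ∀ j, 0 < M.angle j (φ + β)) (hy : ∀ j, 0 < M.angle j (φ - β)) :
    ‖(innerPhase a b).density (innerWeight α t hα (by linarith)) t (β, φ)‖
      ≤ 300000 * t ^ (-(3 / 4) + (1 - ω)) * (M.angleW ω (φ + β) * M.angleW ω (φ - β)) := by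
  have ht0 : 0 < t := by linarith
  set w := innerWeight α t hα ht0 with hw
  have hlog := innerLog_innerPhase M h0 h1 hx hy
  have hs : 0 < sin (2 * β) := sin_pos_of_pos_of_lt_pi (by linarith) (by linarith)
  have hp := M.minDist_pos le_rfl hx
  have hr := M.minDist_pos le_rfl hy
  set N := (innerPhase a b).N (β, φ) with hN
  have hA := abs_circ₁_le_sqrt (a := a) (b := b) β φ
  have hB := abs_circ₁_le_sqrt' (a := a) (b := b) β φ
  rw [← hN] at hA hB
  have hNpos : 0 < N := by
    have h5 : 0 < |circ₁ a b (φ + β)| := by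
      rw [abs_circ₁_eq M]
      have := fun j => hp.trans_le (M.minDist_le 0 (φ + β) j)
      have h0 := this 0
      have h1 := this 1
      have h2 := this 2
      positivity
    exact Real.sqrt_pos.1 (h5.trans_le hA)
  set n := log N with hn
  set lp := log (M.minDist 0 (φ + β)) with hlp
  set lr := log (M.minDist 0 (φ - β)) with hlr
  set lq := log (sin (2 * β)) with hlq
  set lt := log t with hlt
  have elt : exp lt = t := exp_log ht0
  have hlt0 : 0 ≤ lt := log_nonneg ht
  have en : exp n = N := exp_log hNpos
  have elp : exp lp = M.minDist 0 (φ + β) := exp_log hp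
  have elr : exp lr = M.minDist 0 (φ - β) := exp_log hr
  have elq : exp lq = sin (2 * β) := exp_log hs
  have hκ : w.κ β = exp (2 * lq - lt) + exp (-(3 / 2 * lt)) := by
    simp only [hw, innerWeight]
    rw [exp_sub, two_mul lq, exp_add, elq, elt, sq, Real.rpow_def_of_pos ht0]
    congr 2
    rw [← hlt]; ring
  have hb0 : 0 ≤ w.b β := innerWeight_b_nonneg hα ht0 h0.le h1.le
  have hb := innerWeight_b_le hα hα1 ht0 h0.le h1.le
  have hb' := innerWeight_b'_le hα hα1 ht0 h0.le h1.le
  have hc := innerWeight_b_mul_κ'_le hα hα1 ht0 h0.le h1.le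
  rw [← hw] at hb hb' hc
  set D := exp n + (exp (2 * lq - lt) + exp (-(3 / 2 * lt))) with hD
  have hDpos : 0 < D := by positivity
  have hDN : N + w.κ β = D := by rw [hκ, hD, en]
  have hden := (innerPhase a b).norm_density_le w t ht0 (β, φ)
    (H := |circ₂ a b (φ + β)| + |circ₂ a b (φ - β)|) (c := 16) hb0
    (by simp only [innerPhase]; exact abs_add_le _ _)
    (by simp only [innerPhase]; exact abs_sub _ _)
    (by simp only [innerPhase]; exact abs_add_le _ _) hc
  dsimp only at hden
  rw [← hN, hDN] at hden
  rw [elq.symm] at hb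
  have e1 : w.b β * w.κ β / D ≤ 4 * (2 * exp (-(3 / 4 * ω * lt) - ω * lp - ω * lr)) := by
    have := hlog.amplitude_le (lt := lt) (by linarith : 0 ≤ ω) hω1
    calc w.b β * w.κ β / D ≤ 4 * exp lq * w.κ β / D := by
          have := (w.κ_pos β).le
          gcongr
      _ = 4 * (exp lq * (w.κ β / D)) := by ring
      _ ≤ _ := by rw [hκ]; gcongr
  have e2 : (|w.b' β| + 16) * √N / D ≤ 34 * exp (3 / 4 * lt - ω / 2 * lt - ω * lp - ω * lr) := by
    have := hlog.gradient_le (lt := lt) (by linarith : 0 ≤ ω) hω1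
    rw [← en, sqrt_exp, mul_div_assoc]
    have h34 : |w.b' β| + 16 ≤ 34 := by linarith
    gcongr
  have e3 : w.b β * (|circ₂ a b (φ + β)| + |circ₂ a b (φ - β)|) / D
      ≤ 4 * (3072 * exp (1 / 4 * lt + (1 - ω) * lt - ω * lp - ω * lr)
        + 3072 * exp (1 / 4 * lt + (1 - ω) * lt - ω * lp - ω * lr)) := by
    have f1 := inner_hessian_le M hlog hω0 hω1 hlt0 elp.symm elr.symm (by rw [en]; exact hA)
      (by rw [en]; exact hB)
    have f2 := inner_hessian_le M hlog.symm hω0 hω1 hlt0 elr.symm elp.symm (by rw [en]; exact hB)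
      (by rw [en]; exact hA)
    rw [show 1 / 4 * lt + (1 - ω) * lt - ω * lr - ω * lp
      = 1 / 4 * lt + (1 - ω) * lt - ω * lp - ω * lr by ring] at f2
    calc w.b β * (|circ₂ a b (φ + β)| + |circ₂ a b (φ - β)|) / D
        ≤ 4 * exp lq * (|circ₂ a b (φ + β)| + |circ₂ a b (φ - β)|) / D := by gcongr
      _ = 4 * (exp lq * (|circ₂ a b (φ + β)| / D) + exp lq * (|circ₂ a b (φ - β)| / D)) := by ring
      _ ≤ _ := by gcongr
  set E := exp ((-(3 / 4) + (1 - ω)) * lt - ω * lp - ω * lr) with hE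
  have hη : 0 ≤ (1 - ω) * lt := mul_nonneg (by linarith) hlt0
  have g1 : exp (-(3 / 4 * ω * lt) - ω * lp - ω * lr) ≤ E := exp_le_exp.2 (by linarith)
  have g2 : exp (3 / 4 * lt - ω / 2 * lt - ω * lp - ω * lr) / t ≤ E := by
    rw [← elt, ← exp_sub]
    exact exp_le_exp.2 (by linarith)
  have g3 : exp (1 / 4 * lt + (1 - ω) * lt - ω * lp - ω * lr) / t = E := by
    rw [← elt, ← exp_sub, hE]
    congr 1; ring
  have hfin : ‖(innerPhase a b).density w t (β, φ)‖ ≤ 300000 * E := by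
    refine hden.trans ?_
    calc _ ≤ 4 * (2 * exp (-(3 / 4 * ω * lt) - ω * lp - ω * lr))
          + (34 * exp (3 / 4 * lt - ω / 2 * lt - ω * lp - ω * lr)
            + 10 * (4 * (3072 * exp (1 / 4 * lt + (1 - ω) * lt - ω * lp - ω * lr)
        + 3072 * exp (1 / 4 * lt + (1 - ω) * lt - ω * lp - ω * lr)))) / t := by gcongr
      _ = 8 * exp (-(3 / 4 * ω * lt) - ω * lp - ω * lr)
          + 34 * (exp (3 / 4 * lt - ω / 2 * lt - ω * lp - ω * lr) / t)
          + 245760 * (exp (1 / 4 * lt + (1 - ω) * lt - ω * lp - ω * lr) / t) := by ring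
      _ ≤ 8 * E + 34 * E + 245760 * E := by rw [g3]; gcongr
      _ ≤ _ := by
        have := exp_pos ((-(3 / 4) + (1 - ω)) * lt - ω * lp - ω * lr)
        rw [← hE] at this
        linarith
  refine hfin.trans ?_
  have hEeq : E = t ^ (-(3 / 4) + (1 - ω)) * (M.minDist 0 (φ + β) ^ (-ω)
      * M.minDist 0 (φ - β) ^ (-ω)) := by
    rw [Real.rpow_def_of_pos ht0, Real.rpow_def_of_pos hp, Real.rpow_def_of_pos hr, ← exp_add,
      ← exp_add, hE]
    congr 1
    rw [← hlp, ← hlr, ← hlt]; ring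
  rw [hEeq, ← mul_assoc]
  have m0 : 0 ≤ M.angleW ω (φ + β) := Finset.sum_nonneg fun _ _ => sinW_nonneg _ _
  have m1 := M.minDist_rpow_le (by linarith : 0 ≤ ω) hx
  have m2 := M.minDist_rpow_le (by linarith : 0 ≤ ω) hy
  gcongr

/-- The integral of the density over the disc of radius `2`. -/
theorem norm_integral_inner_density_le (hα : 0 ≤ α) (hα1 : α ≤ 1 / 4) (ht : 1 ≤ t)
    (hω0 : 1 / 2 ≤ ω) (hω1 : ω < 1) :
    ‖∫ β in (0 : ℝ)..(π / 2), ∫ φ in (-π)..π,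
      (innerPhase a b).density (innerWeight α t hα (by linarith)) t (β, φ)‖
      ≤ 5400000 * sinWInt ω ^ 2 * t ^ (-(3 / 4) + (1 - ω)) := by
  obtain ⟨M⟩ := nonempty_criticalRoots a b
  set w := innerWeight α t hα (by linarith) with hw
  set c := 300000 * t ^ (-(3 / 4) + (1 - ω)) with hc
  have hc0 : 0 ≤ c := by positivity
  have hpi := pi_pos
  have hint := sinWInt_nonneg ω
  rw [intervalIntegral.integral_of_le (by linarith)]
  simp_rw [intervalIntegral.integral_of_le (by linarith : -π ≤ π)]
  have key : ‖∫ β in Set.Ioc 0 (π / 2), ∫ φ in Set.Ioc (-π) π,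
      (innerPhase a b).density w t (β, φ)‖ₑ
      ≤ ENNReal.ofReal (5400000 * sinWInt ω ^ 2 * t ^ (-(3 / 4) + (1 - ω))) := by
    calc _ ≤ ∫⁻ β in Set.Ioc 0 (π / 2), ∫⁻ φ in Set.Ioc (-π) π,
          ‖(innerPhase a b).density w t (β, φ)‖ₑ :=
          (enorm_integral_le_lintegral_enorm _).trans
            (lintegral_mono fun β => enorm_integral_le_lintegral_enorm _)
      _ ≤ ∫⁻ β in Set.Ioc 0 (π / 2), ∫⁻ φ in Set.Ioc (-π) π,
          ENNReal.ofReal c * ∑ j, ∑ k,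
            ENNReal.ofReal (sinW ω (2 * (φ + β) - (M.μ j).arg))
              * ENNReal.ofReal (sinW ω (2 * (φ - β) - (M.μ k).arg)) := by
          have hne : ∀ᵐ β : ℝ ∂volume.restrict (Set.Ioc 0 (π / 2)), β ≠ π / 2 := by
            refine ae_restrict_of_ae ?_
            simp [ae_iff]
          refine lintegral_mono_ae ?_
          filter_upwards [hne, ae_restrict_mem measurableSet_Ioc] with β hβ hβ2
          refine lintegral_mono_ae (ae_restrict_of_ae ?_)
          filter_upwards [M.ae_angle_pos β, M.ae_angle_pos (-β)] with φ hx hy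
          have hb := norm_inner_density_le M hα hα1 ht hω0 hω1.le hβ2.1
            (lt_of_le_of_ne hβ2.2 hβ) hx hy
          rw [← ofReal_norm]
          refine (ENNReal.ofReal_le_ofReal hb).trans (le_of_eq ?_)
          rw [ENNReal.ofReal_mul hc0, CriticalRoots.angleW, CriticalRoots.angleW,
            Finset.sum_mul_sum, ENNReal.ofReal_sum_of_nonneg (fun j _ =>
              Finset.sum_nonneg fun k _ => mul_nonneg (sinW_nonneg _ _) (sinW_nonneg _ _))]
          congr 1
          refine Finset.sum_congr rfl fun j _ => ?_
          rw [ENNReal.ofReal_sum_of_nonneg (fun k _ =>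
            mul_nonneg (sinW_nonneg _ _) (sinW_nonneg _ _))]
          exact Finset.sum_congr rfl fun k _ => ENNReal.ofReal_mul (sinW_nonneg _ _)
      _ = ENNReal.ofReal c * ∑ j, ∑ k, ∫⁻ β in Set.Ioc 0 (π / 2), ∫⁻ φ in Set.Ioc (-π) π,
            ENNReal.ofReal (sinW ω (2 * (φ + β) - (M.μ j).arg))
              * ENNReal.ofReal (sinW ω (2 * (φ - β) - (M.μ k).arg)) := by
          have hm : ∀ j k : Fin 3, Measurable (fun p : ℝ × ℝ =>
              ENNReal.ofReal (sinW ω (2 * (p.2 + p.1) - (M.μ j).arg))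
              * ENNReal.ofReal (sinW ω (2 * (p.2 - p.1) - (M.μ k).arg))) := by
            intro j k
            have := measurable_sinW ω
            fun_prop
          have hm1 : ∀ (j k : Fin 3) (β : ℝ), Measurable (fun φ : ℝ =>
              ENNReal.ofReal (sinW ω (2 * (φ + β) - (M.μ j).arg))
              * ENNReal.ofReal (sinW ω (2 * (φ - β) - (M.μ k).arg))) := by
            intro j k β
            have := measurable_sinW ω
            fun_prop
          have hm2 : ∀ j k : Fin 3, Measurable (fun β : ℝ => ∫⁻ φ in Set.Ioc (-π) π,
              ENNReal.ofReal (sinW ω (2 * (φ + β) - (M.μ j).arg))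
              * ENNReal.ofReal (sinW ω (2 * (φ - β) - (M.μ k).arg))) :=
            fun j k => (hm j k).lintegral_prod_right'
          have i1 : ∀ β : ℝ, ∫⁻ φ in Set.Ioc (-π) π, ENNReal.ofReal c * ∑ j, ∑ k,
            ENNReal.ofReal (sinW ω (2 * (φ + β) - (M.μ j).arg))
              * ENNReal.ofReal (sinW ω (2 * (φ - β) - (M.μ k).arg))
              = ENNReal.ofReal c * ∑ j, ∑ k, ∫⁻ φ in Set.Ioc (-π) π,
              ENNReal.ofReal (sinW ω (2 * (φ + β) - (M.μ j).arg))
              * ENNReal.ofReal (sinW ω (2 * (φ - β) - (M.μ k).arg)) := by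
            intro β
            rw [lintegral_const_mul _ (Finset.measurable_fun_sum _ fun j _ =>
              Finset.measurable_fun_sum _ fun k _ => hm1 j k β),
              lintegral_finsetSum _ fun j _ => Finset.measurable_fun_sum _ fun k _ => hm1 j k β]
            congr 1
            exact Finset.sum_congr rfl fun j _ => lintegral_finsetSum _ fun k _ => hm1 j k β
          simp_rw [i1]
          rw [lintegral_const_mul _ (Finset.measurable_fun_sum _ fun j _ =>
              Finset.measurable_fun_sum _ fun k _ => hm2 j k),
              lintegral_finsetSum _ fun j _ => Finset.measurable_fun_sum _ fun k _ => hm2 j k]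
          congr 1
          exact Finset.sum_congr rfl fun j _ => lintegral_finsetSum _ fun k _ => hm2 j k
      _ ≤ ENNReal.ofReal c * ∑ _j : Fin 3, ∑ _k : Fin 3,
          ENNReal.ofReal (2 * sinWInt ω ^ 2) := by
          gcongr with j _ k _
          exact lintegral_sinW_mul_sinW (by linarith) hω1 _ _
      _ = _ := by
          rw [← ENNReal.ofReal_sum_of_nonneg (fun _ _ => by positivity),
            ← ENNReal.ofReal_sum_of_nonneg (fun _ _ => Finset.sum_nonneg fun _ _ => by positivity),
            ← ENNReal.ofReal_mul hc0]
          congr 1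
          simp [hc]
          ring
  rw [← ofReal_norm] at key
  exact (ENNReal.ofReal_le_ofReal_iff (by positivity)).1 key

end NovikovVeselov

namespace NovikovVeselov
open Real

/-- The amplitude outside the disc of radius `2`, with a constant regularization. -/
noncomputable def outerWeight (α κ₀ : ℝ) (hα : 0 ≤ α) (hκ : 0 < κ₀) : RadialWeight where
  b τ := 2 ^ (2 + α) * (sinh τ * cosh τ ^ (1 + α))
  b' τ := 2 ^ (2 + α) * (cosh τ * cosh τ ^ (1 + α) + (1 + α) * sinh τ ^ 2 * cosh τ ^ α)
  κ _ := κ₀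
  κ' _ := 0
  deriv_b x := by
    have h1 : HasDerivAt (fun β => cosh β ^ (1 + α)) (sinh x * (1 + α) * cosh x ^ (1 + α - 1)) x :=
      (hasDerivAt_cosh x).rpow_const (Or.inr (by linarith))
    rw [add_sub_cancel_left] at h1
    exact (((hasDerivAt_sinh x).mul h1).const_mul _).congr_deriv (by ring)
  deriv_κ x := hasDerivAt_const _ _
  cont_b' := by
    have h1 : Continuous (fun β => cosh β ^ (1 + α)) :=
      continuous_cosh.rpow_const fun _ => Or.inr (by linarith)
    have h2 : Continuous (fun β => cosh β ^ α) :=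
      continuous_cosh.rpow_const fun _ => Or.inr hα
    fun_prop
  cont_κ' := continuous_const
  κ_pos _ := hκ

section
variable {α κ₀ τ : ℝ}

lemma cosh_le_exp (hτ : 0 ≤ τ) : cosh τ ≤ exp τ := by
  rw [cosh_eq]
  have : exp (-τ) ≤ exp τ := exp_le_exp.2 (by linarith)
  linarith

lemma cosh_rpow_le (hτ : 0 ≤ τ) {s : ℝ} (hs : 0 ≤ s) : cosh τ ^ s ≤ exp (s * τ) := by
  rw [mul_comm, exp_mul]
  exact Real.rpow_le_rpow (cosh_pos τ).le (cosh_le_exp hτ) hs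

lemma outerWeight_b_nonneg (hα : 0 ≤ α) (hκ : 0 < κ₀) (hτ : 0 ≤ τ) :
    0 ≤ (outerWeight α κ₀ hα hκ).b τ := by
  have h1 := sinh_nonneg_iff.2 hτ
  have h2 := cosh_pos τ
  simp only [outerWeight]
  positivity

lemma outerWeight_b_le (hα : 0 ≤ α) (hα1 : α ≤ 1 / 4) (hκ : 0 < κ₀) (hτ : 0 ≤ τ) :
    (outerWeight α κ₀ hα hκ).b τ ≤ 8 * exp ((2 + α) * τ) := by
  have h1 := sinh_nonneg_iff.2 hτ
  have h2 := cosh_pos τ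
  have h3 : sinh τ ≤ exp τ := (sinh_lt_cosh τ).le.trans (cosh_le_exp hτ)
  have h4 := cosh_rpow_le hτ (by linarith : 0 ≤ 1 + α)
  simp only [outerWeight]
  calc _ ≤ 8 * (exp τ * exp ((1 + α) * τ)) := by
        gcongr
        exact two_rpow_le hα1
    _ = _ := by rw [← exp_add]; congr 2; ring

lemma outerWeight_b'_le (hα : 0 ≤ α) (hα1 : α ≤ 1 / 4) (hκ : 0 < κ₀) (hτ : 0 ≤ τ) :
    |(outerWeight α κ₀ hα hκ).b' τ| ≤ 18 * exp ((2 + α) * τ) := by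
  have h1 := sinh_nonneg_iff.2 hτ
  have h2 := cosh_pos τ
  have h3 : sinh τ ≤ exp τ := (sinh_lt_cosh τ).le.trans (cosh_le_exp hτ)
  have h4 := cosh_rpow_le hτ (by linarith : 0 ≤ 1 + α)
  have h5 := cosh_rpow_le hτ hα
  have h6 := cosh_le_exp hτ
  simp only [outerWeight]
  rw [abs_of_nonneg (by positivity)]
  calc _ ≤ 8 * (exp τ * exp ((1 + α) * τ) + (1 + 1 / 4) * exp τ ^ 2 * exp (α * τ)) := by
        gcongr
        exact two_rpow_le hα1
    _ = 8 * (exp ((2 + α) * τ) + (1 + 1 / 4) * exp ((2 + α) * τ)) := by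
        rw [← exp_add, sq, ← exp_add, mul_assoc, ← exp_add]
        congr 3
        · ring_nf
        · congr 2; ring
    _ = _ := by ring

lemma exp_two_le_nine : exp 2 ≤ 9 := by
  have h := exp_one_lt_d9.le
  have h0 := exp_pos 1
  rw [show (2 : ℝ) = 1 + 1 by norm_num, exp_add]
  nlinarith

lemma outerWeight_b_le_of_le_one (hα : 0 ≤ α) (hα1 : α ≤ 1 / 4) (hκ : 0 < κ₀) (hτ : 0 ≤ τ)
    (hτ1 : τ ≤ 1) : (outerWeight α κ₀ hα hκ).b τ ≤ 36 * (exp (2 * τ) - 1) := by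
  have h1 := sinh_nonneg_iff.2 hτ
  have h2 := cosh_pos τ
  have h4 := cosh_rpow_le hτ (by linarith : 0 ≤ 1 + α)
  have h5 : exp ((1 + α) * τ) ≤ 9 := by
    refine le_trans (exp_le_exp.2 ?_) exp_two_le_nine
    nlinarith
  have h6 : sinh τ ≤ (exp (2 * τ) - 1) / 2 := by
    rw [sinh_eq]
    have e1 : exp (2 * τ) = exp τ * exp τ := by rw [← exp_add]; congr 1; ring
    have e2 : exp τ * exp (-τ) = 1 := by rw [← exp_add]; simp
    have e3 : 1 ≤ exp τ := one_le_exp hτ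
    have e4 := exp_pos (-τ)
    have e5 : exp (-τ) ≤ 1 := exp_le_one_iff.2 (by linarith)
    rw [e1]
    nlinarith
  have h7 := h4.trans h5
  simp only [outerWeight]
  calc _ ≤ 8 * ((exp (2 * τ) - 1) / 2 * 9) := by
        gcongr
        · exact two_rpow_le hα1
        · have : 1 ≤ exp (2 * τ) := one_le_exp (by linarith)
          linarith
    _ = _ := by ring

lemma outerWeight_b'_le_of_le_one (hα : 0 ≤ α) (hα1 : α ≤ 1 / 4) (hκ : 0 < κ₀) (hτ : 0 ≤ τ)
    (hτ1 : τ ≤ 1) : |(outerWeight α κ₀ hα hκ).b' τ| ≤ 1458 := by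
  refine (outerWeight_b'_le hα hα1 hκ hτ).trans ?_
  have h1 : exp ((2 + α) * τ) ≤ exp (2 + 2) := exp_le_exp.2 (by nlinarith)
  rw [exp_add] at h1
  have h2 := exp_two_le_nine
  have h3 := exp_pos 2
  nlinarith

end

section Near
variable {n lp lq lt ω S N : ℝ}

lemma near_bounds (hω0 : 0 ≤ ω) (hω1 : ω ≤ 1) (hlt : 0 ≤ lt) (hn : exp n = 16 * N)
    (h1 : 6 * lp ≤ n)
    (h2 : 2 * lp + 4 * lq ≤ n) (hq : exp lq ≤ 9) (hp : exp lp ≤ 10)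
    (hS : S ≤ 84 * exp (n / 2 - lp)) :
    exp lq * (exp (-(3 / 2 * lt)) / (N + exp (-(3 / 2 * lt))))
        ≤ 1440 * exp ((-(3 / 4) + (1 - ω)) * lt - (1 + ω) * lp)
      ∧ √N / (N + exp (-(3 / 2 * lt))) / exp lt
        ≤ 160 * exp ((-(3 / 4) + (1 - ω)) * lt - (1 + ω) * lp)
      ∧ exp lq * (S / (N + exp (-(3 / 2 * lt)))) / exp lt
        ≤ 12096 * exp ((-(3 / 4) + (1 - ω)) * lt - (1 + ω) * lp) := by
  have hN : 0 < N := by have := exp_pos n; linarith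
  have hk := exp_pos (-(3 / 2 * lt))
  have hinv : 1 / (N + exp (-(3 / 2 * lt))) ≤ 16 * (1 / (exp n + exp (-(3 / 2 * lt)))) := by
    rw [hn, mul_one_div, div_le_div_iff₀ (by positivity) (by positivity)]
    linarith
  have hsq : √N ≤ exp (n / 2) := by
    rw [← sqrt_exp, hn]
    exact Real.sqrt_le_sqrt (by linarith)
  have hqω : exp ((1 - ω) * lq) ≤ 9 := by
    rw [mul_comm, exp_mul]
    calc exp lq ^ (1 - ω) ≤ 9 ^ (1 - ω) := by
          have : 0 ≤ 1 - ω := by linarith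
          gcongr
      _ ≤ 9 ^ (1 : ℝ) := Real.rpow_le_rpow_of_exponent_le (by norm_num) (by linarith)
      _ = 9 := by norm_num
  have hpω : exp ((1 - ω) * lp) ≤ 10 := by
    rw [mul_comm, exp_mul]
    calc exp lp ^ (1 - ω) ≤ 10 ^ (1 - ω) := by
          have : 0 ≤ 1 - ω := by linarith
          gcongr
      _ ≤ 10 ^ (1 : ℝ) := Real.rpow_le_rpow_of_exponent_le (by norm_num) (by linarith)
      _ = 10 := by norm_num
  have hη : 0 ≤ (1 - ω) * lt := mul_nonneg (by linarith) hlt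
  set E := exp ((-(3 / 4) + (1 - ω)) * lt - (1 + ω) * lp) with hE
  have hE0 : 0 < E := exp_pos _
  have a1 := mul_le_mul_of_nonneg_left h1 (by linarith : 0 ≤ ω / 4)
  have a2 := mul_le_mul_of_nonneg_left h2 (by linarith : 0 ≤ ω / 4)
  have a3 := mul_le_mul_of_nonneg_left h1 (by linarith : 0 ≤ ω / 12)
  have a4 := mul_le_mul_of_nonneg_left h1 (by linarith : 0 ≤ ω / 3)
  have y1 : 1 / (exp n + exp (-(3 / 2 * lt))) ≤ _ :=
    one_div_exp_add_exp_le (θ := ω / 2) (by linarith) (by linarith)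
  have y2 : 1 / (exp n + exp (-(3 / 2 * lt))) ≤ _ :=
    one_div_exp_add_exp_le (θ := 1 / 2 + ω / 3) (by linarith) (by linarith)
  refine ⟨?_, ?_, ?_⟩
  · calc _ = exp lq * (exp (-(3 / 2 * lt)) * (1 / (N + exp (-(3 / 2 * lt))))) := by ring
      _ ≤ exp lq * (exp (-(3 / 2 * lt)) * (16 * exp (-(ω / 2 * n
          + (1 - ω / 2) * -(3 / 2 * lt))))) := by
        gcongr
        exact hinv.trans (by gcongr)
      _ = 16 * exp (lq + (-(3 / 2 * lt) + (-(ω / 2 * n + (1 - ω / 2) * -(3 / 2 * lt))))) := by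
        rw [exp_add, exp_add]; ring
      _ ≤ 16 * exp ((1 - ω) * lq + ((1 - ω) * lp + ((-(3 / 4) + (1 - ω)) * lt - (1 + ω) * lp))) :=
        mul_le_mul_of_nonneg_left (exp_le_exp.2 (by linarith)) (by norm_num)
      _ = 16 * (exp ((1 - ω) * lq) * (exp ((1 - ω) * lp) * E)) := by rw [exp_add, exp_add]
      _ ≤ 16 * (9 * (10 * E)) := by gcongr
      _ = _ := by ring
  · calc _ = √N * (1 / (N + exp (-(3 / 2 * lt)))) / exp lt := by ring
      _ ≤ exp (n / 2) * (16 * exp (-((1 / 2 + ω / 3) * n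
          + (1 - (1 / 2 + ω / 3)) * -(3 / 2 * lt)))) / exp lt := by
        gcongr
        exact hinv.trans (by gcongr)
      _ = 16 * exp (n / 2 + -((1 / 2 + ω / 3) * n
          + (1 - (1 / 2 + ω / 3)) * -(3 / 2 * lt)) - lt) := by
        rw [exp_sub, exp_add]; ring
      _ ≤ 16 * exp ((1 - ω) * lp + ((-(3 / 4) + (1 - ω)) * lt - (1 + ω) * lp)) :=
        mul_le_mul_of_nonneg_left (exp_le_exp.2 (by linarith)) (by norm_num)
      _ = 16 * (exp ((1 - ω) * lp) * E) := by rw [exp_add]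
      _ ≤ 16 * (10 * E) := by gcongr
      _ = _ := by ring
  · calc _ = exp lq * (S * (1 / (N + exp (-(3 / 2 * lt))))) / exp lt := by ring
      _ ≤ exp lq * (84 * exp (n / 2 - lp) * (16 * exp (-((1 / 2 + ω / 3) * n
          + (1 - (1 / 2 + ω / 3)) * -(3 / 2 * lt))))) / exp lt := by
        gcongr
        exact hinv.trans (by gcongr)
      _ = 1344 * exp (lq + (n / 2 - lp) + -((1 / 2 + ω / 3) * n
          + (1 - (1 / 2 + ω / 3)) * -(3 / 2 * lt)) - lt) := by
        rw [exp_sub _ lt, exp_add, exp_add]; ring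
      _ ≤ 1344 * exp ((1 - ω) * lq + ((-(3 / 4) + (1 - ω)) * lt - (1 + ω) * lp)) :=
        mul_le_mul_of_nonneg_left (exp_le_exp.2 (by linarith)) (by norm_num)
      _ = 1344 * (exp ((1 - ω) * lq) * E) := by rw [exp_add]
      _ ≤ 1344 * (9 * E) := by gcongr
      _ = _ := by ring

end Near

section Far
variable {n lv τ k ω S : ℝ}

lemma far_bounds (hω0 : 0 ≤ ω) (hω1 : ω ≤ 1) (h1 : 6 * τ + 2 * lv ≤ n) (hv : lv ≤ 0)
    (hS : S ≤ 8 * exp (n / 2 - lv)) :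
    exp k / (exp n + exp k) ≤ exp (ω / 2 * k - 3 * ω * τ - (1 + ω) * lv)
      ∧ exp (n / 2) / (exp n + exp k) ≤ exp (-((1 - ω) / 2) * k - 3 * ω * τ - (1 + ω) * lv)
      ∧ S / (exp n + exp k) ≤ 8 * exp (-((1 - ω) / 2) * k - 3 * ω * τ - (1 + ω) * lv) := by
  have a1 := mul_le_mul_of_nonneg_left h1 (by linarith : 0 ≤ ω / 2)
  have y1 : 1 / (exp n + exp k) ≤ _ :=
    one_div_exp_add_exp_le (θ := ω / 2) (by linarith) (by linarith)
  have y2 : 1 / (exp n + exp k) ≤ _ :=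
    one_div_exp_add_exp_le (θ := (1 + ω) / 2) (by linarith) (by linarith)
  refine ⟨?_, ?_, ?_⟩
  · calc _ = exp k * (1 / (exp n + exp k)) := by ring
      _ ≤ exp k * exp (-(ω / 2 * n + (1 - ω / 2) * k)) := by gcongr
      _ ≤ _ := by
        rw [← exp_add]
        refine exp_le_exp.2 ?_
        linarith
  · calc _ = exp (n / 2) * (1 / (exp n + exp k)) := by ring
      _ ≤ exp (n / 2) * exp (-((1 + ω) / 2 * n + (1 - (1 + ω) / 2) * k)) := by gcongr
      _ ≤ _ := by
        rw [← exp_add]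
        refine exp_le_exp.2 ?_
        linarith
  · calc _ = S * (1 / (exp n + exp k)) := by ring
      _ ≤ (8 * exp (n / 2 - lv)) * exp (-((1 + ω) / 2 * n + (1 - (1 + ω) / 2) * k)) := by gcongr
      _ = 8 * exp (n / 2 - lv + -((1 + ω) / 2 * n + (1 - (1 + ω) / 2) * k)) := by
        rw [exp_add]; ring
      _ ≤ _ := by
        gcongr
        linarith

end Far

end NovikovVeselov

namespace NovikovVeselov
open Real
variable {a b α t ω τ φ κ₀ s : ℝ}

/-- The truncated distance of `τ` to the height of the `j`-th root. -/
noncomputable def CriticalRoots.gap (M : CriticalRoots a b) (j : Fin 3) (τ : ℝ) : ℝ :=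
  min 1 |τ - M.height j|

lemma CriticalRoots.gap_pos (M : CriticalRoots a b) {j : Fin 3} (h : τ ≠ M.height j) :
    0 < M.gap j τ := lt_min one_pos (abs_pos.2 (sub_ne_zero.2 h))

lemma rpow_neg_le_of_le {z σ d : ℝ} (hs0 : 0 ≤ s) (hσ : 0 < σ) (hd : 0 < d) (h1 : σ / 2 ≤ z)
    (h2 : d / 2 ≤ z) (hs1 : s ≤ 1) : z ^ (-(s + s)) ≤ 4 * (d ^ (-s) * σ ^ (-s)) := by
  have hz : 0 < z := by linarith
  have h2s : (1 / 2 : ℝ) ^ (-s) ≤ 2 := by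
    rw [Real.rpow_neg (by norm_num), one_div, Real.inv_rpow (by norm_num), inv_inv]
    exact (Real.rpow_le_rpow_of_exponent_le (by norm_num) hs1).trans_eq (Real.rpow_one 2)
  have key : ∀ y : ℝ, 0 < y → y / 2 ≤ z → z ^ (-s) ≤ 2 * y ^ (-s) := by
    intro y hy hyz
    calc z ^ (-s) ≤ (y / 2) ^ (-s) :=
          Real.rpow_le_rpow_of_nonpos (by linarith) hyz (by linarith)
      _ = (1 / 2) ^ (-s) * y ^ (-s) := by
          rw [← Real.mul_rpow (by norm_num) hy.le]; congr 1; ring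
      _ ≤ _ := by gcongr
  rw [show -(s + s) = -s + -s by ring, Real.rpow_add hz]
  calc _ ≤ (2 * d ^ (-s)) * (2 * σ ^ (-s)) := by
        gcongr
        · exact key d hd h2
        · exact key σ hσ h1
    _ = _ := by ring

lemma norm_outer_density_le_near (M : CriticalRoots a b) (hα : 0 ≤ α) (hα1 : α ≤ 1 / 4)
    (ht : 1 ≤ t) (hκ : 0 < κ₀) (hκt : κ₀ = exp (-(3 / 2 * log t)))
    (hω0 : 0 ≤ ω) (hω1 : ω ≤ 1) (h0 : 0 < τ) (h1 : τ ≤ 1)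
    (hang : ∀ j, 0 < M.angle j φ) (hgap : ∀ j, τ ≠ M.height j) :
    ‖(outerPhase a b).density (outerWeight α κ₀ hα hκ) t (τ, φ)‖
      ≤ 20000000 * t ^ (-(3 / 4) + (1 - ω)) * ∑ j, M.gap j τ ^ (-((1 + ω) / 2))
        * sinW ((1 + ω) / 2) (2 * φ - (M.μ j).arg) := by
  have ht0 : 0 < t := by linarith
  set w := outerWeight α κ₀ hα hκ with hw
  set N := (outerPhase a b).N (τ, φ) with hN
  set p := M.minDist τ φ with hp
  have hp0 : 0 < p := M.minDist_pos h0.le hang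
  have hd : ∀ j, p ≤ M.dist j τ φ := M.minDist_le τ φ
  set q := exp (2 * τ) - 1 with hq
  have hq0 : 0 < q := by
    have : 1 < exp (2 * τ) := one_lt_exp_iff.2 (by linarith)
    linarith
  have he2 : exp (2 * τ) ≤ 9 := (exp_le_exp.2 (by linarith)).trans exp_two_le_nine
  have hqd : ∀ j, ‖M.μ j‖ ≤ 1 → q ≤ M.dist j τ φ := by
    intro j hj
    refine le_trans ?_ (M.abs_sub_norm_le j τ φ)
    refine le_trans ?_ (le_abs_self _)
    linarith
  have hq1 := hqd 1 M.norm_one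
  have hq2 := hqd 2 M.norm_two
  have hsq := sqrt_outer_N M τ φ
  rw [← hN] at hsq
  set W := M.dist 0 τ φ * M.dist 1 τ φ * M.dist 2 τ φ with hW
  have hpW : p * p * p ≤ W := prod_three_le hp0.le hp0.le hp0.le (hd 0) (hd 1) (hd 2)
  have hpqW : p * q * q ≤ W := prod_three_le hp0.le hq0.le hq0.le (hd 0) hq1 hq2
  have hWN : W ≤ 4 * √N := by
    have h24 : exp (3 * τ) ≤ 24 := by
      have h3 := exp_one_lt_d9.le
      have h4 := exp_pos 1
      calc exp (3 * τ) ≤ exp (1 + 1 + 1) := exp_le_exp.2 (by linarith)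
        _ = exp 1 * exp 1 * exp 1 := by rw [exp_add, exp_add]
        _ ≤ 2.7182818286 * 2.7182818286 * 2.7182818286 :=
          prod_three_le h4.le h4.le h4.le h3 h3 h3
        _ ≤ 24 := by norm_num
    have h5 : exp (-(3 * τ)) * exp (3 * τ) = 1 := by rw [← exp_add]; simp
    have h6 := exp_pos (-(3 * τ))
    have hW0 : 0 ≤ W := (by positivity : 0 ≤ p * p * p).trans hpW
    have h7 : 1 ≤ 24 * exp (-(3 * τ)) := by nlinarith
    rw [hsq]
    nlinarith
  have hW2 : ∀ z : ℝ, 0 ≤ z → z ≤ W → z ^ 2 ≤ 16 * N := by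
    intro z hz hzW
    have h5 : z ≤ 4 * √N := hzW.trans hWN
    have h6 : √N * √N = N := Real.mul_self_sqrt ((outerPhase a b).N_nonneg _)
    nlinarith [Real.sqrt_nonneg N]
  have hNpos : 0 < N := by
    have := hW2 _ (by positivity) hpW
    have h2 : 0 < (p * p * p) ^ 2 := by positivity
    linarith
  set n := log (16 * N) with hn
  have en : exp n = 16 * N := exp_log (by linarith)
  have elp : exp (log p) = p := exp_log hp0
  have elq : exp (log q) = q := exp_log hq0
  have elt : exp (log t) = t := exp_log ht0
  have g1 : 6 * log p ≤ n := by
    have h2 := log_le_log (by positivity) (hW2 _ (by positivity) hpW)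
    rw [show (p * p * p) ^ 2 = p ^ 6 by ring, log_pow] at h2
    exact_mod_cast h2
  have g2 : 2 * log p + 4 * log q ≤ n := by
    have h2 := log_le_log (by positivity) (hW2 _ (by positivity) hpqW)
    rw [show (p * q * q) ^ 2 = p ^ 2 * q ^ 4 by ring, log_mul (by positivity) (by positivity),
      log_pow, log_pow] at h2
    exact_mod_cast h2
  have hp10 : p ≤ 10 := by
    refine (hd 1).trans ((norm_sub_le _ _).trans ?_)
    rw [norm_expPt]
    linarith [M.norm_one]
  have hH := mul_outerHess_le M τ φ hp0.le hd
  rw [← hN] at hH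
  have hsqn : √N ≤ exp (n / 2) := by
    rw [← sqrt_exp, en]
    exact Real.sqrt_le_sqrt (by linarith)
  have hS : outerHess a b τ φ ≤ 84 * exp (n / 2 - log p) := by
    rw [exp_sub, elp, mul_div_assoc', le_div_iff₀ hp0]
    calc _ = p * outerHess a b τ φ := mul_comm _ _
      _ ≤ _ := hH
      _ ≤ 84 * exp (n / 2) := by
        have : 3 * p + 6 * exp (2 * τ) ≤ 84 := by linarith
        gcongr
  obtain ⟨b1, b2, b3⟩ := near_bounds (ω := ω) hω0 hω1 (log_nonneg ht) en g1 g2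
    (by rw [elq]; linarith) (by rw [elp]; exact hp10) hS
  rw [elq, ← hκt] at b1
  rw [elt, ← hκt] at b2
  rw [elq, elt, ← hκt] at b3
  set E := exp ((-(3 / 4) + (1 - ω)) * log t - (1 + ω) * log p) with hE
  have hE0 : 0 < E := exp_pos _
  have hb0 := outerWeight_b_nonneg hα hκ h0.le
  have hb := outerWeight_b_le_of_le_one hα hα1 hκ h0.le h1
  have hb' := outerWeight_b'_le_of_le_one hα hα1 hκ h0.le h1
  rw [← hw] at hb hb' hb0
  have hden := (outerPhase a b).norm_density_le w t ht0 (τ, φ) (H := outerHess a b τ φ) (c := 0)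
    hb0 (abs_P₁_le τ φ) (abs_P₂_le τ φ) (abs_Q₂_le τ φ) (by simp [hw, outerWeight])
  dsimp only at hden
  have hκw : w.κ τ = κ₀ := rfl
  rw [← hN, hκw] at hden
  have hDpos : 0 < N + κ₀ := by linarith
  have hHess0 : 0 ≤ outerHess a b τ φ := norm_nonneg _
  have hEb : ‖(outerPhase a b).density w t (τ, φ)‖ ≤ 5000000 * E := by
    refine hden.trans ?_
    calc _ ≤ (36 * q) * κ₀ / (N + κ₀) + ((1458 + 0) * √N / (N + κ₀)
          + 10 * ((36 * q) * outerHess a b τ φ / (N + κ₀))) / t := by gcongr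
      _ = 36 * (q * (κ₀ / (N + κ₀))) + 1458 * (√N / (N + κ₀) / t)
          + 360 * (q * (outerHess a b τ φ / (N + κ₀)) / t) := by ring
      _ ≤ 36 * (1440 * E) + 1458 * (160 * E) + 360 * (12096 * E) := by gcongr
      _ ≤ _ := by linarith
  refine hEb.trans ?_
  have hEeq : E = t ^ (-(3 / 4) + (1 - ω)) * p ^ (-((1 + ω) / 2 + (1 + ω) / 2)) := by
    rw [Real.rpow_def_of_pos ht0, Real.rpow_def_of_pos hp0, ← exp_add, hE]
    congr 1; ring
  have hpsum : p ^ (-((1 + ω) / 2 + (1 + ω) / 2))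
      ≤ 4 * ∑ j, M.gap j τ ^ (-((1 + ω) / 2)) * sinW ((1 + ω) / 2) (2 * φ - (M.μ j).arg) := by
    obtain ⟨j, hj⟩ := M.exists_minDist_eq τ φ
    have hp1 : M.gap j τ / 2 ≤ p := by
      rw [hp, hj]
      refine le_trans ?_ (M.exp_mul_min_le j τ φ)
      exact le_mul_of_one_le_left (by have := M.gap_pos (hgap j); positivity)
        (one_le_exp (by linarith))
    have hp2 : M.angle j φ / 2 ≤ p := by
      rw [hp, hj]
      exact (half_le_self (hang j).le).trans (M.angle_le_dist j h0.le φ)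
    refine (rpow_neg_le_of_le (by linarith) (hang j) (M.gap_pos (hgap j)) hp2 hp1
      (by linarith)).trans ?_
    gcongr
    exact Finset.single_le_sum (f := fun j => M.gap j τ ^ (-((1 + ω) / 2))
      * sinW ((1 + ω) / 2) (2 * φ - (M.μ j).arg)) (fun j _ => mul_nonneg
      (Real.rpow_nonneg (M.gap_pos (hgap j)).le _) (sinW_nonneg _ _)) (Finset.mem_univ j)
  rw [hEeq]
  calc _ ≤ 5000000 * (t ^ (-(3 / 4) + (1 - ω)) * (4 * ∑ j, M.gap j τ ^ (-((1 + ω) / 2))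
        * sinW ((1 + ω) / 2) (2 * φ - (M.μ j).arg))) := by gcongr
    _ = _ := by ring

lemma norm_outer_density_le_far (M : CriticalRoots a b) (hα : 0 ≤ α) (hα1 : α ≤ 1 / 4)
    (ht : 0 < t) (hκ : 0 < κ₀) (hω0 : 0 ≤ ω) (hω1 : ω ≤ 1) (h1 : 1 ≤ τ)
    (hang : 0 < M.angle 0 φ) (hgap : τ ≠ M.height 0) :
    ‖(outerPhase a b).density (outerWeight α κ₀ hα hκ) t (τ, φ)‖
      ≤ 2800 * (κ₀ ^ (ω / 2) + κ₀ ^ (-((1 - ω) / 2)) / t) * exp (-(3 * ω - 2 - α) * τ)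
        * (M.gap 0 τ ^ (-((1 + ω) / 2)) * sinW ((1 + ω) / 2) (2 * φ - (M.μ 0).arg)) ∧
    ‖(outerPhase a b).flux (outerWeight α κ₀ hα hκ) t (τ, φ)‖
      ≤ 32 * κ₀ ^ (-((1 - ω) / 2)) * exp (-(3 * ω - 2 - α) * τ)
        * (M.gap 0 τ ^ (-((1 + ω) / 2)) * sinW ((1 + ω) / 2) (2 * φ - (M.μ 0).arg)) := by
  have h0 : 0 ≤ τ := by linarith
  set w := outerWeight α κ₀ hα hκ with hw
  set N := (outerPhase a b).N (τ, φ) with hN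
  set X := exp (2 * τ) with hX
  have hX0 : 0 < X := exp_pos _
  have hX2 : 2 ≤ X := by
    have := Real.add_one_le_exp (2 * τ)
    linarith
  have hgap0 := M.gap_pos hgap
  have hgap1 : M.gap 0 τ ≤ 1 := min_le_left _ _
  set p := min (M.dist 0 τ φ) (X / 2) with hp
  have hpX : p ≤ X / 2 := min_le_right _ _
  have hpang : X * (M.angle 0 φ / 2) ≤ p := by
    refine le_min (le_trans ?_ (M.exp_mul_angle_le 0 τ φ)) ?_
    · gcongr; linarith
    · have := M.angle_le_one 0 φ; nlinarith
  have hpgap : X * (M.gap 0 τ / 2) ≤ p := by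
    refine le_min (M.exp_mul_min_le 0 τ φ) ?_
    nlinarith
  have hp0 : 0 < p := (by positivity : 0 < X * (M.gap 0 τ / 2)).trans_le hpgap
  have hXd : ∀ j, ‖M.μ j‖ ≤ 1 → X / 2 ≤ M.dist j τ φ := by
    intro j hj
    refine le_trans ?_ (M.abs_sub_norm_le j τ φ)
    refine le_trans ?_ (le_abs_self _)
    linarith
  have hd1 := hXd 1 M.norm_one
  have hd2 := hXd 2 M.norm_two
  have hd : ∀ j, p ≤ M.dist j τ φ := by
    intro j
    fin_cases j
    · exact min_le_left _ _
    · exact hpX.trans hd1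
    · exact hpX.trans hd2
  set v := p / X with hv
  have hv0 : 0 < v := by positivity
  have hpv : p = X * v := by rw [hv]; field_simp
  have hv1 : v ≤ 1 := by rw [hv, div_le_one hX0]; linarith
  have hsq := sqrt_outer_N M τ φ
  rw [← hN] at hsq
  have hsqv : exp (3 * τ) * v ≤ √N := by
    have hW := prod_three_le hp0.le (by positivity) (by positivity) (hd 0) hd1 hd2
    have he : exp (-(3 * τ)) * (X * X * X) = exp (3 * τ) := by
      rw [hX, ← exp_add, ← exp_add, ← exp_add]; congr 1; ring
    calc exp (3 * τ) * v ≤ 6 / 4 * (exp (3 * τ) * v) := by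
          have : 0 ≤ exp (3 * τ) * v := by positivity
          linarith
      _ = 6 * exp (-(3 * τ)) * (p * (X / 2) * (X / 2)) := by rw [← he, hpv]; ring
      _ ≤ _ := by rw [hsq]; gcongr
  have hsq0 : 0 < √N := (by positivity : 0 < exp (3 * τ) * v).trans_le hsqv
  have hNpos : 0 < N := Real.sqrt_pos.1 hsq0
  set n := log N with hn
  set k := log κ₀ with hk
  have en : exp n = N := exp_log hNpos
  have ek : exp k = κ₀ := exp_log hκ
  have esq : √N = exp (n / 2) := by rw [← en, sqrt_exp]
  have elv : exp (log v) = v := exp_log hv0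
  have g1 : 6 * τ + 2 * log v ≤ n := by
    have h2 := log_le_log (by positivity) hsqv
    rw [esq, log_exp, log_mul (exp_pos _).ne' hv0.ne', log_exp] at h2
    linarith
  have hH := mul_outerHess_le M τ φ hp0.le hd
  rw [← hN] at hH
  have hS : outerHess a b τ φ ≤ 8 * exp (n / 2 - log v) := by
    rw [exp_sub, elv, mul_div_assoc', le_div_iff₀ hv0, ← esq]
    have : p * outerHess a b τ φ ≤ X * (8 * √N) := by
      refine hH.trans ?_
      have : 3 * p + 6 * exp (2 * τ) ≤ 8 * X := by rw [← hX]; linarith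
      calc _ ≤ 8 * X * √N := by gcongr
        _ = _ := by ring
    rw [hpv, mul_assoc] at this
    have := le_of_mul_le_mul_left this hX0
    linarith
  obtain ⟨b1, b2, b3⟩ := far_bounds (k := k) hω0 hω1 g1 (log_nonpos hv0.le hv1) hS
  rw [← esq] at b2
  rw [en, ek] at b1 b2 b3
  have hb0 := outerWeight_b_nonneg hα hκ h0
  have hb := outerWeight_b_le hα hα1 hκ h0
  have hb' := outerWeight_b'_le hα hα1 hκ h0
  rw [← hw] at hb hb' hb0
  have hden := (outerPhase a b).norm_density_le w t ht (τ, φ) (H := outerHess a b τ φ) (c := 0)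
    hb0 (abs_P₁_le τ φ) (abs_P₂_le τ φ) (abs_Q₂_le τ φ) (by simp [hw, outerWeight])
  have hflux := (outerPhase a b).norm_flux_le w t (τ, φ) hb0
  dsimp only at hden hflux
  have hκw : w.κ τ = κ₀ := rfl
  rw [← hN, hκw] at hden hflux
  have hHess0 : 0 ≤ outerHess a b τ φ := norm_nonneg _
  have hDpos : 0 < N + κ₀ := by linarith
  have hvs : exp (-((1 + ω) * log v)) ≤ 4 * (M.gap 0 τ ^ (-((1 + ω) / 2))
      * sinW ((1 + ω) / 2) (2 * φ - (M.μ 0).arg)) := by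
    have e1 : exp (-((1 + ω) * log v)) = v ^ (-((1 + ω) / 2 + (1 + ω) / 2)) := by
      rw [Real.rpow_def_of_pos hv0]; congr 1; ring
    rw [e1]
    refine rpow_neg_le_of_le (by linarith) hang hgap0 ?_ ?_ (by linarith)
    · rw [hpv] at hpang
      exact le_of_mul_le_mul_left hpang hX0
    · rw [hpv] at hpgap
      exact le_of_mul_le_mul_left hpgap hX0
  set V := exp (-((1 + ω) * log v)) with hV
  set R := M.gap 0 τ ^ (-((1 + ω) / 2)) * sinW ((1 + ω) / 2) (2 * φ - (M.μ 0).arg) with hR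
  have f1 : exp (ω / 2 * k - 3 * ω * τ - (1 + ω) * log v)
      = κ₀ ^ (ω / 2) * exp (-(3 * ω * τ)) * V := by
    rw [Real.rpow_def_of_pos hκ, hV, ← exp_add, ← exp_add, ← hk]; congr 1; ring
  have f2 : exp (-((1 - ω) / 2) * k - 3 * ω * τ - (1 + ω) * log v)
      = κ₀ ^ (-((1 - ω) / 2)) * exp (-(3 * ω * τ)) * V := by
    rw [Real.rpow_def_of_pos hκ, hV, ← exp_add, ← exp_add, ← hk]; congr 1; ring
  have f3 : exp ((2 + α) * τ) * exp (-(3 * ω * τ)) = exp (-(3 * ω - 2 - α) * τ) := by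
    rw [← exp_add]; congr 1; ring
  rw [f1] at b1
  rw [f2] at b2 b3
  set T := exp ((2 + α) * τ) with hT
  set Z := exp (-(3 * ω * τ)) with hZ
  set κa := κ₀ ^ (ω / 2) with hκa
  set κb := κ₀ ^ (-((1 - ω) / 2)) with hκb
  have hκa0 : 0 < κa := by positivity
  have hκb0 : 0 < κb := by positivity
  have hT0 : 0 < T := exp_pos _
  have hZ0 : 0 < Z := exp_pos _
  have hV0 : 0 < V := exp_pos _
  rw [← f3]
  constructor
  · refine hden.trans ?_
    calc _ ≤ (8 * T) * κ₀ / (N + κ₀) + ((18 * T + 0) * √N / (N + κ₀)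
          + 10 * ((8 * T) * outerHess a b τ φ / (N + κ₀))) / t := by gcongr
      _ = 8 * T * (κ₀ / (N + κ₀)) + (18 * T * (√N / (N + κ₀))
          + 80 * T * (outerHess a b τ φ / (N + κ₀))) / t := by ring
      _ ≤ 8 * T * (κa * Z * V) + (18 * T * (κb * Z * V) + 80 * T * (8 * (κb * Z * V))) / t := by
          gcongr
      _ = (8 * κa + 658 * (κb / t)) * (T * Z) * V := by ring
      _ ≤ (700 * κa + 700 * (κb / t)) * (T * Z) * (4 * R) := by
          have : 0 < κb / t := by positivity
          gcongr <;> norm_num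
      _ = _ := by ring
  · refine hflux.trans ?_
    calc _ ≤ 8 * T * (κb * Z * V) := by gcongr
      _ = 8 * κb * (T * Z) * V := by ring
      _ ≤ 8 * κb * (T * Z) * (4 * R) := by gcongr
      _ = _ := by ring

end NovikovVeselov

namespace NovikovVeselov
open Real
variable {a b α t ω τ φ κ₀ s : ℝ}

lemma integral_sinW_two {s : ℝ} (hs0 : 0 ≤ s) (hs : s < 1) (θ : ℝ) :
    ∫ φ in (-π)..π, sinW s (2 * φ - θ) = 2 * sinWInt s := by
  have := integral_sinW_affine hs0 hs (k := 2) (a := -π) (b := π) (c := -θ) (by norm_num) 4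
    (by push_cast; ring)
  simp only [← sub_eq_add_neg] at this
  rw [this]
  push_cast
  ring

lemma intervalIntegrable_sinW_two {s : ℝ} (hs0 : 0 ≤ s) (hs : s < 1) (θ : ℝ) :
    IntervalIntegrable (fun φ => sinW s (2 * φ - θ)) volume (-π) π := by
  have := intervalIntegrable_sinW_affine hs0 hs (k := 2) (by norm_num) (-θ) (-π) π
  simpa only [← sub_eq_add_neg] using this

lemma CriticalRoots.gap_rpow_le (M : CriticalRoots a b) (j : Fin 3) (s τ : ℝ) :
    M.gap j τ ^ (-s) ≤ 1 + absW s (τ - M.height j) := min_one_rpow_le _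

lemma continuous_angular_density (Φ : PlanePhase) (w : RadialWeight) (t : ℝ) :
    Continuous (fun τ => ∫ φ in (-π)..π, Φ.density w t (τ, φ)) :=
  intervalIntegral.continuous_parametric_intervalIntegral_of_continuous'
    (f := fun x y => Φ.density w t (x, y)) (Φ.continuous_density w t) _ _

/-- The integral of the truncated weight. -/
noncomputable def absWInt (s : ℝ) : ℝ := ∫ x, absW s x

lemma absWInt_nonneg (s : ℝ) : 0 ≤ absWInt s := integral_nonneg fun _ => absW_nonneg _ _

lemma integral_sub_absW (s h : ℝ) : ∫ x, absW s (x - h) = absWInt s :=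
  integral_sub_right_eq_self _ h

theorem norm_integral_outer_near_le (hα : 0 ≤ α) (hα1 : α ≤ 1 / 4) (ht : 1 ≤ t) (hκ : 0 < κ₀)
    (hκt : κ₀ = exp (-(3 / 2 * log t))) (hω0 : 0 ≤ ω) (hω1 : ω < 1) :
    ‖∫ τ in (0 : ℝ)..1, ∫ φ in (-π)..π,
      (outerPhase a b).density (outerWeight α κ₀ hα hκ) t (τ, φ)‖
      ≤ 120000000 * sinWInt ((1 + ω) / 2) * (1 + absWInt ((1 + ω) / 2))
        * t ^ (-(3 / 4) + (1 - ω)) := by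
  obtain ⟨M⟩ := nonempty_criticalRoots a b
  set s := (1 + ω) / 2 with hs
  have hs0 : 0 ≤ s := by linarith
  have hs1 : s < 1 := by linarith
  have hI := sinWInt_nonneg s
  set c := 20000000 * t ^ (-(3 / 4) + (1 - ω)) with hc
  have hc0 : 0 ≤ c := by positivity
  have hbound : ∀ᵐ τ : ℝ, τ ∈ Set.Ioc (0 : ℝ) 1 → ‖∫ φ in (-π)..π,
      (outerPhase a b).density (outerWeight α κ₀ hα hκ) t (τ, φ)‖
      ≤ c * (2 * sinWInt s) * ∑ j, (1 + absW s (τ - M.height j)) := by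
    have hae : ∀ᵐ τ : ℝ, ∀ j, τ ≠ M.height j := by
      rw [ae_all_iff]
      intro j
      simp [ae_iff]
    filter_upwards [hae] with τ hgap hτ
    have h1 : ‖∫ φ in (-π)..π, (outerPhase a b).density (outerWeight α κ₀ hα hκ) t (τ, φ)‖
        ≤ ∫ φ in (-π)..π, c * ∑ j, M.gap j τ ^ (-s) * sinW s (2 * φ - (M.μ j).arg) := by
      refine intervalIntegral.norm_integral_le_of_norm_le (by linarith [pi_pos]) ?_ ?_
      · filter_upwards [M.ae_angle_pos 0] with φ hφ _
        simp only [add_zero] at hφ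
        exact norm_outer_density_le_near M hα hα1 ht hκ hκt hω0 hω1.le hτ.1 hτ.2 hφ hgap
      · have hsum := IntervalIntegrable.sum Finset.univ (f := fun j φ =>
          M.gap j τ ^ (-s) * sinW s (2 * φ - (M.μ j).arg)) fun j _ =>
          (intervalIntegrable_sinW_two hs0 hs1 (M.μ j).arg).const_mul _
        simpa only [Finset.sum_fn] using hsum.const_mul c
    refine h1.trans ?_
    rw [intervalIntegral.integral_const_mul, intervalIntegral.integral_finsetSum fun j _ =>
      (intervalIntegrable_sinW_two hs0 hs1 (M.μ j).arg).const_mul _, mul_assoc c]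
    refine mul_le_mul_of_nonneg_left ?_ hc0
    rw [Finset.mul_sum]
    refine Finset.sum_le_sum fun j _ => ?_
    rw [intervalIntegral.integral_const_mul, integral_sinW_two hs0 hs1, mul_comm]
    exact mul_le_mul_of_nonneg_left (M.gap_rpow_le j s τ) (by positivity)
  have hint : ∀ j, Integrable (fun τ => absW s (τ - M.height j)) := fun j =>
    (integrable_absW hs1).comp_sub_right _
  have hint2 : ∀ j, IntervalIntegrable (fun τ => 1 + absW s (τ - M.height j)) volume 0 1 := fun j =>
    intervalIntegrable_const.add (hint j).intervalIntegrable
  have hsum := IntervalIntegrable.sum Finset.univ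
    (f := fun j τ => 1 + absW s (τ - M.height j)) fun j _ => hint2 j
  simp only [Finset.sum_fn] at hsum
  refine (intervalIntegral.norm_integral_le_of_norm_le zero_le_one hbound
    (hsum.const_mul _)).trans ?_
  rw [intervalIntegral.integral_const_mul, intervalIntegral.integral_finsetSum fun j _ => hint2 j]
  have hj : ∀ j, ∫ τ in (0 : ℝ)..1, (1 + absW s (τ - M.height j)) ≤ 1 + absWInt s := by
    intro j
    rw [intervalIntegral.integral_add intervalIntegrable_const
      (hint j).intervalIntegrable]
    have h2 : ∫ τ in (0 : ℝ)..1, absW s (τ - M.height j) ≤ absWInt s := by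
      rw [← integral_sub_absW s (M.height j), intervalIntegral.integral_of_le zero_le_one]
      exact setIntegral_le_integral (hint j) (Eventually.of_forall fun _ => absW_nonneg _ _)
    simpa using h2
  calc _ ≤ c * (2 * sinWInt s) * ∑ _j : Fin 3, (1 + absWInt s) := by
        gcongr with j
        exact hj j
    _ = _ := by
        simp only [Finset.sum_const, Finset.card_univ, Fintype.card_fin, nsmul_eq_mul, hc]
        push_cast
        ring

/-- The outer integral far from the circle converges, with a bound. -/
theorem exists_tendsto_outer_far (hα : 0 ≤ α) (hα1 : α ≤ 1 / 4) (ht : 0 < t) (hκ : 0 < κ₀)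
    (hω0 : 15 / 16 ≤ ω) (hω1 : ω < 1) {τ₀ : ℝ} (hτ₀ : 1 ≤ τ₀) :
    ∃ J : ℂ, Tendsto (fun L : ℝ => ∫ τ in τ₀..L, ∫ φ in (-π)..π,
      (outerPhase a b).density (outerWeight α κ₀ hα hκ) t (τ, φ)) atTop (𝓝 J) ∧
      ‖J‖ ≤ 5600 * sinWInt ((1 + ω) / 2) * (2 + absWInt ((1 + ω) / 2))
        * (κ₀ ^ (ω / 2) + κ₀ ^ (-((1 - ω) / 2)) / t) * exp (-(3 * ω - 2 - α) * τ₀) *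
          (1 / (3 * ω - 2 - α)) := by
  obtain ⟨M⟩ := nonempty_criticalRoots a b
  set s := (1 + ω) / 2 with hs
  have hs0 : 0 ≤ s := by linarith
  have hs1 : s < 1 := by linarith
  have hI := sinWInt_nonneg s
  set δ := 3 * ω - 2 - α with hδ
  have hδ0 : 0 < δ := by linarith
  have hδ1 : δ ≤ 1 := by linarith
  set c := 2800 * (κ₀ ^ (ω / 2) + κ₀ ^ (-((1 - ω) / 2)) / t) with hc
  have hc0 : 0 ≤ c := by positivity
  set G : ℝ → ℂ := fun τ => ∫ φ in (-π)..π,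
      (outerPhase a b).density (outerWeight α κ₀ hα hκ) t (τ, φ) with hG
  have hGc : Continuous G := continuous_angular_density _ _ _
  set m : ℝ → ℝ := fun τ => c * (2 * sinWInt s) * (exp (-δ * τ)
    + exp (-δ * τ₀) * absW s (τ - M.height 0)) with hm
  have hint : Integrable (fun τ => absW s (τ - M.height 0)) :=
    (integrable_absW hs1).comp_sub_right _
  have hexp : IntegrableOn (fun τ => exp (-δ * τ)) (Set.Ioi τ₀) :=
    integrableOn_exp_mul_Ioi (by linarith) τ₀
  have hmint : IntegrableOn m (Set.Ioi τ₀) :=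
    (hexp.add (hint.integrableOn.const_mul _)).const_mul _
  have hbound : ∀ᵐ τ ∂volume.restrict (Set.Ioi τ₀), ‖G τ‖ ≤ m τ := by
    have hae : ∀ᵐ τ : ℝ, τ ≠ M.height 0 := by simp [ae_iff]
    filter_upwards [ae_restrict_of_ae hae, ae_restrict_mem measurableSet_Ioi] with τ hgap hτ
    have hτ' : τ₀ < τ := hτ
    have h1 : ‖G τ‖ ≤ ∫ φ in (-π)..π, c * exp (-δ * τ) *
        (M.gap 0 τ ^ (-s) * sinW s (2 * φ - (M.μ 0).arg)) := by
      refine intervalIntegral.norm_integral_le_of_norm_le (by linarith [pi_pos]) ?_ ?_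
      · filter_upwards [M.ae_angle_pos 0] with φ hφ _
        simp only [add_zero] at hφ
        exact (norm_outer_density_le_far M hα hα1 ht hκ (by linarith) hω1.le (by linarith)
          (hφ 0) hgap).1
      · exact ((intervalIntegrable_sinW_two hs0 hs1 (M.μ 0).arg).const_mul _).const_mul _
    refine h1.trans ?_
    rw [intervalIntegral.integral_const_mul, intervalIntegral.integral_const_mul,
      integral_sinW_two hs0 hs1]
    have h2 := M.gap_rpow_le 0 s τ
    have h3 : exp (-δ * τ) ≤ exp (-δ * τ₀) := exp_le_exp.2 (by nlinarith)
    have h4 := absW_nonneg s (τ - M.height 0)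
    calc _ ≤ c * exp (-δ * τ) * ((1 + absW s (τ - M.height 0)) * (2 * sinWInt s)) := by gcongr
      _ = c * (2 * sinWInt s) * (exp (-δ * τ) + exp (-δ * τ) * absW s (τ - M.height 0)) := by ring
      _ ≤ _ := by rw [hm]; dsimp only; gcongr
  have hGint : IntegrableOn G (Set.Ioi τ₀) :=
    hmint.mono' hGc.aestronglyMeasurable hbound
  refine ⟨∫ τ in Set.Ioi τ₀, G τ, intervalIntegral_tendsto_integral_Ioi τ₀ hGint tendsto_id, ?_⟩
  refine (norm_integral_le_of_norm_le hmint hbound).trans ?_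
  rw [hm]
  dsimp only
  rw [integral_const_mul, integral_add hexp (hint.integrableOn.const_mul _), integral_const_mul,
    integral_exp_mul_Ioi (by linarith)]
  have h2 : ∫ τ in Set.Ioi τ₀, absW s (τ - M.height 0) ≤ absWInt s := by
    rw [← integral_sub_absW s (M.height 0)]
    exact setIntegral_le_integral hint (Eventually.of_forall fun _ => absW_nonneg _ _)
  have h1δ : 1 ≤ 1 / δ := by rw [le_div_iff₀ hδ0]; linarith
  have hA := absWInt_nonneg s
  calc _ ≤ c * (2 * sinWInt s) * (-exp (-δ * τ₀) / -δ + exp (-δ * τ₀) * absWInt s) := by gcongr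
    _ = c * (2 * sinWInt s) * (exp (-δ * τ₀) * (1 / δ + absWInt s * 1)) := by
        rw [neg_div_neg_eq]; ring
    _ ≤ c * (2 * sinWInt s) * (exp (-δ * τ₀) * (2 * (1 / δ) + absWInt s * (1 / δ))) := by
        gcongr
        linarith
    _ = _ := by rw [hc]; ring

lemma tendsto_outer_flux (hα : 0 ≤ α) (hα1 : α ≤ 1 / 4) (ht : 0 < t) (hκ : 0 < κ₀) :
    Tendsto (fun L : ℝ => ∫ φ in (-π)..π,
      (outerPhase a b).flux (outerWeight α κ₀ hα hκ) t (L, φ)) atTop (𝓝 0) := by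
  obtain ⟨M⟩ := nonempty_criticalRoots a b
  set ω : ℝ := 15 / 16 with hω
  set s := (1 + ω) / 2 with hs
  have hs0 : 0 ≤ s := by rw [hs, hω]; norm_num
  have hs1 : s < 1 := by rw [hs, hω]; norm_num
  set δ := 3 * ω - 2 - α with hδ
  have hδ0 : 0 < δ := by rw [hδ, hω]; linarith
  set c := 32 * κ₀ ^ (-((1 - ω) / 2)) * (2 * sinWInt s) with hc
  have hlim : Tendsto (fun L : ℝ => c * exp (-δ * L)) atTop (𝓝 0) := by
    have h1 : Tendsto (fun L : ℝ => -δ * L) atTop atBot :=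
      tendsto_id.const_mul_atTop_of_neg (by linarith)
    simpa using (tendsto_exp_atBot.comp h1).const_mul c
  refine squeeze_zero_norm' ?_ hlim
  filter_upwards [eventually_ge_atTop (1 + |M.height 0|)] with τ hτ
  have hh := le_abs_self (M.height 0)
  have hh0 := abs_nonneg (M.height 0)
  have hgap : M.gap 0 τ = 1 := by
    unfold CriticalRoots.gap
    refine min_eq_left (le_trans ?_ (le_abs_self _))
    linarith
  have hne : τ ≠ M.height 0 := by
    intro h
    linarith
  have h1 : ‖∫ φ in (-π)..π, (outerPhase a b).flux (outerWeight α κ₀ hα hκ) t (τ, φ)‖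
      ≤ ∫ φ in (-π)..π, 32 * κ₀ ^ (-((1 - ω) / 2)) * exp (-δ * τ) *
        (M.gap 0 τ ^ (-s) * sinW s (2 * φ - (M.μ 0).arg)) := by
    refine intervalIntegral.norm_integral_le_of_norm_le (by linarith [pi_pos]) ?_ ?_
    · filter_upwards [M.ae_angle_pos 0] with φ hφ _
      simp only [add_zero] at hφ
      exact (norm_outer_density_le_far M hα hα1 ht hκ (by rw [hω]; norm_num)
        (by rw [hω]; norm_num) (by linarith) (hφ 0) hne).2
    · exact ((intervalIntegrable_sinW_two hs0 hs1 (M.μ 0).arg).const_mul _).const_mul _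
  refine h1.trans (le_of_eq ?_)
  rw [intervalIntegral.integral_const_mul, intervalIntegral.integral_const_mul,
    integral_sinW_two hs0 hs1, hgap, Real.one_rpow, hc]
  ring

lemma norm_integral_outer_flux_le (hα : 0 ≤ α) (hα1 : α ≤ 1 / 4) (hκ : 0 < κ₀)
    (hτ : 0 ≤ τ) :
    ‖∫ φ in (-π)..π, (outerPhase a b).flux (outerWeight α κ₀ hα hκ) t (τ, φ)‖
      ≤ 16 * π * exp ((2 + α) * τ) / √κ₀ := by
  have h : ∀ φ ∈ Set.uIoc (-π) π,
      ‖(outerPhase a b).flux (outerWeight α κ₀ hα hκ) t (τ, φ)‖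
      ≤ 8 * exp ((2 + α) * τ) / √κ₀ := by
    intro φ _
    refine ((outerPhase a b).norm_flux_le _ t (τ, φ) (outerWeight_b_nonneg hα hκ hτ)).trans ?_
    have hb := outerWeight_b_le hα hα1 hκ hτ
    have hb0 := outerWeight_b_nonneg hα hκ hτ
    have hN := (outerPhase a b).N_nonneg (τ, φ)
    have hk : (outerWeight α κ₀ hα hκ).κ τ = κ₀ := rfl
    dsimp only
    rw [hk]
    have h1 : √((outerPhase a b).N (τ, φ)) / ((outerPhase a b).N (τ, φ) + κ₀) ≤ 1 / √κ₀ := by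
      have hs := Real.mul_self_sqrt hN
      have hs2 := Real.mul_self_sqrt hκ.le
      have hs3 := Real.sqrt_pos.2 hκ
      rw [div_le_div_iff₀ (by linarith) hs3]
      nlinarith [Real.sqrt_nonneg ((outerPhase a b).N (τ, φ)),
        sq_nonneg (√((outerPhase a b).N (τ, φ)) - √κ₀)]
    rw [div_eq_mul_one_div (8 * exp _)]
    simpa only [mul_div_assoc] using mul_le_mul hb h1 (by positivity) (by positivity)
  refine (intervalIntegral.norm_integral_le_of_norm_le_const h).trans (le_of_eq ?_)
  rw [show π - -π = 2 * π by ring, abs_of_pos (by positivity)]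
  ring

end NovikovVeselov

namespace NovikovVeselov
open Real

section
variable {a b α t R : ℝ}

/-- The phase in polar coordinates. -/
noncomputable def polarPhase (a b r φ : ℝ) : ℝ :=
  2 * (r ^ 3 - 3 * r) * cos (3 * φ) + r * (a * cos φ + b * sin φ)

/-- The integrand in polar coordinates, the Jacobian included. -/
noncomputable def polarIntegrand (α t a b r φ : ℝ) : ℂ :=
  ((r ^ (1 + α) : ℝ) : ℂ) * Complex.exp (Complex.I * t * polarPhase a b r φ)

/-- The integral over the circle of radius `r`, the Jacobian included. -/
noncomputable def circleAverage (α t a b r : ℝ) : ℂ :=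
  ∫ φ in (-π)..π, polarIntegrand α t a b r φ

lemma continuous_polarIntegrand (hα : 0 ≤ α) :
    Continuous (fun p : ℝ × ℝ => polarIntegrand α t a b p.1 p.2) := by
  unfold polarIntegrand polarPhase
  have h1 : Continuous (fun p : ℝ × ℝ => p.1 ^ (1 + α)) :=
    continuous_fst.rpow_const fun _ => Or.inr (by linarith)
  fun_prop

lemma continuous_circleAverage (hα : 0 ≤ α) : Continuous (circleAverage α t a b) :=
  intervalIntegral.continuous_parametric_intervalIntegral_of_continuous'
    (f := fun x y => polarIntegrand α t a b x y) (continuous_polarIntegrand hα) _ _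

lemma norm_polarIntegrand {r : ℝ} (hr : 0 ≤ r) (φ : ℝ) :
    ‖polarIntegrand α t a b r φ‖ = r ^ (1 + α) := by
  unfold polarIntegrand
  rw [norm_mul, show Complex.I * t * (polarPhase a b r φ : ℂ)
    = ((t * polarPhase a b r φ : ℝ) : ℂ) * Complex.I by push_cast; ring,
    Complex.norm_exp_ofReal_mul_I, mul_one, Complex.norm_real, norm_eq_abs, abs_of_nonneg]
  positivity

lemma nvPhase_polar (u : ℂ) {r : ℝ} (hr : 0 < r) (φ : ℝ) :
    nvPhase 1 u (r * (cos φ + sin φ * Complex.I)) = polarPhase u.re u.im r φ := by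
  have hr' : (r : ℂ) ≠ 0 := by exact_mod_cast hr.ne'
  have hCS : (cos φ : ℂ) ^ 2 + (sin φ : ℂ) ^ 2 = 1 := by exact_mod_cast cos_sq_add_sin_sq φ
  have hI := Complex.I_sq
  unfold nvPhase polarPhase
  rw [cos_three_mul]
  simp only [map_mul, map_add, Complex.conj_ofReal, Complex.conj_I]
  push_cast
  obtain ⟨x, y⟩ := u
  have hu : (⟨x, y⟩ : ℂ) = x + y * Complex.I := Complex.mk_eq_add_mul_I x y
  have hu' : (starRingEnd ℂ) (⟨x, y⟩ : ℂ) = x - y * Complex.I := by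
    apply Complex.ext <;> simp
  dsimp only
  rw [hu', hu]
  push_cast at hCS
  generalize Complex.cos φ = C at *
  generalize Complex.sin φ = S at *
  have h1 : (r : ℂ) * (C + S * Complex.I) * (r * (C + S * -Complex.I)) = (r : ℂ) ^ 2 := by
    linear_combination (r : ℂ) ^ 2 * hCS - (r : ℂ) ^ 2 * S ^ 2 * hI
  rw [h1]
  have h2 : (r * (C + S * Complex.I)) ^ 3 + (r * (C + S * -Complex.I)) ^ 3
      = 2 * (r : ℂ) ^ 3 * (4 * C ^ 3 - 3 * C) := by
    linear_combination (r : ℂ) ^ 3 * 6 * C * S ^ 2 * hI - (r : ℂ) ^ 3 * 6 * C * hCS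
  rw [h2]
  have h3 : 2 * (r : ℂ) ^ 3 * (4 * C ^ 3 - 3 * C) * (1 - 3 * 1 / (r : ℂ) ^ 2)
      = 2 * ((r : ℂ) ^ 3 - 3 * r) * (4 * C ^ 3 - 3 * C) := by
    field_simp
  rw [h3]
  linear_combination -(r : ℂ) * y * S * hI

lemma smul_nvIntegrand_polar (u : ℂ) {r : ℝ} (hr : 0 < r) (φ : ℝ) :
    r • nvIntegrand 1 α t u (r * (cos φ + sin φ * Complex.I))
      = polarIntegrand α t u.re u.im r φ := by
  have h1 : ‖(r : ℂ) * (cos φ + sin φ * Complex.I)‖ = r := by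
    rw [norm_mul, Complex.norm_real, norm_eq_abs, abs_of_pos hr]
    push_cast
    rw [Complex.norm_cos_add_sin_mul_I, mul_one]
  unfold nvIntegrand polarIntegrand
  rw [h1, nvPhase_polar u hr, rpow_add hr, rpow_one, Complex.real_smul]
  push_cast
  ring

theorem setIntegral_closedBall_nvIntegrand (hα : 0 ≤ α) (u : ℂ) (hR : 0 ≤ R) :
    ∫ ξ in Metric.closedBall (0 : ℂ) R, nvIntegrand 1 α t u ξ
      = ∫ r in (0 : ℝ)..R, circleAverage α t u.re u.im r := by
  rw [← integral_indicator Metric.isClosed_closedBall.measurableSet,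
    ← Complex.integral_comp_polarCoord_symm]
  have htar : polarCoord.target = Set.Ioi (0 : ℝ) ×ˢ Set.Ioo (-π) π := rfl
  have hset : polarCoord.target ∩ (Set.Iic R ×ˢ Set.univ)
      = Set.Ioc (0 : ℝ) R ×ˢ Set.Ioo (-π) π := by
    rw [htar]
    ext ⟨x, y⟩
    simp only [Set.mem_inter_iff, Set.mem_prod, Set.mem_Ioi, Set.mem_Iic, Set.mem_univ, and_true,
      Set.mem_Ioc]
    tauto
  have h1 : ∫ p in polarCoord.target, p.1 • (Metric.closedBall (0 : ℂ) R).indicator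
        (nvIntegrand 1 α t u) (Complex.polarCoord.symm p)
      = ∫ p in polarCoord.target, (Set.Iic R ×ˢ Set.univ : Set (ℝ × ℝ)).indicator
        (fun p => polarIntegrand α t u.re u.im p.1 p.2) p := by
    refine setIntegral_congr_fun polarCoord.open_target.measurableSet fun p hp => ?_
    rw [htar] at hp
    have hp1 : 0 < p.1 := hp.1
    have hn : Complex.polarCoord.symm p ∈ Metric.closedBall (0 : ℂ) R ↔
        p ∈ (Set.Iic R ×ˢ Set.univ : Set (ℝ × ℝ)) := by
      rw [mem_closedBall_zero_iff, Complex.norm_polarCoord_symm, abs_of_pos hp1]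
      simp
    by_cases h : p ∈ (Set.Iic R ×ˢ Set.univ : Set (ℝ × ℝ))
    · rw [Set.indicator_of_mem h, Set.indicator_of_mem (hn.2 h), Complex.polarCoord_symm_apply,
        smul_nvIntegrand_polar u hp1]
    · rw [Set.indicator_of_notMem h, Set.indicator_of_notMem (fun h' => h (hn.1 h')), smul_zero]
  rw [h1, setIntegral_indicator (measurableSet_Iic.prod MeasurableSet.univ), hset,
    Measure.volume_eq_prod, setIntegral_prod]
  · rw [intervalIntegral.integral_of_le hR]
    refine setIntegral_congr_fun measurableSet_Ioc fun r _ => ?_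
    dsimp only
    unfold circleAverage
    rw [intervalIntegral.integral_of_le (by linarith [pi_pos]), integral_Ioc_eq_integral_Ioo]
  · have hc : IntegrableOn (fun p : ℝ × ℝ => polarIntegrand α t u.re u.im p.1 p.2)
        (Set.Icc 0 R ×ˢ Set.Icc (-π) π) (volume.prod volume) :=
      (continuous_polarIntegrand hα).continuousOn.integrableOn_compact
        (isCompact_Icc.prod isCompact_Icc)
    exact hc.mono_set (Set.prod_mono Set.Ioc_subset_Icc_self Set.Ioo_subset_Icc_self)

theorem norm_integral_circleAverage_le (hα : 0 ≤ α) (hR : 0 ≤ R) :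
    ‖∫ r in (0 : ℝ)..R, circleAverage α t a b r‖ ≤ 2 * π * R ^ (2 + α) := by
  have h1 : ∀ r ∈ Set.uIoc 0 R, ‖circleAverage α t a b r‖ ≤ 2 * π * R ^ (1 + α) := by
    intro r hr
    rw [Set.uIoc_of_le hR] at hr
    have h2 : ∀ φ ∈ Set.uIoc (-π) π, ‖polarIntegrand α t a b r φ‖ ≤ R ^ (1 + α) := by
      intro φ _
      rw [norm_polarIntegrand hr.1.le]
      exact rpow_le_rpow hr.1.le hr.2 (by linarith)
    refine (intervalIntegral.norm_integral_le_of_norm_le_const h2).trans (le_of_eq ?_)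
    rw [show π - -π = 2 * π by ring, abs_of_pos (by positivity)]
    ring
  refine (intervalIntegral.norm_integral_le_of_norm_le_const h1).trans (le_of_eq ?_)
  rw [sub_zero, abs_of_nonneg hR, show 2 + α = 1 + α + 1 by ring,
    rpow_add_one' hR (by linarith)]
  ring

lemma polarPhase_two_cos (β φ : ℝ) :
    polarPhase a b (2 * cos β) φ = (innerPhase a b).ψ (β, φ) := by
  have h : (innerPhase a b).ψ (β, φ) = circ a b (φ + β) + circ a b (φ - β) := rfl
  rw [h]
  unfold polarPhase circ
  have h3 : 2 * ((2 * cos β) ^ 3 - 3 * (2 * cos β)) = 4 * cos (3 * β) := by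
    rw [cos_three_mul]; ring
  rw [h3, mul_add 3, mul_sub 3, cos_add, cos_add, cos_sub, cos_sub, sin_add, sin_sub]
  ring

lemma polarPhase_two_cosh (τ φ : ℝ) :
    polarPhase a b (2 * cosh τ) φ = (outerPhase a b).ψ (τ, φ) := by
  have h : (outerPhase a b).ψ (τ, φ) = 4 * (cosh (3 * τ) * cos (3 * φ))
    + 2 * (cosh τ * (a * cos φ + b * sin φ)) := rfl
  rw [h, cosh_three_mul]
  unfold polarPhase
  ring

lemma two_mul_mul_rpow {s c : ℝ} (hc : 0 ≤ c) :
    2 * s * (2 * c) ^ (1 + α) = 2 ^ (2 + α) * (s * c ^ (1 + α)) := by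
  rw [mul_rpow zero_le_two hc, show 2 + α = 1 + α + 1 by ring,
    rpow_add two_pos (1 + α) 1, rpow_one]
  ring

theorem integral_circleAverage_inner (hα : 0 ≤ α) {κt : ℝ} (ht : 0 < κt) :
    ∫ r in (0 : ℝ)..2, circleAverage α t a b r
      = ∫ β in (0 : ℝ)..(π / 2), ∫ φ in (-π)..π,
        ((innerWeight α κt hα ht).b β : ℂ) * (innerPhase a b).osc t (β, φ) := by
  have h := intervalIntegral.integral_deriv_smul_comp (a := 0) (b := π / 2)
    (f := fun β => 2 * cos β) (f' := fun β => 2 * -sin β) (g := circleAverage α t a b)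
    (fun x _ => (hasDerivAt_cos x).const_mul 2) (by fun_prop) (continuous_circleAverage hα)
  simp only [cos_zero, mul_one, cos_pi_div_two, mul_zero] at h
  rw [intervalIntegral.integral_symm, ← h, ← intervalIntegral.integral_neg]
  refine intervalIntegral.integral_congr fun β hβ => ?_
  rw [Set.uIcc_of_le (by positivity)] at hβ
  have hc : 0 ≤ cos β := cos_nonneg_of_mem_Icc ⟨by linarith [hβ.1, pi_pos], hβ.2⟩
  have hb : (innerWeight α κt hα ht).b β = 2 ^ (2 + α) * (sin β * cos β ^ (1 + α)) := rfl
  simp only [Function.comp]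
  unfold circleAverage
  rw [hb, ← two_mul_mul_rpow hc, ← neg_smul, Complex.real_smul,
    ← intervalIntegral.integral_const_mul]
  refine intervalIntegral.integral_congr fun φ _ => ?_
  simp only [polarIntegrand, PlanePhase.osc]
  rw [polarPhase_two_cos]
  push_cast
  ring

theorem integral_circleAverage_outer (hα : 0 ≤ α) {κ₀ : ℝ} (hκ : 0 < κ₀) (τ₀ L : ℝ) :
    ∫ r in (2 * cosh τ₀)..(2 * cosh L), circleAverage α t a b r
      = ∫ τ in τ₀..L, ∫ φ in (-π)..π,
        ((outerWeight α κ₀ hα hκ).b τ : ℂ) * (outerPhase a b).osc t (τ, φ) := by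
  have h := intervalIntegral.integral_deriv_smul_comp (a := τ₀) (b := L)
    (f := fun β => 2 * cosh β) (f' := fun β => 2 * sinh β) (g := circleAverage α t a b)
    (fun x _ => (hasDerivAt_cosh x).const_mul 2) (by fun_prop) (continuous_circleAverage hα)
  rw [← h]
  refine intervalIntegral.integral_congr fun τ _ => ?_
  have hb : (outerWeight α κ₀ hα hκ).b τ = 2 ^ (2 + α) * (sinh τ * cosh τ ^ (1 + α)) := rfl
  simp only [Function.comp]
  unfold circleAverage
  rw [hb, ← two_mul_mul_rpow (cosh_pos τ).le, Complex.real_smul,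
    ← intervalIntegral.integral_const_mul]
  refine intervalIntegral.integral_congr fun φ _ => ?_
  simp only [polarIntegrand, PlanePhase.osc]
  rw [polarPhase_two_cosh]
  push_cast
  ring

end

end NovikovVeselov

namespace NovikovVeselov
open Real

section
variable {a b α t ω : ℝ}

lemma PlanePhase.flux_of_b_eq_zero (Φ : PlanePhase) (w : RadialWeight) (t : ℝ) {x : ℝ}
    (h : w.b x = 0) (y : ℝ) : Φ.flux w t (x, y) = 0 := by
  simp [PlanePhase.flux, h]

lemma integral_circleAverage_inner_eq_density (hα : 0 ≤ α) (ht : 0 < t) :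
    ∫ r in (0 : ℝ)..2, circleAverage α t a b r
      = ∫ β in (0 : ℝ)..(π / 2), ∫ φ in (-π)..π,
        (innerPhase a b).density (innerWeight α t hα ht) t (β, φ) := by
  have h0 : (innerWeight α t hα ht).b 0 = 0 := by simp [innerWeight]
  have h1 : (innerWeight α t hα ht).b (π / 2) = 0 := by
    simp [innerWeight, zero_rpow (show 1 + α ≠ 0 by linarith)]
  rw [integral_circleAverage_inner hα ht, (innerPhase a b).integral_osc_eq _ t ht.ne']
  simp [PlanePhase.flux_of_b_eq_zero _ _ _ h0, PlanePhase.flux_of_b_eq_zero _ _ _ h1]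

lemma integral_circleAverage_outer_eq_density (hα : 0 ≤ α) (ht : 0 < t) {κ₀ : ℝ} (hκ : 0 < κ₀)
    (τ₀ L : ℝ) :
    ∫ r in (2 * cosh τ₀)..(2 * cosh L), circleAverage α t a b r
      = (∫ τ in τ₀..L, ∫ φ in (-π)..π,
        (outerPhase a b).density (outerWeight α κ₀ hα hκ) t (τ, φ))
        + ((∫ φ in (-π)..π, (outerPhase a b).flux (outerWeight α κ₀ hα hκ) t (L, φ))
          - ∫ φ in (-π)..π, (outerPhase a b).flux (outerWeight α κ₀ hα hκ) t (τ₀, φ))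
          / (Complex.I * t) := by
  rw [integral_circleAverage_outer hα hκ, (outerPhase a b).integral_osc_eq _ t ht.ne']

lemma tendsto_arcosh_atTop : Tendsto arcosh atTop atTop := by
  refine tendsto_atTop_mono' atTop ?_ tendsto_log_atTop
  filter_upwards [eventually_ge_atTop 1] with x hx
  exact log_le_log (by linarith) (by linarith [sqrt_nonneg (x ^ 2 - 1)])

lemma isNVIntegral_of_tendsto (hα : 0 ≤ α) (u J : ℂ)
    (h : Tendsto (fun L : ℝ => ∫ r in (0 : ℝ)..(2 * cosh L), circleAverage α t u.re u.im r)
      atTop (𝓝 J)) : IsNVIntegral 1 α t u J := by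
  have h1 : Tendsto (fun R : ℝ => arcosh (R / 2)) atTop atTop :=
    tendsto_arcosh_atTop.comp (tendsto_id.atTop_div_const two_pos)
  refine (h.comp h1).congr' ?_
  filter_upwards [eventually_ge_atTop 2] with R hR
  rw [Function.comp, cosh_arcosh (by linarith), mul_div_cancel₀ R two_ne_zero,
    setIntegral_closedBall_nvIntegrand hα u (by linarith)]

/-- The constant in the bounds for the part of the integral far from the circle of radius two. -/
noncomputable def farConstant (α ω : ℝ) : ℝ :=
  11200 * sinWInt ((1 + ω) / 2) * (2 + absWInt ((1 + ω) / 2)) * (1 / (3 * ω - 2 - α))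

/-- The constant for times at least one. -/
noncomputable def lateConstant (α ω : ℝ) : ℝ :=
  5400000 * sinWInt ω ^ 2
    + 120000000 * sinWInt ((1 + ω) / 2) * (1 + absWInt ((1 + ω) / 2)) + farConstant α ω

/-- The constant for times at most one. -/
noncomputable def earlyConstant (α ω : ℝ) : ℝ :=
  2 * π * (2 * exp 1) ^ (2 + α) + farConstant α ω + 16 * π * exp (2 + α)

lemma farConstant_nonneg (h : 0 ≤ 3 * ω - 2 - α) : 0 ≤ farConstant α ω := by
  have := sinWInt_nonneg ((1 + ω) / 2)
  have := absWInt_nonneg ((1 + ω) / 2)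
  unfold farConstant
  positivity

lemma lateConstant_nonneg (h : 0 ≤ 3 * ω - 2 - α) : 0 ≤ lateConstant α ω := by
  have := sinWInt_nonneg ((1 + ω) / 2)
  have := absWInt_nonneg ((1 + ω) / 2)
  have := farConstant_nonneg h
  unfold lateConstant
  positivity

lemma earlyConstant_pos (h : 0 ≤ 3 * ω - 2 - α) : 0 < earlyConstant α ω := by
  have := farConstant_nonneg h
  unfold earlyConstant
  positivity

lemma far_bound_le {X E T : ℝ} (hδ : 0 ≤ 3 * ω - 2 - α) (h : X * E ≤ 2 * T) :
    5600 * sinWInt ((1 + ω) / 2) * (2 + absWInt ((1 + ω) / 2)) * X * E * (1 / (3 * ω - 2 - α))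
      ≤ farConstant α ω * T := by
  have h1 := sinWInt_nonneg ((1 + ω) / 2)
  have h2 := absWInt_nonneg ((1 + ω) / 2)
  calc _ = 5600 * sinWInt ((1 + ω) / 2) * (2 + absWInt ((1 + ω) / 2)) * (1 / (3 * ω - 2 - α))
        * (X * E) := by ring
    _ ≤ 5600 * sinWInt ((1 + ω) / 2) * (2 + absWInt ((1 + ω) / 2)) * (1 / (3 * ω - 2 - α))
        * (2 * T) := by gcongr
    _ = _ := by rw [farConstant]; ring

theorem exists_isNVIntegral_late (hα : 0 ≤ α) (hα1 : α ≤ 1 / 4) (ht : 1 ≤ t)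
    (hω0 : 15 / 16 ≤ ω) (hω1 : ω < 1) (u : ℂ) :
    ∃ J, IsNVIntegral 1 α t u J ∧ ‖J‖ ≤ lateConstant α ω * t ^ (-(3 / 4) + (1 - ω)) := by
  have ht0 : 0 < t := by linarith
  have hl : 0 ≤ log t := log_nonneg ht
  set κ₀ := exp (-(3 / 2 * log t)) with hκt
  have hκ : 0 < κ₀ := exp_pos _
  obtain ⟨K, hK, hKn⟩ := exists_tendsto_outer_far (a := u.re) (b := u.im) (κ₀ := κ₀) hα hα1 ht0 hκ
    hω0 hω1 (le_refl (1 : ℝ))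
  have hflux := tendsto_outer_flux (a := u.re) (b := u.im) hα hα1 ht0 hκ
  set A := ∫ r in (0 : ℝ)..2, circleAverage α t u.re u.im r with hA
  set B := ∫ τ in (0 : ℝ)..1, ∫ φ in (-π)..π,
    (outerPhase u.re u.im).density (outerWeight α κ₀ hα hκ) t (τ, φ) with hB
  refine ⟨A + B + K, isNVIntegral_of_tendsto hα u _ ?_, ?_⟩
  · have hlim := (hK.const_add (A + B)).add (hflux.div_const (Complex.I * t))
    rw [zero_div, add_zero] at hlim
    refine hlim.congr fun L => ?_
    have h0 : (outerWeight α κ₀ hα hκ).b 0 = 0 := by simp [outerWeight]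
    have h1 := integral_circleAverage_outer_eq_density (a := u.re) (b := u.im) hα ht0 hκ 0 L
    simp only [PlanePhase.flux_of_b_eq_zero _ _ _ h0, intervalIntegral.integral_zero, sub_zero,
      cosh_zero, mul_one] at h1
    have hc := continuous_circleAverage (α := α) (t := t) (a := u.re) (b := u.im) hα
    have hd := continuous_angular_density (outerPhase u.re u.im) (outerWeight α κ₀ hα hκ) t
    rw [← intervalIntegral.integral_add_adjacent_intervals (hc.intervalIntegrable 0 2)
      (hc.intervalIntegrable 2 _), h1, ← intervalIntegral.integral_add_adjacent_intervals
      (hd.intervalIntegrable 0 1) (hd.intervalIntegrable 1 L)]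
    ring
  · have h1 : ‖A‖ ≤ 5400000 * sinWInt ω ^ 2 * t ^ (-(3 / 4) + (1 - ω)) := by
      rw [hA, integral_circleAverage_inner_eq_density hα ht0]
      exact norm_integral_inner_density_le hα hα1 ht (by linarith) hω1
    have h2 : ‖B‖ ≤ 120000000 * sinWInt ((1 + ω) / 2) * (1 + absWInt ((1 + ω) / 2))
        * t ^ (-(3 / 4) + (1 - ω)) :=
      norm_integral_outer_near_le hα hα1 ht hκ hκt (by linarith) hω1
    have h3 : ‖K‖ ≤ farConstant α ω * t ^ (-(3 / 4) + (1 - ω)) := by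
      refine hKn.trans (far_bound_le (by linarith) ?_)
      have e1 : exp (-(3 * ω - 2 - α) * 1) ≤ 1 := exp_le_one_iff.2 (by linarith)
      have e2 : κ₀ ^ (ω / 2) ≤ t ^ (-(3 / 4) + (1 - ω)) := by
        rw [hκt, ← exp_mul, rpow_def_of_pos ht0]
        exact exp_le_exp.2 (by nlinarith)
      have e3 : κ₀ ^ (-((1 - ω) / 2)) / t ≤ t ^ (-(3 / 4) + (1 - ω)) := by
        rw [hκt, ← exp_mul, rpow_def_of_pos ht0]
        nth_rw 2 [← exp_log ht0]
        rw [← exp_sub]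
        exact exp_le_exp.2 (by nlinarith)
      have e4 : 0 ≤ κ₀ ^ (ω / 2) + κ₀ ^ (-((1 - ω) / 2)) / t := by positivity
      calc _ ≤ (κ₀ ^ (ω / 2) + κ₀ ^ (-((1 - ω) / 2)) / t) * 1 := by gcongr
        _ ≤ _ := by linarith
    calc _ ≤ ‖A‖ + ‖B‖ + ‖K‖ := norm_add₃_le
      _ ≤ _ := by rw [lateConstant]; linarith

theorem exists_isNVIntegral_early (hα : 0 ≤ α) (hα1 : α ≤ 1 / 4) (ht0 : 0 < t) (ht : t ≤ 1)
    (hω0 : 15 / 16 ≤ ω) (hω1 : ω < 1) (u : ℂ) :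
    ∃ J, IsNVIntegral 1 α t u J ∧ ‖J‖ ≤ earlyConstant α ω * t ^ (-((α + 2) / 3)) := by
  have hl : log t ≤ 0 := log_nonpos ht0.le ht
  have htl : t = exp (log t) := (exp_log ht0).symm
  set κ₀ := exp (-(2 * log t)) with hκt
  have hκ : 0 < κ₀ := exp_pos _
  set τ₀ := 1 - log t / 3 with hτ
  have hτ1 : 1 ≤ τ₀ := by linarith
  obtain ⟨K, hK, hKn⟩ := exists_tendsto_outer_far (a := u.re) (b := u.im) (κ₀ := κ₀) hα hα1 ht0 hκ
    hω0 hω1 hτ1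
  have hflux := tendsto_outer_flux (a := u.re) (b := u.im) hα hα1 ht0 hκ
  set A := ∫ r in (0 : ℝ)..(2 * cosh τ₀), circleAverage α t u.re u.im r with hA
  set F := ∫ φ in (-π)..π,
    (outerPhase u.re u.im).flux (outerWeight α κ₀ hα hκ) t (τ₀, φ) with hF
  refine ⟨A + K - F / (Complex.I * t), isNVIntegral_of_tendsto hα u _ ?_, ?_⟩
  · have hlim := (hK.const_add A).add ((hflux.sub_const F).div_const (Complex.I * t))
    rw [zero_sub, neg_div, ← sub_eq_add_neg] at hlim
    refine hlim.congr fun L => ?_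
    have h1 := integral_circleAverage_outer_eq_density (a := u.re) (b := u.im) hα ht0 hκ τ₀ L
    have hc := continuous_circleAverage (α := α) (t := t) (a := u.re) (b := u.im) hα
    rw [← intervalIntegral.integral_add_adjacent_intervals (hc.intervalIntegrable 0 (2 * cosh τ₀))
      (hc.intervalIntegrable (2 * cosh τ₀) _), h1, add_assoc]
  · have hT : t ^ (-((α + 2) / 3)) = exp (-((2 + α) / 3) * log t) := by
      rw [rpow_def_of_pos ht0]
      congr 1
      ring
    have h1 : ‖A‖ ≤ 2 * π * (2 * exp 1) ^ (2 + α) * t ^ (-((α + 2) / 3)) := by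
      refine (norm_integral_circleAverage_le hα (by positivity)).trans ?_
      have e1 : 2 * cosh τ₀ ≤ 2 * exp 1 * exp (-(log t / 3)) := by
        rw [mul_assoc, ← exp_add, cosh_eq, hτ, ← sub_eq_add_neg]
        have : exp (-(1 - log t / 3)) ≤ exp (1 - log t / 3) := exp_le_exp.2 (by linarith)
        linarith
      rw [mul_assoc (2 * π)]
      refine mul_le_mul_of_nonneg_left ?_ (by positivity)
      refine (rpow_le_rpow (by positivity) e1 (by linarith)).trans (le_of_eq ?_)
      rw [mul_rpow (by positivity) (exp_pos _).le, ← exp_mul, hT]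
      congr 2
      ring
    have h2 : ‖K‖ ≤ farConstant α ω * t ^ (-((α + 2) / 3)) := by
      refine hKn.trans (far_bound_le (by linarith) ?_)
      have e2 : κ₀ ^ (ω / 2) = exp (-ω * log t) := by
        rw [hκt, ← exp_mul]
        congr 1
        ring
      have e3 : κ₀ ^ (-((1 - ω) / 2)) / t = exp (-ω * log t) := by
        rw [hκt, ← exp_mul]
        nth_rw 2 [htl]
        rw [← exp_sub]
        congr 1
        ring
      rw [e2, e3, ← two_mul, mul_assoc, ← exp_add, hT]
      refine mul_le_mul_of_nonneg_left (exp_le_exp.2 ?_) zero_le_two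
      rw [hτ]
      linarith
    have h3 : ‖F / (Complex.I * t)‖ ≤ 16 * π * exp (2 + α) * t ^ (-((α + 2) / 3)) := by
      rw [norm_div, norm_mul, Complex.norm_I, one_mul, Complex.norm_real, norm_eq_abs,
        abs_of_pos ht0, div_le_iff₀ ht0]
      refine (norm_integral_outer_flux_le hα hα1 hκ (by linarith)).trans (le_of_eq ?_)
      have e1 : √κ₀ = exp (-log t) := by
        rw [hκt, ← exp_half]
        congr 1
        ring
      rw [e1, exp_neg, exp_log ht0, div_inv_eq_mul, hT, mul_assoc (16 * π) (exp (2 + α)),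
        ← exp_add]
      congr 3
      rw [hτ]
      ring
    calc _ ≤ ‖A‖ + ‖K‖ + ‖F / (Complex.I * t)‖ :=
          (norm_sub_le _ _).trans (by gcongr; exact norm_add_le _ _)
      _ ≤ _ := by rw [earlyConstant]; linarith

end

end NovikovVeselov

theorem proposition2p1 (α : ℝ) (hα0 : 0 ≤ α) (hα1 : α ≤ 1 / 4) (ε : ℝ) (hε : 0 < ε) :
    ∃ C : ℝ, 0 < C ∧ ∀ t : ℝ, 0 < t → ∀ u : ℂ, ∃ J : ℂ,
      IsNVIntegral 1 α t u J ∧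
      (1 ≤ t ∨ ε ≤ (1 - 4 * α) / 12 → ‖J‖ ≤ C * t ^ (-(3 / 4 : ℝ) + ε)) ∧
      (t ≤ 1 → ‖J‖ ≤ C * t ^ (-((α + 2) / 3))) := by
  set ω := 1 - min ε (1 / 16) with hω
  have hm1 : min ε (1 / 16) ≤ ε := min_le_left _ _
  have hm2 : min ε (1 / 16) ≤ 1 / 16 := min_le_right _ _
  have hm0 : 0 < min ε (1 / 16) := lt_min hε (by norm_num)
  have hω0 : 15 / 16 ≤ ω := by linarith
  have hω1 : ω < 1 := by linarith
  have hδ : 0 ≤ 3 * ω - 2 - α := by linarith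
  have hL := NovikovVeselov.lateConstant_nonneg hδ
  have hE := NovikovVeselov.earlyConstant_pos hδ
  refine ⟨NovikovVeselov.lateConstant α ω + NovikovVeselov.earlyConstant α ω, by linarith,
    fun t ht u => ?_⟩
  rcases le_or_gt 1 t with h1 | h1
  · obtain ⟨J, hJ, hJn⟩ := NovikovVeselov.exists_isNVIntegral_late hα0 hα1 h1 hω0 hω1 u
    refine ⟨J, hJ, fun _ => hJn.trans ?_, fun h2 => ?_⟩
    · have h3 : t ^ (-(3 / 4) + (1 - ω)) ≤ t ^ (-(3 / 4 : ℝ) + ε) :=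
        Real.rpow_le_rpow_of_exponent_le h1 (by linarith)
      have h4 : 0 ≤ t ^ (-(3 / 4 : ℝ) + ε) := by positivity
      nlinarith
    · obtain rfl : t = 1 := le_antisymm h2 h1
      simp only [Real.one_rpow] at hJn ⊢
      linarith
  · obtain ⟨J, hJ, hJn⟩ := NovikovVeselov.exists_isNVIntegral_early hα0 hα1 ht h1.le hω0 hω1 u
    have h3 : 0 ≤ t ^ (-((α + 2) / 3)) := by positivity
    have h5 : ‖J‖ ≤ (NovikovVeselov.lateConstant α ω + NovikovVeselov.earlyConstant α ω)
        * t ^ (-((α + 2) / 3)) := by nlinarith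
    refine ⟨J, hJ, fun h2 => h5.trans ?_, fun _ => h5⟩
    have h6 : ε ≤ (1 - 4 * α) / 12 := h2.resolve_left (by linarith)
    have h4 : t ^ (-((α + 2) / 3)) ≤ t ^ (-(3 / 4 : ℝ) + ε) :=
      Real.rpow_le_rpow_of_exponent_ge ht h1.le (by linarith)
    gcongr
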